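/- Let $a<b$, let $p\ge 1$ be an integer, and let $\gamma, c\in\mathbb R$ be constants with $c\ge 0$ and $\rho\in\mathbb R$. There is a constant $C>0$, depending only on $(a,b)$, $\rho$, $\gamma$, $c$ and $p$, such that for all $\beta^-,\beta^+>0$ with $\max\{\beta^-,\beta^+\}/\min\{\beta^-,\beta^+\}=\rho$ there is $h_0>0$ (depending only on $(a,b)$, $\beta^\pm$, $\gamma$, $c$, $p$) for which the following holds. Let $\alpha\in(a,b)$, let $\beta=\beta^-$ on $(a,\alpha)$ and $\beta=\beta^+$ on $(\alpha,b)$, and write $[w](\alpha)=w(\alpha^+)-w(\alpha^-)$. Let $a=x_0<x_1<\dots<x_{k-1}<\alpha<x_k<\dots<x_N=b$ be a partition with elements $\tau_i=[x_{i-1},x_i]$, lengths $h_i=x_i-x_{i-1}$ and mesh size $h=\max_i h_i\le h_0$. Let $u$ solve $$-(\beta u')'+\gamma u'+cu=f \ \text{ a.e. on } (a,\alpha)\cup(\alpha,b),\qquad u(a)=u(b)=0,\qquad [u](\alpha)=[\beta u'](\alpha)=0,$$ and suppose that $u\in C([a,b])$, that $u\in W^{p+1,\infty}(a,\alpha)$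 and $u\in W^{p+1,\infty}(\alpha,b)$, and that $[\beta u^{(j)}](\alpha)=0$ for $j=1,\dots,p$. *Trial space.* On the reference interval $[-1,1]$ let $P_n$ be the Legendre polynomials and put $\psi_0(\xi)=\frac{1-\xi}2$, $\psi_1(\xi)=\frac{1+\xi}2$, $\psi_n(\xi)=\int_{-1}^{\xi}P_{n-1}\,dt$ for $n\ge 2$. Let $\hat\alpha\in(-1,1)$ be the image of $\alpha$ under the increasing affine map $\tau_k\to[-1,1]$, let $\hat\beta=\beta^-$ on $(-1,\hat\alpha)$ and $\hat\beta=\beta^+$ on $(\hat\alpha,1)$, and let $L_n$ be a polynomial of degree $n$, orthogonal with weight $1/\hat\beta$ on $[-1,1]$ to all polynomials of lower degree. Let $\phi_0$, $\phi_1$ be the continuous functions on $[-1,1]$ that are affine on each side of $\hat\alpha$, have $\hat\beta\phi_0'$ and $\hat\beta\phi_1'$ constant, and satisfy $\phi_0(-1)=1$, $\phi_0(1)=0$, $\phi_1(-1)=0$, $\phi_1(1)=1$; for $n\ge2$ put $\phi_n(\xi)=\int_{-1}^{\xi}\hat\beta^{-1}L_{n-1}\,dt$. Let $\phi_{i,n}$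 be the pullback to $\tau_i$ of $\psi_n$ if $i\ne k$ and of $\phi_n$ if $i=k$, and let $$U_{\mathcal T}=\{v\in C([a,b]): v|_{\tau_i}\in\operatorname{span}\{\phi_{i,0},\dots,\phi_{i,p}\}\ \text{for all } i,\ v(a)=v(b)=0\}.$$ *Scheme.* Let $g_{i,1}<\dots<g_{i,p}$ be the images in $\tau_i$ of the roots of $P_p$ if $i\neq k$, and of $L_p$ if $i=k$. Put $g_{i,p+1}=g_{i+1,1}$ for $i<N$, $p_i=p$ for $i<N$ and $p_N=p-1$. Let $u_{\mathcal T}\in U_{\mathcal T}$ be a solution of the immersed finite volume scheme of degree $p$: for all real coefficients $v_{i,j}$, $1\le i\le N$, $1\le j\le p_i$, with $v_{1,0}=v_{N,p}=0$, $v_{i,0}=v_{i-1,p}$ for $i\ge 2$, and $v_{\mathcal T'}=\sum_{i=1}^N\sum_{j=1}^{p_i}v_{i,j}\chi_{[g_{i,j},g_{i,j+1}]}$, $$\sum_{i=1}^N\sum_{j=1}^p (v_{i,j}-v_{i,j-1})\,(\beta u_{\mathcal T}')(g_{i,j})+\sum_{i=1}^N\sum_{j=1}^{p_i}v_{i,j}\int_{g_{i,j}}^{g_{i,j+1}}(\gamma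 u_{\mathcal T}'+cu_{\mathcal T})\,dx=\int_a^b f\,v_{\mathcal T'}\,dx .$$ Here, if $g_{k,j}=\alpha$, then $(\beta u_{\mathcal T}')(g_{k,j})$ is the common one-sided limit of $\beta u_{\mathcal T}'$ at $\alpha$. Then $$|u-u_{\mathcal T}|_1\le C\,h^p\,\|u\|_{p+1,\infty},$$ where $|v|_1^2=\|v'\|_{L^2(a,\alpha)}^2+\|v'\|_{L^2(\alpha,b)}^2$ and $\|v\|_{p+1,\infty}$ is the maximum over $0\le j\le p+1$ of the $L^\infty$ norms of $v^{(j)}$ on $(a,\alpha)$ and on $(\alpha,b)$. -/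

import Mathlib

open MeasureTheory Filter Topology Polynomial
open scoped ENNReal ContDiff

noncomputable section

namespace IFV

/-! ### Weak derivatives and broken Sobolev spaces -/

/-- `g` is a weak derivative of order `j` of `v` on the open set `s`. -/
def IsWeakDeriv (s : Set ℝ) (j : ℕ) (v g : ℝ → ℝ) : Prop :=
  LocallyIntegrableOn v s ∧ LocallyIntegrableOn g s ∧
    ∀ φ : ℝ → ℝ, ContDiff ℝ ∞ φ → HasCompactSupport φ → tsupport φ ⊆ s →
      ∫ x in s, v x * iteratedDeriv j φ x = (-1) ^ j * ∫ x in s, g x * φ x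

/-- The seminorm `‖v^(j)‖_{L^q(s)}` of the weak derivative of order `j`. All weak derivatives agree
almost everywhere on `s`, so the infimum is their common norm; it is `⊤` if there is none. -/
def seminorm (s : Set ℝ) (j : ℕ) (q : ℝ≥0∞) (v : ℝ → ℝ) : ℝ≥0∞ :=
  ⨅ (g : ℝ → ℝ) (_ : IsWeakDeriv s j v g), eLpNorm g q (volume.restrict s)

/-- The Sobolev space `W^{m,q}(s)`. -/
def MemW (s : Set ℝ) (m : ℕ) (q : ℝ≥0∞) (v : ℝ → ℝ) : Prop :=
  ∀ j ≤ m, ∃ g, IsWeakDeriv s j v g ∧ MemLp g q (volume.restrict s)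

/-- The piecewise seminorm `|v|_1`, with
`|v|_1 ^ 2 = |v|_{1,2,(a,α)} ^ 2 + |v|_{1,2,(α,b)} ^ 2`. -/
def brokenH1Seminorm (a b α : ℝ) (v : ℝ → ℝ) : ℝ≥0∞ :=
  (seminorm (Set.Ioo a α) 1 2 v ^ 2 + seminorm (Set.Ioo α b) 1 2 v ^ 2) ^ (1 / 2 : ℝ)

/-- The piecewise norm `‖v‖_{m,∞}`: the maximum over the two subdomains and over the orders
`j ≤ m` of the essential suprema of the weak derivatives. -/
def brokenWInftyNorm (a b α : ℝ) (m : ℕ) (v : ℝ → ℝ) : ℝ≥0∞ :=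
  ⨆ j ∈ Finset.range (m + 1),
    max (seminorm (Set.Ioo a α) j ∞ v) (seminorm (Set.Ioo α b) j ∞ v)

/-- `[β v^(j)](α) = 0` with `β = βm` on the left and `β = βp` on the right of `α`: the weak
derivative of order `j` on each side has a representative with a one-sided limit at `α`, and
the weighted limits coincide. -/
def JumpZero (a b α βm βp : ℝ) (j : ℕ) (v : ℝ → ℝ) : Prop :=
  ∃ (gm gp : ℝ → ℝ) (l r : ℝ),
    IsWeakDeriv (Set.Ioo a α) j v gm ∧ IsWeakDeriv (Set.Ioo α b) j v gp ∧
    Tendsto gm (𝓝[<] α) (𝓝 l) ∧ Tendsto gp (𝓝[>] α) (𝓝 r) ∧ βp * r - βm * l = 0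

/-- The piecewise space with interface conditions of smoothness `m` and exponent `q`. The jump
conditions are imposed for the orders `1 ≤ j < m`, where one-sided traces at `α` exist; the
derivative of order `m` is only an `L^q` function. -/
structure MemWTilde (a b α βm βp : ℝ) (m : ℕ) (q : ℝ≥0∞) (v : ℝ → ℝ) : Prop where
  continuousOn : ContinuousOn v (Set.Icc a b)
  left_mem : MemW (Set.Ioo a α) m q v
  right_mem : MemW (Set.Ioo α b) m q v
  bc_left : v a = 0
  bc_right : v b = 0
  jump : ∀ j, 1 ≤ j → j < m → JumpZero a b α βm βp j v

/-! ### The interface problem -/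

/-- `-(β v')' + γ v' + c v = f` almost everywhere on `s`, where `β = β₀` is constant. -/
def SolvesOn (s : Set ℝ) (β₀ γ c : ℝ) (f v : ℝ → ℝ) : Prop :=
  ∃ g₁ g₂ : ℝ → ℝ, IsWeakDeriv s 1 v g₁ ∧ IsWeakDeriv s 2 v g₂ ∧
    ∀ᵐ x ∂(volume.restrict s), -(β₀ * g₂ x) + γ * g₁ x + c * v x = f x

/-- `u` solves the elliptic interface problem with homogeneous Dirichlet conditions. -/
structure IsExactSolution (a b α βm βp γ c : ℝ) (f u : ℝ → ℝ) : Prop where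
  left : SolvesOn (Set.Ioo a α) βm γ c f u
  right : SolvesOn (Set.Ioo α b) βp γ c f u
  bc_left : u a = 0
  bc_right : u b = 0
  jump : JumpZero a b α 1 1 0 u
  flux_jump : JumpZero a b α βm βp 1 u

/-! ### Generalized Legendre and Lobatto polynomials -/

/-- The coefficient that is `βm` on the left of the interface `α` and `βp` on the right. -/
def beta (α βm βp : ℝ) (x : ℝ) : ℝ := if x ≤ α then βm else βp

/-- The monic polynomials that are orthogonal on `[-1, 1]` with respect to the weight `w`, by the
Gram-Schmidt procedure applied to the monomials. -/
def orthPoly (w : ℝ → ℝ) : ℕ → ℝ[X]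
  | n => X ^ n - ∑ m : Fin n,
      C ((∫ t in (-1 : ℝ)..1, w t * (t ^ n * (orthPoly w m.1).eval t)) /
          (∫ t in (-1 : ℝ)..1, w t * ((orthPoly w m.1).eval t) ^ 2)) * orthPoly w m.1
  termination_by n => n
  decreasing_by all_goals exact m.2

/-- The standard Legendre polynomials, normalized by `∫ P_n ^ 2 = 2 / (2 n + 1)`. -/
def legendre (n : ℕ) : ℝ[X] :=
  C (Real.sqrt (2 / ((2 * (n : ℝ) + 1) *
    ∫ t in (-1 : ℝ)..1, ((orthPoly (fun _ => 1) n).eval t) ^ 2))) * orthPoly (fun _ => 1) n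

/-- The Lobatto polynomials on `[-1, 1]`. -/
def lobatto : ℕ → ℝ → ℝ
  | 0, ξ => (1 - ξ) / 2
  | 1, ξ => (1 + ξ) / 2
  | n + 2, ξ => ∫ t in (-1 : ℝ)..ξ, (legendre (n + 1)).eval t

/-- The generalized Legendre polynomials for the weight `1 / β` with interface `α'` in `(-1, 1)`;
their normalization is arbitrary, and they are taken monic. -/
def genLegendre (α' βm βp : ℝ) (n : ℕ) : ℝ[X] :=
  orthPoly (fun t => 1 / beta α' βm βp t) n

/-- The generalized Lobatto functions on `[-1, 1]` with interface `α'`. -/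
def genLobatto (α' βm βp : ℝ) : ℕ → ℝ → ℝ
  | 0, ξ =>
      if ξ ≤ α' then ((1 - α') * βm + (α' - ξ) * βp) / ((1 - α') * βm + (1 + α') * βp)
      else ((1 - ξ) * βm) / ((1 - α') * βm + (1 + α') * βp)
  | 1, ξ =>
      if ξ ≤ α' then ((1 + ξ) * βp) / ((1 - α') * βm + (1 + α') * βp)
      else ((ξ - α') * βm + (1 + α') * βp) / ((1 - α') * βm + (1 + α') * βp)
  | n + 2, ξ =>
      ∫ t in (-1 : ℝ)..ξ, 1 / beta α' βm βp t * (genLegendre α' βm βp (n + 1)).eval t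

/-! ### Partition, trial space, dual partition -/

/-- `a = x 0 < x 1 < ⋯ < x N = b`, and the interface lies in the interior of the `k`-th element
`[x (k - 1), x k]`, where elements are numbered `1, …, N`. -/
structure IsPartition (a b α : ℝ) (N k : ℕ) (x : ℕ → ℝ) : Prop where
  left : x 0 = a
  right : x N = b
  lt : ∀ i ∈ Finset.Icc 1 N, x (i - 1) < x i
  mem : k ∈ Finset.Icc 1 N
  lt_interface : x (k - 1) < α
  interface_lt : α < x k

/-- `h = max_i h_i`. -/
def meshSize (N : ℕ) (x : ℕ → ℝ) : ℝ := ⨆ i : Fin N, (x (i.1 + 1) - x i.1)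

/-- The affine map of the `i`-th element onto `[-1, 1]`. -/
def toRef (x : ℕ → ℝ) (i : ℕ) (t : ℝ) : ℝ := (2 * t - x (i - 1) - x i) / (x i - x (i - 1))

/-- The inverse of `toRef`. -/
def fromRef (x : ℕ → ℝ) (i : ℕ) (ξ : ℝ) : ℝ := (x (i - 1) + x i + (x i - x (i - 1)) * ξ) / 2

/-- The local basis function `φ_{i,n}`. -/
def basisFun (α βm βp : ℝ) (k : ℕ) (x : ℕ → ℝ) (i n : ℕ) (t : ℝ) : ℝ :=
  if i = k then genLobatto (toRef x k α) βm βp n (toRef x i t) else lobatto n (toRef x i t)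

/-- Membership in the trial space `U_T` of degree `p`. -/
structure MemTrial (a b α βm βp : ℝ) (p N k : ℕ) (x : ℕ → ℝ) (v : ℝ → ℝ) : Prop where
  continuousOn : ContinuousOn v (Set.Icc a b)
  mem_span : ∀ i ∈ Finset.Icc 1 N, ∃ d : ℕ → ℝ, ∀ t ∈ Set.Icc (x (i - 1)) (x i),
    v t = ∑ n ∈ Finset.range (p + 1), d n * basisFun α βm βp k x i n t
  bc_left : v a = 0
  bc_right : v b = 0

/-- The polynomial on the reference element whose roots give the Gauss points of the `i`-th
element. -/
def gaussPoly (α βm βp : ℝ) (p k : ℕ) (x : ℕ → ℝ) (i : ℕ) : ℝ[X] :=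
  if i = k then genLegendre (toRef x k α) βm βp p else legendre p

/-- The (generalized) Gauss point `g_{i,j}`, `1 ≤ j ≤ p`: the `j`-th root in increasing order,
mapped to the `i`-th element. For `j = p + 1` it is `g_{i+1,1}`. -/
def gaussPt (α βm βp : ℝ) (p k : ℕ) (x : ℕ → ℝ) (i j : ℕ) : ℝ :=
  if j ≤ p then
    fromRef x i (((gaussPoly α βm βp p k x i).roots.sort (· ≤ ·)).getD (j - 1) 0)
  else
    fromRef x (i + 1) (((gaussPoly α βm βp p k x (i + 1)).roots.sort (· ≤ ·)).getD 0 0)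

/-- The number `p_i` of interior control volumes attached to the `i`-th element. -/
def numCV (p N i : ℕ) : ℕ := if i = N then p - 1 else p

/-! ### The immersed finite volume scheme -/

/-- The coefficients `v_{i,j}`, `1 ≤ i ≤ N`, `0 ≤ j ≤ p`, with the conventions `v_{1,0} = 0`,
`v_{N,p} = 0` and `v_{i,0} = v_{i-1,p}` for `i ≥ 2`. -/
def extCoef (p N : ℕ) (v : ℕ → ℕ → ℝ) (i j : ℕ) : ℝ :=
  if j = 0 then (if i = 1 then 0 else v (i - 1) p)
  else if i = N ∧ j = p then 0 else v i j

/-- The piecewise constant test function `∑ v_{i,j} φ_{i,j}`, where `φ_{i,j}` is the characteristic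
function of the control volume `[g_{i,j}, g_{i,j+1}]`. -/
def testFun (α βm βp : ℝ) (p N k : ℕ) (x : ℕ → ℝ) (v : ℕ → ℕ → ℝ) (t : ℝ) : ℝ :=
  ∑ i ∈ Finset.Icc 1 N, ∑ j ∈ Finset.Icc 1 (numCV p N i),
    v i j * (Set.Icc (gaussPt α βm βp p k x i j) (gaussPt α βm βp p k x i (j + 1))).indicator 1 t

/-- The flux `β v'` at `t`. The derivative is taken from the left, which matters only at `t = α`:
there a trial function has a kink but its flux is continuous, so that the left-hand flux is the
value of `β v'` at `α`. -/
def flux (α βm βp : ℝ) (v : ℝ → ℝ) (t : ℝ) : ℝ :=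
  beta α βm βp t * derivWithin v (Set.Iic t) t

/-- The bilinear form of the immersed finite volume method; the test function is given by its
coefficients. -/
def bilin (α βm βp γ c : ℝ) (p N k : ℕ) (x : ℕ → ℝ) (u : ℝ → ℝ) (v : ℕ → ℕ → ℝ) : ℝ :=
  (∑ i ∈ Finset.Icc 1 N, ∑ j ∈ Finset.Icc 1 p,
    (extCoef p N v i j - extCoef p N v i (j - 1)) *
      flux α βm βp u (gaussPt α βm βp p k x i j)) +
  ∑ i ∈ Finset.Icc 1 N, ∑ j ∈ Finset.Icc 1 (numCV p N i),
    v i j * ∫ t in (gaussPt α βm βp p k x i j)..(gaussPt α βm βp p k x i (j + 1)),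
      (γ * deriv u t + c * u t)

/-- `uT` is a solution of the immersed finite volume scheme of degree `p`. -/
structure IsIFVSolution (a b α βm βp γ c : ℝ) (p N k : ℕ) (x : ℕ → ℝ) (f uT : ℝ → ℝ) :
    Prop where
  mem : MemTrial a b α βm βp p N k x uT
  eq : ∀ v : ℕ → ℕ → ℝ,
    bilin α βm βp γ c p N k x uT v = ∫ t in a..b, f t * testFun α βm βp p N k x v t

end IFV

end

/-! The scheme is a collocation method for the flux, and an energy argument for the flux error gives
the estimate directly, without an inf-sup condition or a separate projection of `u`.

Write `e = u - uT`, `w = 1 / β` and `F = β u'`. The conditions `[β u^(j)](α) = 0` for `1 ≤ j ≤ p`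
say that `F` and its derivatives up to order `p - 1` match at the interface. So `F` is globally
`C^(p-1)` with a Lipschitz derivative of order `p - 1`, although `u` has a kink
(`exists_smooth_flux`). The trial space is built so that `β uT'` is one polynomial `q` of degree
less than `p` on each element, the interface element included (`MemTrial.exists_isPrimitiveOn`).
Hence `e' = w d` with `d = F - q`.

Testing with a single control volume compares `d` at two consecutive Gauss points. With `W = γ e + c
∫ e`, it follows that `d = W - K` at all Gauss points, with one constant `K` for the whole mesh
(`IsIFVSolution.exists_flux_error_eq`). If `I` denotes interpolation at the Gauss points of an
element, then `d = (F - I F) + (I W - W) + (W - K)`. Multiply by `w d` and integrate: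

* `F - I F` is of size `h^p` (`abs_sub_interpolate_le`). * `I W - W` is controlled by the
oscillation of `W` on the element, because the Lagrange basis at Gauss points is orthogonal with
weight `w` (`IsWeight.integral_interpolate_sub_sq_le`). This oscillation is bounded by the energy `∫
w d ^ 2` times a positive power of `h`, so the term is absorbed for small `h`. * `∫ w d (W - K) = ∫
e' (γ e + c ∫ e - K) = -c ∫ e ^ 2 ≤ 0`, since `e` vanishes at both ends.

This bounds the energy (`CollocationError.energy_le`), and `(e')^2 = w * (w d ^ 2)` turns it into
the bound for `|e|_1`. The factors `max β` from the Lipschitz constant of `F` and `1 / min β` from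
`w` combine to the ratio `ρ`. -/

namespace IFV

/-! ### Primitives of integrable functions -/

/-- On `[s, t]`, the function `f` is a primitive of the integrable function `g`. -/
structure IsPrimitiveOn (f g : ℝ → ℝ) (s t : ℝ) : Prop where
  le : s ≤ t
  int : IntervalIntegrable g volume s t
  eq : ∀ x ∈ Set.Icc s t, f x = f s + ∫ y in s..x, g y

namespace IsPrimitiveOn

variable {f g f₁ g₁ : ℝ → ℝ} {s t : ℝ}

theorem int_sub (h : IsPrimitiveOn f g s t) {x y : ℝ} (hx : x ∈ Set.Icc s t)
    (hy : y ∈ Set.Icc s t) : IntervalIntegrable g volume x y :=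
  h.int.mono_set (by
    rw [Set.uIcc_of_le h.le]
    exact Set.uIcc_subset_Icc hx hy)

theorem integral_eq (h : IsPrimitiveOn f g s t) {x y : ℝ} (hx : x ∈ Set.Icc s t)
    (hy : y ∈ Set.Icc s t) : ∫ z in x..y, g z = f y - f x := by
  have hs : s ∈ Set.Icc s t := ⟨le_rfl, h.le⟩
  have := intervalIntegral.integral_interval_sub_left (h.int_sub hs hy) (h.int_sub hs hx)
  rw [h.eq x hx, h.eq y hy, ← this]
  ring

theorem continuousOn (h : IsPrimitiveOn f g s t) : ContinuousOn f (Set.Icc s t) := by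
  have := intervalIntegral.continuousOn_primitive_interval' h.int Set.left_mem_uIcc
  rw [Set.uIcc_of_le h.le] at this
  exact (continuousOn_const.add this).congr h.eq

theorem mono (h : IsPrimitiveOn f g s t) {s' t' : ℝ} (hs : s ≤ s') (hst : s' ≤ t') (ht : t' ≤ t) :
    IsPrimitiveOn f g s' t' := by
  have h1 : s' ∈ Set.Icc s t := ⟨hs, hst.trans ht⟩
  refine ⟨hst, h.int_sub h1 ⟨hs.trans hst, ht⟩, fun x hx => ?_⟩
  rw [h.integral_eq h1 ⟨hs.trans hx.1, hx.2.trans ht⟩]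
  ring

theorem sub (h : IsPrimitiveOn f g s t) (h₁ : IsPrimitiveOn f₁ g₁ s t) :
    IsPrimitiveOn (fun x => f x - f₁ x) (fun x => g x - g₁ x) s t := by
  refine ⟨h.le, h.int.sub h₁.int, fun x hx => ?_⟩
  have hs : s ∈ Set.Icc s t := ⟨le_rfl, h.le⟩
  rw [intervalIntegral.integral_sub (h.int_sub hs hx) (h₁.int_sub hs hx), h.integral_eq hs hx,
    h₁.integral_eq hs hx]
  ring

theorem add (h : IsPrimitiveOn f g s t) (h₁ : IsPrimitiveOn f₁ g₁ s t) :
    IsPrimitiveOn (fun x => f x + f₁ x) (fun x => g x + g₁ x) s t := by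
  refine ⟨h.le, h.int.add h₁.int, fun x hx => ?_⟩
  have hs : s ∈ Set.Icc s t := ⟨le_rfl, h.le⟩
  rw [intervalIntegral.integral_add (h.int_sub hs hx) (h₁.int_sub hs hx), h.integral_eq hs hx,
    h₁.integral_eq hs hx]
  ring

theorem const_mul (h : IsPrimitiveOn f g s t) (r : ℝ) :
    IsPrimitiveOn (fun x => r * f x) (fun x => r * g x) s t := by
  refine ⟨h.le, h.int.const_mul r, fun x hx => ?_⟩
  have hs : s ∈ Set.Icc s t := ⟨le_rfl, h.le⟩
  rw [intervalIntegral.integral_const_mul, h.integral_eq hs hx]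
  ring

theorem trans {r : ℝ} (h : IsPrimitiveOn f g r s) (h₁ : IsPrimitiveOn f g s t) :
    IsPrimitiveOn f g r t := by
  refine ⟨h.le.trans h₁.le, h.int.trans h₁.int, fun x hx => ?_⟩
  rcases le_total x s with hxs | hxs
  · exact h.eq x ⟨hx.1, hxs⟩
  · have hr : r ∈ Set.Icc r s := ⟨le_rfl, h.le⟩
    have hs : s ∈ Set.Icc r s := ⟨h.le, le_rfl⟩
    have hs' : s ∈ Set.Icc s t := ⟨le_rfl, h₁.le⟩
    rw [← intervalIntegral.integral_add_adjacent_intervals h.int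
      (h₁.int_sub hs' ⟨hxs, hx.2⟩), h.integral_eq hr hs, h₁.integral_eq hs' ⟨hxs, hx.2⟩]
    ring

theorem congr (h : IsPrimitiveOn f g s t) (hf : Set.EqOn f₁ f (Set.Icc s t))
    (hg : ∀ᵐ x, x ∈ Set.Ioc s t → g₁ x = g x) : IsPrimitiveOn f₁ g₁ s t := by
  have hs : s ∈ Set.Icc s t := ⟨le_rfl, h.le⟩
  refine ⟨h.le, h.int.congr_ae ?_, fun x hx => ?_⟩
  · rw [Set.uIoc_of_le h.le]
    refine (ae_restrict_iff' measurableSet_Ioc).2 ?_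
    filter_upwards [hg] with x hx hx' using (hx hx').symm
  · rw [hf hx, hf hs, h.eq x hx]
    congr 1
    refine intervalIntegral.integral_congr_ae ?_
    filter_upwards [hg] with y hy hy'
    rw [Set.uIoc_of_le hx.1] at hy'
    exact (hy ⟨hy'.1, hy'.2.trans hx.2⟩).symm

/-- Integration by parts. -/
theorem integral_mul (h : IsPrimitiveOn f g s t) (h₁ : IsPrimitiveOn f₁ g₁ s t) :
    ∫ x in s..t, (g x * f₁ x + f x * g₁ x) = f t * f₁ t - f s * f₁ s := by
  have hs : s ∈ Set.Icc s t := ⟨le_rfl, h.le⟩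
  have ht : t ∈ Set.Icc s t := ⟨h.le, le_rfl⟩
  -- Outside `[s, t]` nothing is known about `f`, so its two-sided derivative at the ends is
  -- uncontrolled. The explicit primitive replaces it.
  have key : ∀ {f g : ℝ → ℝ}, IsPrimitiveOn f g s t →
      AbsolutelyContinuousOnInterval (fun x => f s + ∫ y in s..x, g y) s t := by
    intro f g h
    refine AbsolutelyContinuousOnInterval.add ?_
      (h.int.absolutelyContinuousOnInterval_intervalIntegral (by simp))
    exact ((LipschitzWith.const (f s)).lipschitzOnWith).absolutelyContinuousOnInterval
  have hd : ∀ {f g : ℝ → ℝ}, IsPrimitiveOn f g s t →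
      ∀ᵐ x, x ∈ Set.uIoc s t → deriv (fun x => f s + ∫ y in s..x, g y) x = g x := by
    intro f g h
    filter_upwards [h.int.ae_hasDerivAt_integral] with x hx hx'
    exact ((hx (Set.uIoc_subset_uIcc hx') s Set.left_mem_uIcc).const_add (f s)).deriv
  have := AbsolutelyContinuousOnInterval.integral_deriv_mul_eq_sub (key h) (key h₁)
  rw [← h.eq t ht, ← h.eq s hs, ← h₁.eq t ht, ← h₁.eq s hs] at this
  rw [← this]
  refine intervalIntegral.integral_congr_ae ?_
  filter_upwards [hd h, hd h₁] with x hx hx₁ hx'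
  have hx2 : x ∈ Set.Icc s t := by
    rw [Set.uIoc_of_le h.le] at hx'
    exact Set.Ioc_subset_Icc_self hx'
  rw [hx hx', hx₁ hx', ← h.eq x hx2, ← h₁.eq x hx2]

end IsPrimitiveOn

theorem isPrimitiveOn_integral {g : ℝ → ℝ} {s t : ℝ} (hst : s ≤ t)
    (hg : IntervalIntegrable g volume s t) (r : ℝ) :
    IsPrimitiveOn (fun x => r + ∫ y in s..x, g y) g s t :=
  ⟨hst, hg, fun x _ => by simp⟩

theorem isPrimitiveOn_of_hasDerivAt {f g : ℝ → ℝ} {s t : ℝ} (hst : s ≤ t)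
    (hf : ∀ x, HasDerivAt f (g x) x) (hg : Continuous g) : IsPrimitiveOn f g s t := by
  refine ⟨hst, hg.intervalIntegrable _ _, fun x _ => ?_⟩
  rw [intervalIntegral.integral_eq_sub_of_hasDerivAt (fun y _ => hf y)
    (hg.intervalIntegrable _ _)]
  ring

/-! ### Test functions and weak derivatives on intervals -/

theorem exists_Icc_of_tsupport_subset {a b : ℝ} (hab : a < b) {φ : ℝ → ℝ}
    (h1 : HasCompactSupport φ) (h2 : tsupport φ ⊆ Set.Ioo a b) :
    ∃ c d, a < c ∧ c ≤ d ∧ d < b ∧ ∀ x, x ∉ Set.Icc c d → φ x = 0 := by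
  obtain ⟨m, hm⟩ := Set.nonempty_Ioo.2 hab
  -- The extra point `m` keeps the set nonempty when `φ = 0`.
  have hK : IsCompact (insert m (tsupport φ)) := h1.isCompact.insert m
  have hne : (insert m (tsupport φ)).Nonempty := Set.insert_nonempty _ _
  have hsub : insert m (tsupport φ) ⊆ Set.Ioo a b := Set.insert_subset hm h2
  refine ⟨sInf (insert m (tsupport φ)), sSup (insert m (tsupport φ)),
    (hsub (hK.sInf_mem hne)).1, ?_, (hsub (hK.sSup_mem hne)).2, fun x hx => ?_⟩
  · exact csInf_le_of_le hK.bddBelow (Set.mem_insert _ _)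
      (le_csSup hK.bddAbove (Set.mem_insert _ _))
  · by_contra hne'
    refine hx ?_
    have : x ∈ insert m (tsupport φ) :=
      Set.mem_insert_of_mem _ (subset_tsupport _ (Function.mem_support.2 hne'))
    exact ⟨csInf_le hK.bddBelow this, le_csSup hK.bddAbove this⟩

theorem integrableOn_mul_test {a b : ℝ} {z φ : ℝ → ℝ}
    (hz : LocallyIntegrableOn z (Set.Ioo a b)) (hφ : Continuous φ) (h1 : HasCompactSupport φ)
    (h2 : tsupport φ ⊆ Set.Ioo a b) :
    IntegrableOn (fun x => z x * φ x) (Set.Ioo a b) := by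
  have := (hz.integrableOn_compact_subset h2 h1.isCompact).mul_continuousOn hφ.continuousOn
    h1.isCompact
  refine this.of_forall_sdiff_eq_zero measurableSet_Ioo fun x hx => ?_
  rw [image_eq_zero_of_notMem_tsupport hx.2, mul_zero]

theorem tsupport_deriv_subset' (φ : ℝ → ℝ) : tsupport (deriv φ) ⊆ tsupport φ :=
  closure_minimal support_deriv_subset (isClosed_tsupport φ)

/-- The du Bois-Reymond lemma. A test function of integral zero is the derivative of a test
function, and any `φ` acquires integral zero after subtracting a multiple of a fixed bump `ψ`. Hence
`z` acts on `φ` like the constant `∫ z ψ`. -/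
theorem ae_eq_const_of_integral_mul_deriv_eq_zero {a b : ℝ} (hab : a < b) {z : ℝ → ℝ}
    (hz : LocallyIntegrableOn z (Set.Ioo a b))
    (h : ∀ φ : ℝ → ℝ, ContDiff ℝ ∞ φ → HasCompactSupport φ → tsupport φ ⊆ Set.Ioo a b →
      ∫ x in Set.Ioo a b, z x * deriv φ x = 0) :
    ∃ C : ℝ, ∀ᵐ x, x ∈ Set.Ioo a b → z x = C := by
  obtain ⟨m, hm⟩ := Set.nonempty_Ioo.2 hab
  obtain ⟨r, hr, hrsub⟩ := Metric.nhds_basis_closedBall.mem_iff.1 (isOpen_Ioo.mem_nhds hm)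
  let ψb : ContDiffBump m := ⟨r / 2, r, half_pos hr, half_lt_self hr⟩
  set ψ : ℝ → ℝ := ψb.normed volume with hψ
  have ψ1 : ContDiff ℝ ∞ ψ := ψb.contDiff_normed
  have ψ2 : HasCompactSupport ψ := ψb.hasCompactSupport_normed
  have ψ3 : tsupport ψ ⊆ Set.Ioo a b := by
    rw [hψ, ψb.tsupport_normed_eq]; exact hrsub
  have ψ4 : ∫ x, ψ x = 1 := ψb.integral_normed
  set C := ∫ x in Set.Ioo a b, z x * ψ x with hC
  refine ⟨C, ?_⟩
  have hloc : LocallyIntegrableOn (fun x => z x - C) (Set.Ioo a b) :=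
    hz.sub (locallyIntegrableOn_const C)
  have := isOpen_Ioo.ae_eq_zero_of_integral_contDiff_smul_eq_zero hloc ?_
  · filter_upwards [this] with x hx hx' using sub_eq_zero.1 (hx hx')
  intro φ φ1 φ2 φ3
  set I := ∫ x, φ x with hI
  obtain ⟨c, d, hac, hcd, hdb, hφ0⟩ := exists_Icc_of_tsupport_subset hab φ2 φ3
  obtain ⟨c', d', hac', hcd', hdb', hψ0⟩ := exists_Icc_of_tsupport_subset hab ψ2 ψ3
  set θ : ℝ → ℝ := fun x => φ x - I * ψ x with hθ
  have θ1 : ContDiff ℝ ∞ θ := φ1.sub (contDiff_const.mul ψ1)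
  have θ0 : ∀ x, x ∉ Set.Icc (min c c') (max d d') → θ x = 0 := by
    intro x hx
    have e1 : x ∉ Set.Icc c d := fun h => hx ⟨(min_le_left _ _).trans h.1, h.2.trans (le_max_left _ _)⟩
    have e2 : x ∉ Set.Icc c' d' := fun h =>
      hx ⟨(min_le_right _ _).trans h.1, h.2.trans (le_max_right _ _)⟩
    simp only [hθ, hφ0 x e1, hψ0 x e2, mul_zero, sub_zero]
  have hφi : Integrable φ := φ1.continuous.integrable_of_hasCompactSupport φ2
  have hψi : Integrable ψ := ψ1.continuous.integrable_of_hasCompactSupport ψ2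
  have θint : ∫ x, θ x = 0 := by
    rw [hθ, integral_sub hφi (hψi.const_mul I), integral_const_mul, ψ4]
    simp [hI]
  set Φ : ℝ → ℝ := fun x => ∫ y in a..x, θ y with hΦ
  have Φd : ∀ x, HasDerivAt Φ (θ x) x := fun x =>
    intervalIntegral.integral_hasDerivAt_right (θ1.continuous.intervalIntegrable _ _)
      θ1.continuous.stronglyMeasurable.stronglyMeasurableAtFilter θ1.continuous.continuousAt
  have Φderiv : deriv Φ = θ := funext fun x => (Φd x).deriv
  have Φ1 : ContDiff ℝ ∞ Φ := by
    refine contDiff_infty_iff_deriv.2 ⟨fun x => (Φd x).differentiableAt, ?_⟩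
    rw [Φderiv]; exact θ1
  have hlt1 : a < min c c' := lt_min hac hac'
  have hlt2 : max d d' < b := max_lt hdb hdb'
  have hle : min c c' ≤ max d d' := (min_le_left _ _).trans (hcd.trans (le_max_left _ _))
  -- To the right of the supports, `Φ` equals the total integral of `θ`, which is zero. This is
  -- where the correction by `I * ψ` is needed.
  have Φ0 : ∀ x, x ∉ Set.Icc (min c c') (max d d') → Φ x = 0 := by
    intro x hx
    rw [Set.mem_Icc, not_and_or, not_le, not_le] at hx
    rcases hx with hx | hx
    · rw [hΦ]
      refine intervalIntegral.integral_zero_ae (Eventually.of_forall fun y hy => θ0 y fun h' => ?_)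
      have : y ≤ max a x := hy.2
      exact absurd h'.1 (not_le.2 (this.trans_lt (max_lt hlt1 hx)))
    · have hax : a ≤ x := (hlt1.trans_le (hle.trans hx.le)).le
      rw [hΦ]
      simp only
      rw [intervalIntegral.integral_of_le hax, ← θint]
      refine setIntegral_eq_integral_of_forall_compl_eq_zero fun y hy => θ0 y fun h' => hy ?_
      exact ⟨hlt1.trans_le h'.1, h'.2.trans hx.le⟩
  have Φsub : tsupport Φ ⊆ Set.Icc (min c c') (max d d') :=
    closure_minimal (fun x hx => by
      by_contra h'
      exact hx (Φ0 x h')) isClosed_Icc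
  have Φ2 : HasCompactSupport Φ := isCompact_Icc.of_isClosed_subset (isClosed_tsupport _) Φsub
  have Φ3 : tsupport Φ ⊆ Set.Ioo a b :=
    Φsub.trans fun x hx => ⟨hlt1.trans_le hx.1, hx.2.trans_lt hlt2⟩
  have h0 := h Φ Φ1 Φ2 Φ3
  have i1 := integrableOn_mul_test hz φ1.continuous φ2 φ3
  have i2 := integrableOn_mul_test hz ψ1.continuous ψ2 ψ3
  have e1 : ∫ x in Set.Ioo a b, z x * deriv Φ x =
      (∫ x in Set.Ioo a b, z x * φ x) - I * C := by
    rw [hC, ← integral_const_mul, ← integral_sub i1 (i2.const_mul I), Φderiv]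
    refine integral_congr_ae (Eventually.of_forall fun x => ?_)
    simp only [hθ]; ring
  have hIs : ∫ x in Set.Ioo a b, φ x = I := by
    refine setIntegral_eq_integral_of_forall_compl_eq_zero fun y hy => ?_
    exact image_eq_zero_of_notMem_tsupport fun h' => hy (φ3 h')
  have e2 : ∫ x, φ x • (z x - C) = ∫ x in Set.Ioo a b, φ x • (z x - C) := by
    refine (setIntegral_eq_integral_of_forall_compl_eq_zero fun y hy => ?_).symm
    rw [image_eq_zero_of_notMem_tsupport fun h' => hy (φ3 h'), zero_smul]
  have e3 : ∫ x in Set.Ioo a b, φ x • (z x - C) = (∫ x in Set.Ioo a b, z x * φ x) - C * I := by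
    rw [← hIs, ← integral_const_mul, ← integral_sub i1 (hφi.integrableOn.const_mul C)]
    refine integral_congr_ae (Eventually.of_forall fun x => ?_)
    simp only [smul_eq_mul]; ring
  rw [e2, e3]
  linarith [e1, h0]

theorem IsPrimitiveOn.integral_mul_deriv_test {f g : ℝ → ℝ} {a b : ℝ} (h : IsPrimitiveOn f g a b)
    (hab : a < b) {φ : ℝ → ℝ} (h1 : ContDiff ℝ ∞ φ)
    (h3 : tsupport φ ⊆ Set.Ioo a b) :
    ∫ x in Set.Ioo a b, f x * deriv φ x = -∫ x in Set.Ioo a b, g x * φ x := by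
  have hd : Differentiable ℝ φ := h1.differentiable (by simp)
  have hc : Continuous (deriv φ) := h1.continuous_deriv (by simp)
  have hp : IsPrimitiveOn φ (deriv φ) a b :=
    isPrimitiveOn_of_hasDerivAt hab.le (fun x => (hd x).hasDerivAt) hc
  have key := h.integral_mul hp
  have ha : φ a = 0 := image_eq_zero_of_notMem_tsupport fun h' => (h3 h').1.false
  have hb : φ b = 0 := image_eq_zero_of_notMem_tsupport fun h' => (h3 h').2.false
  have i1 : IntervalIntegrable (fun x => g x * φ x) volume a b :=
    h.int.mul_continuousOn h1.continuous.continuousOn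
  have i2 : IntervalIntegrable (fun x => f x * deriv φ x) volume a b := by
    refine ContinuousOn.intervalIntegrable ?_
    rw [Set.uIcc_of_le hab.le]
    exact h.continuousOn.mul hc.continuousOn
  rw [intervalIntegral.integral_add i1 i2, ha, hb] at key
  rw [← integral_Ioc_eq_integral_Ioo, ← integral_Ioc_eq_integral_Ioo,
    ← intervalIntegral.integral_of_le hab.le, ← intervalIntegral.integral_of_le hab.le]
  linarith

theorem IsPrimitiveOn.locallyIntegrableOn {f g : ℝ → ℝ} {a b : ℝ} (h : IsPrimitiveOn f g a b) :
    LocallyIntegrableOn f (Set.Ioo a b) :=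
  (h.continuousOn.mono Set.Ioo_subset_Icc_self).locallyIntegrableOn measurableSet_Ioo

theorem IsPrimitiveOn.isWeakDeriv {f g : ℝ → ℝ} {a b : ℝ} (h : IsPrimitiveOn f g a b)
    (hab : a < b) : IsWeakDeriv (Set.Ioo a b) 1 f g := by
  refine ⟨h.locallyIntegrableOn, ?_, fun φ h1 _ h3 => ?_⟩
  · have := h.int.1
    exact (this.mono_set Set.Ioo_subset_Ioc_self).locallyIntegrableOn
  · rw [iteratedDeriv_one, h.integral_mul_deriv_test hab h1 h3]
    ring

/-- The difference of `z` and a primitive of `w` has weak derivative zero, so the du Bois-Reymond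
lemma applies. -/
theorem ae_eq_primitive {a b : ℝ} (hab : a < b) {z w : ℝ → ℝ}
    (hz : LocallyIntegrableOn z (Set.Ioo a b)) (hw : IntervalIntegrable w volume a b)
    (h : ∀ φ : ℝ → ℝ, ContDiff ℝ ∞ φ → HasCompactSupport φ → tsupport φ ⊆ Set.Ioo a b →
      ∫ x in Set.Ioo a b, z x * deriv φ x = -∫ x in Set.Ioo a b, w x * φ x) :
    ∃ C : ℝ, ∀ᵐ x, x ∈ Set.Ioo a b → z x = C + ∫ y in a..x, w y := by
  have hW := isPrimitiveOn_integral hab.le hw 0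
  obtain ⟨C, hC⟩ := ae_eq_const_of_integral_mul_deriv_eq_zero hab
    (hz.sub hW.locallyIntegrableOn) (fun φ h1 h2 h3 => by
      have hc : Continuous (deriv φ) := h1.continuous_deriv (by simp)
      have i1 := integrableOn_mul_test hz hc h2.deriv ((tsupport_deriv_subset' φ).trans h3)
      have i2 := integrableOn_mul_test hW.locallyIntegrableOn hc h2.deriv
        ((tsupport_deriv_subset' φ).trans h3)
      have e := hW.integral_mul_deriv_test hab h1 h3
      have : ∫ x in Set.Ioo a b, (z - fun x => 0 + ∫ y in a..x, w y) x * deriv φ x =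
          (∫ x in Set.Ioo a b, z x * deriv φ x) -
            ∫ x in Set.Ioo a b, (0 + ∫ y in a..x, w y) * deriv φ x := by
        rw [← integral_sub i1 i2]
        refine integral_congr_ae (Eventually.of_forall fun x => ?_)
        simp only [Pi.sub_apply]; ring
      rw [this, e, h φ h1 h2 h3, sub_self])
  refine ⟨C, ?_⟩
  filter_upwards [hC] with x hx hx'
  have := hx hx'
  simp only [Pi.sub_apply, zero_add] at this
  linarith

theorem iteratedDeriv_test {s : Set ℝ} {φ : ℝ → ℝ} (h1 : ContDiff ℝ ∞ φ)
    (h2 : HasCompactSupport φ) (h3 : tsupport φ ⊆ s) (j : ℕ) :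
    ContDiff ℝ ∞ (iteratedDeriv j φ) ∧ HasCompactSupport (iteratedDeriv j φ) ∧
      tsupport (iteratedDeriv j φ) ⊆ s := by
  induction j with
  | zero => simpa using ⟨h1, h2, h3⟩
  | succ j ih =>
    rw [iteratedDeriv_succ]
    exact ⟨(contDiff_infty_iff_deriv.1 ih.1).2, ih.2.1.deriv,
      (tsupport_deriv_subset' _).trans ih.2.2⟩

namespace IsWeakDeriv

variable {s : Set ℝ} {j : ℕ} {v g g' : ℝ → ℝ}

theorem ae_unique (hs : IsOpen s) (h : IsWeakDeriv s j v g) (h' : IsWeakDeriv s j v g') :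
    ∀ᵐ x, x ∈ s → g x = g' x := by
  have key := hs.ae_eq_zero_of_integral_contDiff_smul_eq_zero (h.2.1.sub h'.2.1) ?_
  · filter_upwards [key] with x hx hx' using sub_eq_zero.1 (hx hx')
  intro φ h1 h2 h3
  have int : ∀ {z : ℝ → ℝ}, LocallyIntegrableOn z s → IntegrableOn (fun x => z x * φ x) s := by
    intro z hz
    have := (hz.integrableOn_compact_subset h3 h2.isCompact).mul_continuousOn
      h1.continuous.continuousOn h2.isCompact
    refine this.of_forall_sdiff_eq_zero hs.measurableSet fun x hx => ?_
    rw [image_eq_zero_of_notMem_tsupport hx.2, mul_zero]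
  have e := (h.2.2 φ h1 h2 h3).symm.trans (h'.2.2 φ h1 h2 h3)
  have e' := mul_left_cancel₀ (pow_ne_zero j (by norm_num)) e
  rw [← sub_eq_zero, ← integral_sub (int h.2.1) (int h'.2.1)] at e'
  rw [← e', ← setIntegral_eq_integral_of_forall_compl_eq_zero (s := s)]
  · refine integral_congr_ae (Eventually.of_forall fun x => ?_)
    simp only [Pi.sub_apply, smul_eq_mul]; ring
  · intro x hx
    rw [image_eq_zero_of_notMem_tsupport fun h' => hx (h3 h'), zero_smul]

theorem zero_self (h : IsWeakDeriv s j v g) : IsWeakDeriv s 0 v v :=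
  ⟨h.1, h.1, fun φ _ _ _ => by simp⟩

/-- A derivative of order `j + 1` of `v` is a derivative of order `j` of `v'`. -/
theorem shift (h₁ : IsWeakDeriv s 1 v g') (h : IsWeakDeriv s (j + 1) v g) :
    IsWeakDeriv s j g' g := by
  refine ⟨h₁.2.1, h.2.1, fun φ h1 h2 h3 => ?_⟩
  obtain ⟨t1, t2, t3⟩ := iteratedDeriv_test h1 h2 h3 j
  have e := h₁.2.2 _ t1 t2 t3
  rw [iteratedDeriv_one, ← iteratedDeriv_succ, h.2.2 φ h1 h2 h3, pow_succ, pow_one] at e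
  linarith

end IsWeakDeriv

/-! ### Regular representatives of functions with bounded weak derivatives -/

theorem intervalIntegrable_of_bounded {g : ℝ → ℝ} {a b M : ℝ} (hab : a ≤ b)
    (hg : AEStronglyMeasurable g (volume.restrict (Set.Ioo a b)))
    (hM : ∀ᵐ x, x ∈ Set.Ioo a b → |g x| ≤ M) : IntervalIntegrable g volume a b := by
  rw [intervalIntegrable_iff_integrableOn_Ioo_of_le hab]
  exact IntegrableOn.of_bound measure_Ioo_lt_top hg M
    ((ae_restrict_iff' measurableSet_Ioo).2 hM)

theorem exists_lipschitz_representative {a b : ℝ} (hab : a < b) {M : ℝ} (hM : 0 ≤ M)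
    {v g : ℝ → ℝ} (hg : IsWeakDeriv (Set.Ioo a b) 1 v g)
    (hgM : ∀ᵐ x, x ∈ Set.Ioo a b → |g x| ≤ M) :
    ∃ V : ℝ → ℝ, Continuous V ∧ (∀ x y, |V x - V y| ≤ M * |x - y|) ∧
      (∀ᵐ x, x ∈ Set.Ioo a b → v x = V x) ∧ IsPrimitiveOn V g a b := by
  have hgi : IntervalIntegrable g volume a b :=
    intervalIntegrable_of_bounded hab.le hg.2.1.aestronglyMeasurable hgM
  -- Extension by zero makes the primitive Lipschitz on the whole line with the same constant.
  -- Globally defined representatives are what the later gluing at the interface needs.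
  set w : ℝ → ℝ := (Set.Ioo a b).indicator g with hw
  have hwi : Integrable w := by
    rw [hw, integrable_indicator_iff measurableSet_Ioo]
    exact (intervalIntegrable_iff_integrableOn_Ioo_of_le hab.le).1 hgi
  have hwM : ∀ᵐ x, ‖w x‖ ≤ M := by
    filter_upwards [hgM] with x hx
    by_cases hx' : x ∈ Set.Ioo a b
    · rw [hw, Set.indicator_of_mem hx']; exact hx hx'
    · rw [hw, Set.indicator_of_notMem hx', norm_zero]; exact hM
  have hwg : ∀ᵐ x, x ∈ Set.Ioc a b → g x = w x := by
    have : ∀ᵐ x : ℝ, x ≠ b := by simp [ae_iff, measure_singleton]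
    filter_upwards [this] with x hx hx'
    rw [hw, Set.indicator_of_mem (show x ∈ Set.Ioo a b from ⟨hx'.1, lt_of_le_of_ne hx'.2 hx⟩)]
  obtain ⟨C, hC⟩ := ae_eq_primitive hab hg.1 hgi fun φ h1 h2 h3 => by
    have := hg.2.2 φ h1 h2 h3
    rw [iteratedDeriv_one] at this
    rw [this]; ring
  have hP := isPrimitiveOn_integral hab.le hwi.intervalIntegrable C
  have hlip : ∀ x y, |(C + ∫ z in a..x, w z) - (C + ∫ z in a..y, w z)| ≤ M * |x - y| := by
    intro x y
    rw [add_sub_add_left_eq_sub, intervalIntegral.integral_interval_sub_left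
      hwi.intervalIntegrable hwi.intervalIntegrable]
    exact intervalIntegral.norm_integral_le_of_norm_le_const_ae
      (hwM.mono fun z hz _ => hz)
  refine ⟨fun x => C + ∫ y in a..x, w y, ?_, hlip, ?_, hP.congr (fun _ _ => rfl) hwg⟩
  · refine LipschitzWith.continuous (K := M.toNNReal) (LipschitzWith.of_dist_le_mul fun x y => ?_)
    rw [Real.dist_eq, Real.dist_eq, Real.coe_toNNReal _ hM]
    exact hlip x y
  · filter_upwards [hC] with x hx hx'
    rw [hx hx']
    congr 1
    refine intervalIntegral.integral_congr_ae ?_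
    filter_upwards [hwg] with y hy hy'
    rw [Set.uIoc_of_le hx'.1.le] at hy'
    exact hy ⟨hy'.1, hy'.2.trans hx'.2.le⟩

/-- Induction on the order: represent the weak derivative `v'` first, then integrate its
representative. The conclusions quantify over all weak derivatives, so that they apply to whichever
representatives the jump conditions and the differential equation supply. -/
theorem exists_contDiff_representative {a b : ℝ} (hab : a < b) {M : ℝ} (hM : 0 ≤ M) (m : ℕ) :
    ∀ v : ℝ → ℝ, (∀ j ≤ m + 1, ∃ g, IsWeakDeriv (Set.Ioo a b) j v g) →
      (∃ g, IsWeakDeriv (Set.Ioo a b) (m + 1) v g ∧ ∀ᵐ x, x ∈ Set.Ioo a b → |g x| ≤ M) →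
      ∃ V : ℝ → ℝ, ContDiff ℝ m V ∧
        (∀ x y, |iteratedDeriv m V x - iteratedDeriv m V y| ≤ M * |x - y|) ∧
        (∀ j ≤ m, ∀ g, IsWeakDeriv (Set.Ioo a b) j v g →
          ∀ᵐ x, x ∈ Set.Ioo a b → g x = iteratedDeriv j V x) ∧
        ∀ g, IsWeakDeriv (Set.Ioo a b) (m + 1) v g →
          IsPrimitiveOn (iteratedDeriv m V) g a b := by
  induction m with
  | zero =>
    rintro v - ⟨g, hg, hgM⟩
    obtain ⟨V, hV1, hV2, hV3, hV4⟩ := exists_lipschitz_representative hab hM hg hgM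
    refine ⟨V, contDiff_zero.2 hV1, by simpa using hV2, fun j hj g' hg' => ?_,
      fun g' hg' => ?_⟩
    · obtain rfl : j = 0 := by omega
      filter_upwards [hV3, hg'.ae_unique isOpen_Ioo hg'.zero_self] with x hx hx' hxs
      rw [hx' hxs, hx hxs, iteratedDeriv_zero]
    · rw [iteratedDeriv_zero]
      refine hV4.congr (fun _ _ => rfl) ?_
      have : ∀ᵐ x : ℝ, x ≠ b := by simp [ae_iff, measure_singleton]
      filter_upwards [this, hg'.ae_unique isOpen_Ioo hg] with x hx hx' hxs
      exact hx' ⟨hxs.1, lt_of_le_of_ne hxs.2 hx⟩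
  | succ m ih =>
    rintro v hv ⟨g, hg, hgM⟩
    obtain ⟨g₁, hg₁⟩ := hv 1 (by omega)
    obtain ⟨V₁, c1, c2, c3, c4⟩ := ih g₁
      (fun j hj => by
        obtain ⟨g', hg'⟩ := hv (j + 1) (by omega)
        exact ⟨g', hg₁.shift hg'⟩) ⟨g, hg₁.shift hg, hgM⟩
    obtain ⟨C, hC⟩ := ae_eq_primitive hab hg₁.1 (c1.continuous.intervalIntegrable a b)
      fun φ h1 h2 h3 => by
        have := hg₁.2.2 φ h1 h2 h3
        rw [iteratedDeriv_one] at this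
        rw [this, pow_one, neg_one_mul, neg_inj]
        refine setIntegral_congr_ae measurableSet_Ioo ?_
        filter_upwards [c3 0 (Nat.zero_le _) g₁ (hg₁.shift hg₁ |>.zero_self)] with x hx hx'
        rw [hx hx', iteratedDeriv_zero]
    set V : ℝ → ℝ := fun x => C + ∫ y in a..x, V₁ y with hV
    have hVd : ∀ x, HasDerivAt V (V₁ x) x := fun x =>
      (intervalIntegral.integral_hasDerivAt_right (c1.continuous.intervalIntegrable _ _)
        c1.continuous.stronglyMeasurable.stronglyMeasurableAtFilter
        c1.continuous.continuousAt).const_add C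
    have hVderiv : deriv V = V₁ := funext fun x => (hVd x).deriv
    have hit : ∀ j, iteratedDeriv (j + 1) V = iteratedDeriv j V₁ := fun j => by
      rw [iteratedDeriv_succ', hVderiv]
    refine ⟨V, ?_, ?_, fun j hj g' hg' => ?_, fun g' hg' => ?_⟩
    · push_cast
      refine contDiff_succ_iff_deriv.2 ⟨fun x => (hVd x).differentiableAt, by simp, ?_⟩
      rw [hVderiv]; exact c1
    · rw [hit]; exact c2
    · cases j with
      | zero =>
        filter_upwards [hC, hg'.ae_unique isOpen_Ioo hg'.zero_self] with x hx hx' hxs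
        rw [hx' hxs, hx hxs, iteratedDeriv_zero]
      | succ j =>
        rw [hit]
        exact c3 j (by omega) g' (hg₁.shift hg')
    · rw [hit]
      exact c4 g' (hg₁.shift hg')

/-! ### Gluing smooth functions at a point -/

/-- The function that is `f` up to `α` and `g` beyond `α`. -/
noncomputable def glue (α : ℝ) (f g : ℝ → ℝ) (t : ℝ) : ℝ := if t ≤ α then f t else g t

theorem hasDerivAt_glue {α : ℝ} {f g f' g' : ℝ → ℝ} (hf : ∀ t, HasDerivAt f (f' t) t)
    (hg : ∀ t, HasDerivAt g (g' t) t) (h : f α = g α) (h' : f' α = g' α) (t : ℝ) :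
    HasDerivAt (glue α f g) (glue α f' g' t) t := by
  rcases lt_trichotomy t α with ht | rfl | ht
  · rw [glue, if_pos ht.le]
    refine (hf t).congr_of_eventuallyEq ?_
    filter_upwards [Iio_mem_nhds ht] with y hy
    exact if_pos (le_of_lt hy)
  · rw [glue, if_pos le_rfl]
    have e1 : HasDerivWithinAt (glue t f g) (f' t) (Set.Iic t) t :=
      (hf t).hasDerivWithinAt.congr (fun y hy => if_pos hy) (if_pos le_rfl)
    have e2 : HasDerivWithinAt (glue t f g) (f' t) (Set.Ici t) t := by
      rw [h']
      refine (hg t).hasDerivWithinAt.congr (fun y hy => ?_) ((if_pos le_rfl).trans h)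
      rcases eq_or_lt_of_le (show t ≤ y from hy) with rfl | hy'
      · exact (if_pos le_rfl).trans h
      · exact if_neg (not_le.2 hy')
    have := e1.union e2
    rwa [Set.Iic_union_Ici, hasDerivWithinAt_univ] at this
  · rw [glue, if_neg (not_le.2 ht)]
    refine (hg t).congr_of_eventuallyEq ?_
    filter_upwards [Ioi_mem_nhds ht] with y hy
    exact if_neg (not_le.2 hy)

theorem contDiff_glue (α : ℝ) (n : ℕ) : ∀ f g : ℝ → ℝ, ContDiff ℝ n f → ContDiff ℝ n g →
    (∀ j ≤ n, iteratedDeriv j f α = iteratedDeriv j g α) →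
    ContDiff ℝ n (glue α f g) ∧
      iteratedDeriv n (glue α f g) = glue α (iteratedDeriv n f) (iteratedDeriv n g) := by
  induction n with
  | zero =>
    intro f g hf hg h
    have h0 := h 0 le_rfl
    simp only [iteratedDeriv_zero] at h0 ⊢
    refine ⟨contDiff_zero.2 (Continuous.if_le hf.continuous hg.continuous continuous_id
      continuous_const fun x hx => ?_), trivial⟩
    rw [hx, h0]
  | succ n ih =>
    intro f g hf hg h
    push_cast at hf hg ⊢
    obtain ⟨f1, -, f2⟩ := contDiff_succ_iff_deriv.1 hf
    obtain ⟨g1, -, g2⟩ := contDiff_succ_iff_deriv.1 hg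
    have hd := hasDerivAt_glue (fun t => (f1 t).hasDerivAt) (fun t => (g1 t).hasDerivAt)
      (by simpa using h 0 (Nat.zero_le _)) (by simpa using h 1 (by omega))
    have hderiv : deriv (glue α f g) = glue α (deriv f) (deriv g) := funext fun t => (hd t).deriv
    obtain ⟨c1, c2⟩ := ih (deriv f) (deriv g) f2 g2 fun j hj => by
      rw [← iteratedDeriv_succ', ← iteratedDeriv_succ']
      exact h (j + 1) (by omega)
    refine ⟨contDiff_succ_iff_deriv.2 ⟨fun t => (hd t).differentiableAt, by simp, ?_⟩, ?_⟩
    · rw [hderiv]; exact c1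
    · rw [iteratedDeriv_succ', hderiv, c2, iteratedDeriv_succ', iteratedDeriv_succ']

/-- The constant does not grow: for points on opposite sides of `α` the path through `α` has length
exactly `|x - y|`. -/
theorem abs_glue_sub_le {α L : ℝ} {f g : ℝ → ℝ} (hf : ∀ x y, |f x - f y| ≤ L * |x - y|)
    (hg : ∀ x y, |g x - g y| ≤ L * |x - y|) (h : f α = g α) (x y : ℝ) :
    |glue α f g x - glue α f g y| ≤ L * |x - y| := by
  wlog hxy : x ≤ y generalizing x y
  · rw [abs_sub_comm, abs_sub_comm x]
    exact this y x (le_of_not_ge hxy)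
  unfold glue
  by_cases hx : x ≤ α <;> by_cases hy : y ≤ α
  · simpa [hx, hy] using hf x y
  · rw [if_pos hx, if_neg hy]
    push Not at hy
    have e1 := hf x α
    have e2 := hg α y
    rw [abs_of_nonpos (by linarith : x - α ≤ 0)] at e1
    rw [abs_of_nonpos (by linarith : α - y ≤ 0)] at e2
    rw [abs_of_nonpos (by linarith : x - y ≤ 0)]
    have : f x - g y = (f x - f α) + (g α - g y) := by rw [h]; ring
    rw [this]
    refine (abs_add_le _ _).trans ((add_le_add e1 e2).trans (le_of_eq (by ring)))
  · exact absurd (hxy.trans hy) hx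
  · simpa [hx, hy] using hg x y

/-! ### The interpolation error -/

/-- Rolle's theorem for many zeros. -/
theorem exists_two_zeros_iteratedDeriv (n : ℕ) {A B : ℝ} : ∀ (f : ℝ → ℝ) (z : ℕ → ℝ),
    ContDiff ℝ n f → (∀ i ≤ n + 1, f (z i) = 0) → (∀ i ≤ n + 1, z i ∈ Set.Icc A B) →
    (∀ i ≤ n, z i < z (i + 1)) →
    ∃ x ∈ Set.Icc A B, ∃ y ∈ Set.Icc A B, x < y ∧ iteratedDeriv n f x = 0 ∧
      iteratedDeriv n f y = 0 := by
  induction n with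
  | zero =>
    intro f z _ h1 h2 h3
    refine ⟨z 0, h2 0 (by omega), z 1, h2 1 le_rfl, h3 0 le_rfl, ?_, ?_⟩
    · rw [iteratedDeriv_zero]; exact h1 0 (by omega)
    · rw [iteratedDeriv_zero]; exact h1 1 le_rfl
  | succ n ih =>
    intro f z hf h1 h2 h3
    have hR : ∀ i : ℕ, ∃ c, i ≤ n + 1 → c ∈ Set.Ioo (z i) (z (i + 1)) ∧ deriv f c = 0 := by
      intro i
      by_cases hi : i ≤ n + 1
      · obtain ⟨c, hc, hc'⟩ := exists_deriv_eq_zero (h3 i hi) hf.continuous.continuousOn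
          ((h1 i (by omega)).trans (h1 (i + 1) (by omega)).symm)
        exact ⟨c, fun _ => ⟨hc, hc'⟩⟩
      · exact ⟨0, fun h => absurd h hi⟩
    choose w hw using hR
    push_cast at hf
    have := ih (deriv f) w (contDiff_succ_iff_deriv.1 hf).2.2 (fun i hi => (hw i hi).2)
      (fun i hi => ⟨(h2 i (by omega)).1.trans (hw i hi).1.1.le,
        (hw i hi).1.2.le.trans (h2 (i + 1) (by omega)).2⟩)
      (fun i hi => (hw i (by omega)).1.2.trans (hw (i + 1) (by omega)).1.1)
    simpa only [iteratedDeriv_succ'] using this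

theorem iteratedDeriv_polynomial (P : ℝ[X]) (n : ℕ) :
    iteratedDeriv n (fun x => P.eval x) = fun x => (derivative^[n] P).eval x := by
  induction n generalizing P with
  | zero => simp
  | succ n ih =>
    rw [iteratedDeriv_succ', Function.iterate_succ_apply, ← ih]
    congr 1
    ext x
    exact P.deriv

/-- The classical remainder argument, stopped one derivative early because `F` has only `n`
derivatives. Rolle leaves two zeros of the derivative of order `n` of `F - R`. At these points an
`L`-Lipschitz function coincides with an affine one of slope `(n + 1)! * lam`, so the slope is at
most `L` in absolute value. -/
theorem abs_sub_interpolation_le (n : ℕ) {A B L : ℝ} {F : ℝ → ℝ} (hF : ContDiff ℝ n F)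
    (hL : ∀ x y, |iteratedDeriv n F x - iteratedDeriv n F y| ≤ L * |x - y|)
    {P : Finset ℝ} (hP : P.card = n + 1) (hPs : ∀ z ∈ P, z ∈ Set.Icc A B) {Q : ℝ[X]}
    (hQ : Q.natDegree ≤ n) (hFQ : ∀ z ∈ P, F z = Q.eval z) {x : ℝ} (hx : x ∈ Set.Icc A B) :
    |F x - Q.eval x| ≤ L * (B - A) ^ (n + 1) := by
  have hAB : A ≤ B := hx.1.trans hx.2
  have hL0 : 0 ≤ L := by
    have := (abs_nonneg _).trans (hL 1 0)
    simpa using this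
  by_cases hxP : x ∈ P
  · rw [hFQ x hxP, sub_self, abs_zero]
    exact mul_nonneg hL0 (pow_nonneg (sub_nonneg.2 hAB) _)
  set N : ℝ[X] := ∏ z ∈ P, (X - C z) with hN
  have hNm : N.Monic := monic_prod_of_monic _ _ fun z _ => monic_X_sub_C z
  have hNd : N.natDegree = n + 1 := by
    rw [hN, natDegree_prod_of_monic _ _ fun z _ => monic_X_sub_C z]
    simp [hP]
  have hNx : N.eval x = ∏ z ∈ P, (x - z) := by simp [hN, eval_prod]
  have hNx0 : N.eval x ≠ 0 := by
    rw [hNx]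
    exact Finset.prod_ne_zero_iff.2 fun z hz h => hxP (by rwa [sub_eq_zero.1 h])
  have hNle : |N.eval x| ≤ (B - A) ^ (n + 1) := by
    rw [hNx, Finset.abs_prod, ← hP]
    rw [← Finset.prod_const]
    refine Finset.prod_le_prod (fun _ _ => abs_nonneg _) fun z hz => ?_
    have := hPs z hz
    exact abs_sub_le_iff.2 ⟨by linarith [hx.2, this.1], by linarith [hx.1, this.2]⟩
  -- Chosen so that `F - Q - lam * N` vanishes at `x` in addition to the `n + 1` nodes.
  set lam := (F x - Q.eval x) / N.eval x with hlam
  set R : ℝ[X] := C lam * N + Q with hR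
  have hRd : R.natDegree ≤ n + 1 := by
    refine (natDegree_add_le _ _).trans (max_le ?_ (by omega))
    exact (natDegree_C_mul_le _ _).trans hNd.le
  have hRc : R.coeff (n + 1) = lam := by
    rw [hR, coeff_add, coeff_C_mul, coeff_eq_zero_of_natDegree_lt (by omega : Q.natDegree < n + 1),
      ← hNd, hNm.coeff_natDegree]
    ring
  have hRsmooth : ContDiff ℝ n (fun t => R.eval t) := contDiff_aeval R n
  have hzero : ∀ z ∈ insert x P, (F - fun t => R.eval t) z = 0 := by
    intro z hz
    rcases Finset.mem_insert.1 hz with rfl | hz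
    · simp only [Pi.sub_apply, hR, eval_add, eval_mul, eval_C, hlam]
      field_simp
      ring
    · have : N.eval z = 0 := by
        rw [hN, eval_prod]
        exact Finset.prod_eq_zero hz (by simp)
      simp only [Pi.sub_apply, hR, eval_add, eval_mul, eval_C, this, hFQ z hz]
      ring
  have hcard : (insert x P).card = n + 2 := by rw [Finset.card_insert_of_notMem hxP, hP]
  have hins : ∀ z ∈ insert x P, z ∈ Set.Icc A B := by
    intro z hz
    rcases Finset.mem_insert.1 hz with rfl | hz
    · exact hx
    · exact hPs z hz
  let e := (insert x P).orderEmbOfFin hcard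
  let z : ℕ → ℝ := fun i => if h : i < n + 2 then e ⟨i, h⟩ else 0
  have hzm : ∀ i ≤ n + 1, z i ∈ insert x P := fun i hi => by
    have : i < n + 2 := by omega
    simp only [z, this, dif_pos]
    exact Finset.orderEmbOfFin_mem _ _ _
  obtain ⟨x₁, -, x₂, -, hlt, e1, e2⟩ := exists_two_zeros_iteratedDeriv n _ z
    (hF.sub hRsmooth) (fun i hi => hzero _ (hzm i hi)) (fun i hi => hins _ (hzm i hi))
    (fun i hi => by
      have h1 : i < n + 2 := by omega
      have h2 : i + 1 < n + 2 := by omega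
      simp only [z, h1, h2, dif_pos]
      exact e.strictMono (by simp [Fin.lt_def]))
  rw [show (fun x => F x - R.eval x) = F - fun t => R.eval t from rfl,
    iteratedDeriv_sub hF.contDiffAt hRsmooth.contDiffAt, iteratedDeriv_polynomial,
    sub_eq_zero] at e1 e2
  have hlin : ∀ t, (derivative^[n] R).eval t =
      ((1 + n).descFactorial n : ℝ) * lam * t + (derivative^[n] R).coeff 0 := by
    intro t
    have hd1 : (derivative^[n] R).natDegree ≤ 1 :=
      (natDegree_iterate_derivative R n).trans (by omega)
    have hc1 : (derivative^[n] R).coeff 1 = ((1 + n).descFactorial n : ℝ) * lam := by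
      rw [coeff_iterate_derivative, nsmul_eq_mul, add_comm 1 n, hRc]
    conv_lhs => rw [eq_X_add_C_of_natDegree_le_one hd1]
    rw [hc1]
    simp
  -- This number is `(n + 1)!`. Only the bound by `1` is kept, so the estimate loses the factor `1 /
  -- (n + 1)!`.
  have hfac : (1 : ℝ) ≤ ((1 + n).descFactorial n : ℝ) := by
    exact_mod_cast Nat.one_le_iff_ne_zero.2 (Nat.descFactorial_eq_zero_iff_lt.not.2 (by omega))
  have hle := hL x₁ x₂
  rw [e1, e2] at hle
  simp only [hlin] at hle
  rw [add_sub_add_right_eq_sub, ← mul_sub, abs_mul, abs_mul] at hle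
  have hlamL : |lam| ≤ L := by
    have h1 := le_of_mul_le_mul_right hle (abs_pos.2 (sub_ne_zero.2 hlt.ne))
    rw [abs_of_pos (by linarith)] at h1
    nlinarith [abs_nonneg lam]
  have : F x - Q.eval x = lam * N.eval x := by rw [hlam]; field_simp
  rw [this, abs_mul]
  exact mul_le_mul hlamL hNle (abs_nonneg _) hL0

/-! ### Orthogonal polynomials -/

/-- A measurable weight that is bounded and bounded away from zero. -/
structure IsWeight (w : ℝ → ℝ) : Prop where
  meas : Measurable w
  bounds : ∃ c C : ℝ, 0 < c ∧ ∀ t, c ≤ w t ∧ w t ≤ C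

namespace IsWeight

variable {w : ℝ → ℝ}

theorem pos (hw : IsWeight w) (t : ℝ) : 0 < w t := by
  obtain ⟨c, C, hc, h⟩ := hw.bounds
  exact hc.trans_le (h t).1

theorem intervalIntegrable (hw : IsWeight w) (s t : ℝ) : IntervalIntegrable w volume s t := by
  obtain ⟨c, C, hc, h⟩ := hw.bounds
  rw [intervalIntegrable_iff]
  refine IntegrableOn.of_bound measure_Ioc_lt_top hw.meas.aestronglyMeasurable C
    (Eventually.of_forall fun x => ?_)
  rw [Real.norm_of_nonneg (hw.pos x).le]
  exact (h x).2

theorem mul_continuous (hw : IsWeight w) {f : ℝ → ℝ} (hf : Continuous f) (s t : ℝ) :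
    IntervalIntegrable (fun x => w x * f x) volume s t :=
  (hw.intervalIntegrable s t).mul_continuousOn hf.continuousOn

/-- The functional `P ↦ ∫ w P` on polynomials. -/
noncomputable def polyIntegral (hw : IsWeight w) (s t : ℝ) : ℝ[X] →ₗ[ℝ] ℝ where
  toFun P := ∫ x in s..t, w x * P.eval x
  map_add' P Q := by
    rw [← intervalIntegral.integral_add (hw.mul_continuous P.continuous _ _)
      (hw.mul_continuous Q.continuous _ _)]
    simp only [eval_add, mul_add]
  map_smul' r P := by
    simp only [eval_smul, smul_eq_mul, RingHom.id_apply]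
    rw [← intervalIntegral.integral_const_mul]
    congr 1
    ext x
    ring

theorem polyIntegral_apply (hw : IsWeight w) (s t : ℝ) (P : ℝ[X]) :
    hw.polyIntegral s t P = ∫ x in s..t, w x * P.eval x := rfl

/-- The weight is only measurable, so positivity is first shown for the integral of `P` alone and
then transferred by the positive lower bound of `w`. -/
theorem polyIntegral_pos (hw : IsWeight w) {s t : ℝ} (hst : s < t) {P : ℝ[X]} (hP : P ≠ 0)
    (h : ∀ x ∈ Set.Ioo s t, 0 ≤ P.eval x) : 0 < hw.polyIntegral s t P := by
  obtain ⟨c, C, hc, hb⟩ := hw.bounds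
  have h' : ∀ x ∈ Set.Icc s t, 0 ≤ P.eval x := by
    rw [← closure_Ioo hst.ne]
    exact closure_minimal h (isClosed_le continuous_const P.continuous)
  have hex : ∃ x ∈ Set.Icc s t, 0 < P.eval x := by
    by_contra! hcon
    refine hP (P.eq_zero_of_infinite_isRoot ((Set.Icc_infinite hst).mono fun x hx => ?_))
    exact le_antisymm (hcon x hx) (h' x hx)
  have h1 : 0 < ∫ x in s..t, P.eval x := by
    exact intervalIntegral.integral_pos hst P.continuous.continuousOn
      (fun x hx => h' x (Set.Ioc_subset_Icc_self hx)) hex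
  have h2 : c * ∫ x in s..t, P.eval x ≤ hw.polyIntegral s t P := by
    rw [polyIntegral_apply, ← intervalIntegral.integral_const_mul]
    refine intervalIntegral.integral_mono_on hst.le
      ((continuous_const.mul P.continuous).intervalIntegrable _ _)
      (hw.mul_continuous P.continuous _ _) fun x hx => ?_
    exact mul_le_mul_of_nonneg_right (hb x).1 (h' x hx)
  exact (mul_pos hc h1).trans_le h2

end IsWeight

/-! ### Gram-Schmidt polynomials: degree, orthogonality, roots -/

theorem orthPoly_eq {w : ℝ → ℝ} (hw : IsWeight w) (n : ℕ) :
    orthPoly w n = X ^ n - ∑ m : Fin n,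
      C (hw.polyIntegral (-1) 1 (X ^ n * orthPoly w m) /
        hw.polyIntegral (-1) 1 (orthPoly w m ^ 2)) * orthPoly w m := by
  rw [orthPoly]
  congr 1
  refine Finset.sum_congr rfl fun m _ => ?_
  simp only [IsWeight.polyIntegral_apply, eval_mul, eval_pow, eval_X]

theorem orthPoly_monic_degree {w : ℝ → ℝ} (hw : IsWeight w) (n : ℕ) :
    (orthPoly w n).Monic ∧ (orthPoly w n).degree = n := by
  induction n using Nat.strong_induction_on with
  | _ n ih =>
    have hlt : (∑ m : Fin n,
      C (hw.polyIntegral (-1) 1 (X ^ n * orthPoly w m) /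
        hw.polyIntegral (-1) 1 (orthPoly w m ^ 2)) * orthPoly w m).degree < n := by
      rw [← mem_degreeLT]
      refine Submodule.sum_mem _ fun m _ => ?_
      rw [C_mul']
      refine Submodule.smul_mem _ _ ?_
      rw [mem_degreeLT, (ih m m.2).2]
      exact_mod_cast m.2
    rw [orthPoly_eq hw]
    refine ⟨monic_X_pow_sub hlt, ?_⟩
    rw [degree_sub_eq_left_of_degree_lt (by rwa [degree_X_pow]), degree_X_pow]

theorem orthPoly_ne_zero {w : ℝ → ℝ} (hw : IsWeight w) (n : ℕ) : orthPoly w n ≠ 0 :=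
  (orthPoly_monic_degree hw n).1.ne_zero

theorem natDegree_orthPoly {w : ℝ → ℝ} (hw : IsWeight w) (n : ℕ) :
    (orthPoly w n).natDegree = n :=
  natDegree_eq_of_degree_eq_some (orthPoly_monic_degree hw n).2

theorem orthPoly_orthogonal {w : ℝ → ℝ} (hw : IsWeight w) (n : ℕ) :
    ∀ m < n, hw.polyIntegral (-1) 1 (orthPoly w n * orthPoly w m) = 0 := by
  induction n using Nat.strong_induction_on with
  | _ n ih =>
    intro m hm
    have hpos : 0 < hw.polyIntegral (-1) 1 (orthPoly w m ^ 2) :=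
      hw.polyIntegral_pos (by norm_num) (pow_ne_zero 2 (orthPoly_ne_zero hw m))
        fun x _ => by rw [eval_pow]; positivity
    rw [orthPoly_eq hw n, sub_mul, map_sub, Finset.sum_mul, map_sum,
      Finset.sum_eq_single (⟨m, hm⟩ : Fin n)]
    · rw [mul_assoc, C_mul', map_smul, smul_eq_mul, ← pow_two]
      field_simp
      ring
    · intro k _ hk
      rw [mul_assoc, C_mul', map_smul, smul_eq_mul]
      have hkm : (k : ℕ) ≠ m := fun h => hk (Fin.ext h)
      rcases lt_or_gt_of_ne hkm with h | h
      · rw [mul_comm (orthPoly w k), ih m hm k h, mul_zero]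
      · rw [ih k k.2 m h, mul_zero]
    · intro h
      exact absurd (Finset.mem_univ _) h

theorem orthPoly_orthogonal_degree_lt {w : ℝ → ℝ} (hw : IsWeight w) (n : ℕ) {r : ℝ[X]}
    (hr : r.degree < n) : hw.polyIntegral (-1) 1 (orthPoly w n * r) = 0 := by
  have key : ∀ d ≤ n, ∀ r : ℝ[X], r.degree < d →
      hw.polyIntegral (-1) 1 (orthPoly w n * r) = 0 := by
    intro d
    induction d with
    | zero =>
      intro _ r hr
      have : r = 0 := by
        rw [← degree_eq_bot]
        exact Nat.WithBot.lt_zero_iff.1 (by exact_mod_cast hr)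
      rw [this, mul_zero, map_zero]
    | succ d ih =>
      intro hd r hr
      have hdec : r = (r - C (r.coeff d) * orthPoly w d) + C (r.coeff d) * orthPoly w d := by ring
      have hlt : (r - C (r.coeff d) * orthPoly w d).degree < d := by
        rw [degree_lt_iff_coeff_zero]
        intro m hm
        rw [coeff_sub, coeff_C_mul]
        rcases eq_or_lt_of_le hm with rfl | hm
        · have := (orthPoly_monic_degree hw d).1.coeff_natDegree
          rw [natDegree_orthPoly hw] at this
          rw [this, mul_one, sub_self]
        · rw [coeff_eq_zero_of_natDegree_lt (p := orthPoly w d)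
            (by rw [natDegree_orthPoly hw]; exact hm),
            (degree_lt_iff_coeff_zero _ _).1 hr m hm, mul_zero, sub_zero]
      rw [hdec, mul_add, map_add, ih (by omega) _ hlt, zero_add, mul_left_comm, C_mul', map_smul,
        orthPoly_orthogonal hw n d (by omega), smul_zero]
  exact key n le_rfl r hr

/-- Multiplying by a polynomial of degree at most the number of roots in an interval, one can
remove the sign changes there. -/
theorem exists_mul_nonneg {s t : ℝ} (hst : s < t) (k : ℕ) : ∀ P : ℝ[X], P ≠ 0 →
    (P.roots.toFinset.filter (· ∈ Set.Ioo s t)).card ≤ k →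
    ∃ r : ℝ[X], r ≠ 0 ∧ r.natDegree ≤ k ∧ ∀ x ∈ Set.Ioo s t, 0 ≤ (P * r).eval x := by
  classical
  have base : ∀ P : ℝ[X], P ≠ 0 → (P.roots.toFinset.filter (· ∈ Set.Ioo s t)) = ∅ →
      ∃ r : ℝ[X], r ≠ 0 ∧ r.natDegree ≤ 0 ∧ ∀ x ∈ Set.Ioo s t, 0 ≤ (P * r).eval x := by
    intro P hP hk
    have hno : ∀ x ∈ Set.Ioo s t, P.eval x ≠ 0 := fun x hx h0 => by
      have : x ∈ P.roots.toFinset.filter (· ∈ Set.Ioo s t) :=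
        Finset.mem_filter.2 ⟨by simpa [hP] using h0, hx⟩
      rw [hk] at this
      exact absurd this (Finset.notMem_empty x)
    obtain ⟨m, hm⟩ := Set.nonempty_Ioo.2 hst
    -- Without roots in the interval `P` has a constant sign there, so multiplying by one of its
    -- values makes it nonnegative.
    refine ⟨C (P.eval m), by simpa using hno m hm, by simp, fun x hx => ?_⟩
    rw [eval_mul, eval_C]
    by_contra! hneg
    have hc : ContinuousOn (fun x => P.eval x) (Set.Ioo s t) := P.continuous.continuousOn
    rcases lt_or_gt_of_ne (hno m hm) with h | h
    · obtain ⟨y, hy, hy0⟩ := isPreconnected_Ioo.intermediate_value hm hx hc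
        ⟨h.le, by nlinarith [pos_of_mul_neg_left hneg h.le]⟩
      exact hno y hy hy0
    · obtain ⟨y, hy, hy0⟩ := isPreconnected_Ioo.intermediate_value hx hm hc
        ⟨by nlinarith, h.le⟩
      exact hno y hy hy0
  induction k with
  | zero =>
    intro P hP hk
    exact base P hP (Finset.card_eq_zero.1 (Nat.le_zero.1 hk))
  | succ k ih =>
    intro P hP hk
    rcases (P.roots.toFinset.filter (· ∈ Set.Ioo s t)).eq_empty_or_nonempty with he | ⟨z, hz⟩
    · obtain ⟨r, h1, h2, h3⟩ := base P hP he
      exact ⟨r, h1, by omega, h3⟩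
    · obtain ⟨P₁, hP₁, hdvd⟩ := P.exists_eq_pow_rootMultiplicity_mul_and_not_dvd hP z
      set m := P.rootMultiplicity z
      have hP₁0 : P₁ ≠ 0 := fun h => hdvd (h ▸ dvd_zero _)
      have hsub : P₁.roots.toFinset.filter (· ∈ Set.Ioo s t) ⊆
          (P.roots.toFinset.filter (· ∈ Set.Ioo s t)).erase z := by
        intro y hy
        rw [Finset.mem_filter, Multiset.mem_toFinset, mem_roots hP₁0] at hy
        refine Finset.mem_erase.2 ⟨?_, Finset.mem_filter.2 ⟨?_, hy.2⟩⟩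
        · rintro rfl
          exact hdvd (dvd_iff_isRoot.2 hy.1)
        · rw [Multiset.mem_toFinset, mem_roots hP, hP₁, IsRoot.def, eval_mul, hy.1.eq_zero,
            mul_zero]
      have hc := (Finset.card_le_card hsub).trans_eq (Finset.card_erase_of_mem hz)
      obtain ⟨r, h1, h2, h3⟩ := ih P₁ hP₁0 (by omega)
      -- A root of even multiplicity is no sign change and needs no factor; for odd multiplicity one
      -- factor makes the exponent even.
      refine ⟨r * (X - C z) ^ (m % 2), mul_ne_zero h1 (pow_ne_zero _ (X_sub_C_ne_zero z)), ?_,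
        fun x hx => ?_⟩
      · refine natDegree_mul_le.trans (add_le_add h2 ?_)
        rw [natDegree_pow, natDegree_X_sub_C]
        omega
      · rw [hP₁, show (X - C z) ^ m * P₁ * (r * (X - C z) ^ (m % 2)) =
          (X - C z) ^ (m + m % 2) * (P₁ * r) by ring, eval_mul, eval_pow]
        refine mul_nonneg (Even.pow_nonneg ?_ _) (h3 x hx)
        rw [Nat.even_iff]
        omega

/-- With fewer than `n` distinct roots in `(-1, 1)`, some nonzero `r` of degree less than `n` makes
`P * r` nonnegative there. Its weighted integral would be positive by `polyIntegral_pos` and zero by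
orthogonality. Counting degrees then shows that these roots are all the roots and are simple. -/
theorem orthPoly_roots {w : ℝ → ℝ} (hw : IsWeight w) (n : ℕ) :
    (orthPoly w n).roots.card = n ∧ (orthPoly w n).roots.Nodup ∧
      ∀ r ∈ (orthPoly w n).roots, r ∈ Set.Ioo (-1 : ℝ) 1 := by
  classical
  set P := orthPoly w n with hP
  have hP0 : P ≠ 0 := orthPoly_ne_zero hw n
  set S := P.roots.toFinset.filter (· ∈ Set.Ioo (-1 : ℝ) 1) with hS
  have hcard : n ≤ S.card := by
    by_contra! hlt
    obtain ⟨r, h1, h2, h3⟩ := exists_mul_nonneg (by norm_num : (-1 : ℝ) < 1) S.card P hP0 le_rfl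
    have := hw.polyIntegral_pos (by norm_num) (mul_ne_zero hP0 h1) h3
    rw [orthPoly_orthogonal_degree_lt hw n
      (degree_le_natDegree.trans_lt (by exact_mod_cast h2.trans_lt hlt))] at this
    exact lt_irrefl _ this
  have h1 : S.card ≤ P.roots.toFinset.card := Finset.card_filter_le _ _
  have h2 : P.roots.toFinset.card ≤ P.roots.card := Multiset.toFinset_card_le _
  have h3 : P.roots.card ≤ n := (card_roots' P).trans_eq (natDegree_orthPoly hw n)
  refine ⟨by omega, Multiset.toFinset_card_eq_card_iff_nodup.1 (by omega), fun r hr => ?_⟩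
  have : S = P.roots.toFinset :=
    Finset.eq_of_subset_of_card_le (Finset.filter_subset _ _) (by omega)
  rw [← Multiset.mem_toFinset, ← this] at hr
  exact (Finset.mem_filter.1 hr).2

/-- The increasingly ordered roots of a polynomial with only simple roots, numbered from `0`. -/
theorem sort_roots_getD {P : ℝ[X]} {n : ℕ} (h1 : P.roots.card = n) (h2 : P.roots.Nodup) :
    (∀ i < n, (P.roots.sort (· ≤ ·)).getD i 0 ∈ P.roots) ∧
      ∀ i j, i < j → j < n →
        (P.roots.sort (· ≤ ·)).getD i 0 < (P.roots.sort (· ≤ ·)).getD j 0 := by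
  have hl : (P.roots.sort (· ≤ ·)).length = n := by rw [Multiset.length_sort, h1]
  have hnd : (P.roots.sort (· ≤ ·)).Nodup := by
    rw [← Multiset.coe_nodup, Multiset.sort_eq]; exact h2
  refine ⟨fun i hi => ?_, fun i j hij hj => ?_⟩
  · rw [List.getD_eq_getElem _ _ (by omega), ← Multiset.mem_sort (r := (· ≤ ·))]
    exact List.getElem_mem _
  · rw [List.getD_eq_getElem _ _ (by omega), List.getD_eq_getElem _ _ (by omega)]
    refine lt_of_le_of_ne ?_ ?_
    · exact List.pairwise_iff_getElem.1 (Multiset.pairwise_sort _ _) i j (by omega) (by omega) hij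
    · exact fun h => hij.ne ((List.Nodup.getElem_inj_iff hnd).1 h)

/-! ### Stability of interpolation at the zeros of an orthogonal polynomial -/

namespace IsWeight

variable {w : ℝ → ℝ} {s t : ℝ} {J : Finset ℕ} {g : ℕ → ℝ}

/-- Two different Lagrange basis polynomials have a product that vanishes at every node. It is
therefore the nodal polynomial times a factor of degree less than the number of nodes, to which the
nodal polynomial is orthogonal. -/
theorem polyIntegral_basis_mul_basis (hw : IsWeight w) (hg : Set.InjOn g J)
    (horth : ∀ r : ℝ[X], r.degree < J.card → hw.polyIntegral s t (Lagrange.nodal J g * r) = 0)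
    {i j : ℕ} (hi : i ∈ J) (hj : j ∈ J) (hij : i ≠ j) :
    hw.polyIntegral s t (Lagrange.basis J g i * Lagrange.basis J g j) = 0 := by
  obtain ⟨r, hr⟩ := dvd_iff_isRoot.2
    (show (Lagrange.basis J g i).IsRoot (g j) from Lagrange.eval_basis_of_ne hij hj)
  have hrd : r.degree < J.card := by
    refine (degree_le_of_dvd (Dvd.intro_left _ hr.symm) (Lagrange.basis_ne_zero hg hi)).trans_lt ?_
    rw [Lagrange.degree_basis hg hi]
    exact_mod_cast Nat.sub_lt (Finset.card_pos.2 ⟨i, hi⟩) one_pos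
  have h2 : Lagrange.basis J g i * Lagrange.basis J g j =
      Lagrange.nodalWeight J g j • (Lagrange.nodal J g * r) := by
    rw [Lagrange.basis_eq_prod_sub_inv_mul_nodal_div (i := j) hj,
      ← Lagrange.nodal_erase_eq_nodal_div hj, hr, Lagrange.nodal_eq_mul_nodal_erase hj, smul_eq_C_mul]
    ring
  rw [h2, map_smul, horth r hrd, smul_zero]

theorem polyIntegral_interpolate_sq (hw : IsWeight w) (hg : Set.InjOn g J)
    (horth : ∀ r : ℝ[X], r.degree < J.card → hw.polyIntegral s t (Lagrange.nodal J g * r) = 0)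
    (y : ℕ → ℝ) :
    hw.polyIntegral s t (Lagrange.interpolate J g y ^ 2) =
      ∑ j ∈ J, y j ^ 2 * hw.polyIntegral s t (Lagrange.basis J g j ^ 2) := by
  rw [Lagrange.interpolate_apply, pow_two, Finset.sum_mul_sum, map_sum]
  refine Finset.sum_congr rfl fun i hi => ?_
  rw [map_sum, Finset.sum_eq_single_of_mem i hi]
  · rw [show C (y i) * Lagrange.basis J g i * (C (y i) * Lagrange.basis J g i) =
      (y i ^ 2) • Lagrange.basis J g i ^ 2 by rw [smul_eq_C_mul, C_pow]; ring, map_smul,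
      smul_eq_mul]
  · intro j hj hji
    rw [show C (y i) * Lagrange.basis J g i * (C (y j) * Lagrange.basis J g j) =
      (y i * y j) • (Lagrange.basis J g i * Lagrange.basis J g j) by
        rw [smul_eq_C_mul, C_mul]; ring, map_smul,
      hw.polyIntegral_basis_mul_basis hg horth hi hj hji.symm, smul_zero]

/-- By orthogonality the squared norm is a sum of squared nodal values with positive coefficients.
Interpolating the constant `1` shows that the coefficients add up to `∫ w`. The bound is thus
independent of the degree and of the position of the nodes, hence of where the interface cuts its
element. -/
theorem polyIntegral_interpolate_sq_le (hw : IsWeight w) (hst : s < t) (hg : Set.InjOn g J)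
    (hJ : J.Nonempty)
    (horth : ∀ r : ℝ[X], r.degree < J.card → hw.polyIntegral s t (Lagrange.nodal J g * r) = 0)
    {y : ℕ → ℝ} {D : ℝ} (hy : ∀ j ∈ J, y j ^ 2 ≤ D) :
    hw.polyIntegral s t (Lagrange.interpolate J g y ^ 2) ≤ D * ∫ x in s..t, w x := by
  have h1 : ∫ x in s..t, w x = ∑ j ∈ J, hw.polyIntegral s t (Lagrange.basis J g j ^ 2) := by
    have := hw.polyIntegral_interpolate_sq hg horth (1 : ℕ → ℝ)
    rw [Lagrange.interpolate_one hg hJ] at this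
    simpa [polyIntegral_apply] using this
  rw [hw.polyIntegral_interpolate_sq hg horth, h1, Finset.mul_sum]
  refine Finset.sum_le_sum fun j hj => mul_le_mul_of_nonneg_right (hy j hj) ?_
  exact (hw.polyIntegral_pos hst (pow_ne_zero 2 (Lagrange.basis_ne_zero hg hj))
    fun x _ => by rw [eval_pow]; positivity).le

/-- The interpolation error of a function with small oscillation. -/
theorem integral_interpolate_sub_sq_le (hw : IsWeight w) (hst : s < t) (hg : Set.InjOn g J)
    (hJ : J.Nonempty) (hgs : ∀ j ∈ J, g j ∈ Set.Icc s t)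
    (horth : ∀ r : ℝ[X], r.degree < J.card → hw.polyIntegral s t (Lagrange.nodal J g * r) = 0)
    {W : ℝ → ℝ} (hW : ContinuousOn W (Set.Icc s t)) {D : ℝ}
    (hD : ∀ x ∈ Set.Icc s t, ∀ y ∈ Set.Icc s t, (W x - W y) ^ 2 ≤ D) :
    ∫ x in s..t, w x * ((Lagrange.interpolate J g fun j => W (g j)).eval x - W x) ^ 2 ≤
      4 * D * ∫ x in s..t, w x := by
  have hs : s ∈ Set.Icc s t := ⟨le_rfl, hst.le⟩
  -- Interpolation reproduces the constant `W s`, so only the oscillation of `W` enters.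
  set P := Lagrange.interpolate J g fun j => W (g j) - W s with hP
  have hPW : (Lagrange.interpolate J g fun j => W (g j)) = P + C (W s) := by
    have h1 : C (W s) = Lagrange.interpolate J g fun _ => W s := by
      have := Lagrange.eq_interpolate (f := C (W s)) hg
        (degree_C_le.trans_lt (by exact_mod_cast Finset.card_pos.2 hJ))
      simpa using this
    rw [hP, h1, ← map_add]
    congr 1
    ext j
    simp
  have hc : ContinuousOn W (Set.uIcc s t) := by rwa [Set.uIcc_of_le hst.le]
  have i1 : IntervalIntegrable
      (fun x => w x * ((Lagrange.interpolate J g fun j => W (g j)).eval x - W x) ^ 2)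
      volume s t :=
    (hw.intervalIntegrable s t).mul_continuousOn
      (((Polynomial.continuous _).continuousOn.sub hc).pow 2)
  have i2 : IntervalIntegrable (fun x => 2 * (w x * (P ^ 2).eval x)) volume s t :=
    (hw.mul_continuous (P ^ 2).continuous s t).const_mul 2
  have i3 : IntervalIntegrable (fun x => 2 * D * w x) volume s t :=
    (hw.intervalIntegrable s t).const_mul _
  calc _ ≤ ∫ x in s..t, (2 * (w x * (P ^ 2).eval x) + 2 * D * w x) := by
        refine intervalIntegral.integral_mono_on hst.le i1 (i2.add i3) fun x hx => ?_
        rw [hPW, eval_add, eval_C, eval_pow]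
        have h1 := hD s hs x hx
        have h2 := hw.pos x
        nlinarith [mul_nonneg h2.le (sq_nonneg (P.eval x - (W s - W x))),
          mul_le_mul_of_nonneg_left h1 h2.le]
    _ = 2 * hw.polyIntegral s t (P ^ 2) + 2 * D * ∫ x in s..t, w x := by
        rw [intervalIntegral.integral_add i2 i3, intervalIntegral.integral_const_mul,
          intervalIntegral.integral_const_mul, polyIntegral_apply]
    _ ≤ _ := by
        have := hw.polyIntegral_interpolate_sq_le hst hg hJ horth
          (y := fun j => W (g j) - W s) (fun j hj => hD _ (hgs j hj) s hs)
        linarith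

/-- Weighted Cauchy-Schwarz: the variance of `z` about its weighted mean `r` is nonnegative. -/
theorem sq_integral_le (hw : IsWeight w) (hst : s ≤ t) {z : ℝ → ℝ}
    (h1 : IntervalIntegrable (fun x => w x * z x) volume s t)
    (h2 : IntervalIntegrable (fun x => w x * z x ^ 2) volume s t) :
    (∫ x in s..t, w x * z x) ^ 2 ≤ (∫ x in s..t, w x) * ∫ x in s..t, w x * z x ^ 2 := by
  rcases eq_or_lt_of_le hst with rfl | hlt
  · simp
  have hpos : 0 < ∫ x in s..t, w x := by
    have := hw.polyIntegral_pos hlt (one_ne_zero (α := ℝ[X])) (fun x _ => by simp)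
    simpa [polyIntegral_apply] using this
  set r := (∫ x in s..t, w x * z x) / ∫ x in s..t, w x with hr
  have h0 : 0 ≤ ∫ x in s..t, (w x * z x ^ 2 - 2 * r * (w x * z x) + r ^ 2 * w x) := by
    refine intervalIntegral.integral_nonneg hst fun x _ => ?_
    have : w x * z x ^ 2 - 2 * r * (w x * z x) + r ^ 2 * w x = w x * (z x - r) ^ 2 := by ring
    rw [this]
    exact mul_nonneg (hw.pos x).le (sq_nonneg _)
  rw [intervalIntegral.integral_add (h2.sub (h1.const_mul _))
    ((hw.intervalIntegrable s t).const_mul _), intervalIntegral.integral_sub h2 (h1.const_mul _),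
    intervalIntegral.integral_const_mul, intervalIntegral.integral_const_mul] at h0
  have hrw : (∫ x in s..t, w x * z x) = r * ∫ x in s..t, w x := by rw [hr]; field_simp
  rw [hrw] at h0 ⊢
  nlinarith

theorem integral_le (hw : IsWeight w) {M : ℝ} (hM : ∀ x, w x ≤ M) (hst : s ≤ t) :
    ∫ x in s..t, w x ≤ M * (t - s) := by
  have := intervalIntegral.integral_mono_on hst (hw.intervalIntegrable s t)
    (intervalIntegrable_const (c := M)) fun x _ => hM x
  rw [intervalIntegral.integral_const, smul_eq_mul] at this
  linarith

end IsWeight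

/-! ### The energy estimate -/

/-- The energy estimate on a single element `[s, t]`: `F - q` is the error of the flux, and it
coincides with `W - K` in the nodes. -/
theorem IsWeight.element_energy_le {w : ℝ → ℝ} (hw : IsWeight w) {Ω : ℝ} (hΩ : ∀ x, w x ≤ Ω)
    {s t : ℝ} (hst : s < t) {J : Finset ℕ} {g : ℕ → ℝ} (hg : Set.InjOn g J) (hJ : J.Nonempty)
    (hgs : ∀ j ∈ J, g j ∈ Set.Icc s t)
    (horth : ∀ r : ℝ[X], r.degree < J.card → hw.polyIntegral s t (Lagrange.nodal J g * r) = 0)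
    {F : ℝ → ℝ} (hF : Continuous F) {q : ℝ[X]} (hq : q.degree < J.card) {B : ℝ}
    (hB : ∀ x ∈ Set.Icc s t,
      |F x - (Lagrange.interpolate J g fun j => F (g j)).eval x| ≤ B)
    {W : ℝ → ℝ} (hW : ContinuousOn W (Set.Icc s t)) {D : ℝ}
    (hD : ∀ x ∈ Set.Icc s t, ∀ y ∈ Set.Icc s t, (W x - W y) ^ 2 ≤ D)
    {K : ℝ} (hK : ∀ j ∈ J, F (g j) - q.eval (g j) = W (g j) - K) {h : ℝ} (hh : t - s ≤ h) :
    ∫ x in s..t, w x * (F x - q.eval x) ^ 2 ≤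
      (1 / 4 + h / 2) * (∫ x in s..t, w x * (F x - q.eval x) ^ 2) + B ^ 2 * Ω * (t - s) +
        2 * Ω * D + ∫ x in s..t, w x * (F x - q.eval x) * (W x - K) := by
  set Q := Lagrange.interpolate J g fun j => F (g j) with hQ
  set I := Lagrange.interpolate J g fun j => W (g j) with hI
  -- Both sides have degree less than the number of nodes and agree at the nodes by `hK`; this is
  -- the collocation property as an identity of polynomials.
  have hqI : q - C K = Q - I := by
    rw [hQ, hI, ← map_sub]
    have hd : (q - C K).degree < J.card := by
      refine (degree_sub_le _ _).trans_lt (max_lt hq ?_)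
      exact degree_C_le.trans_lt (by exact_mod_cast Finset.card_pos.2 hJ)
    rw [Lagrange.eq_interpolate hg hd]
    refine Lagrange.interpolate_eq_of_values_eq_on _ _ fun j hj => ?_
    simp only [eval_sub, eval_C, Pi.sub_apply]
    linarith [hK j hj]
  have hdec : ∀ x, F x - q.eval x = (F x - Q.eval x) + (I.eval x - W x) + (W x - K) := by
    intro x
    have := congrArg (eval x) hqI
    simp only [eval_sub, eval_C] at this
    linarith
  have hh0 : 0 < h := (sub_pos.2 hst).trans_le hh
  have hcF : Continuous fun x => F x - q.eval x := hF.sub q.continuous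
  have hc : ContinuousOn W (Set.uIcc s t) := by rwa [Set.uIcc_of_le hst.le]
  have i0 : IntervalIntegrable (fun x => w x * (F x - q.eval x) ^ 2) volume s t :=
    hw.mul_continuous (hcF.pow 2) s t
  have i1 : IntervalIntegrable (fun x => (1 / 4 + h / 2) * (w x * (F x - q.eval x) ^ 2))
      volume s t := i0.const_mul _
  have i2 : IntervalIntegrable (fun x => B ^ 2 * w x) volume s t :=
    (hw.intervalIntegrable s t).const_mul _
  have i3 : IntervalIntegrable (fun x => 1 / (2 * h) * (w x * (I.eval x - W x) ^ 2))
      volume s t :=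
    ((hw.intervalIntegrable s t).mul_continuousOn
      (((Polynomial.continuous _).continuousOn.sub hc).pow 2)).const_mul _
  have i4 : IntervalIntegrable (fun x => w x * (F x - q.eval x) * (W x - K)) volume s t :=
    (hw.mul_continuous hcF s t).mul_continuousOn (hc.sub continuousOn_const)
  have hΩI : ∫ x in s..t, w x ≤ Ω * (t - s) := hw.integral_le hΩ hst.le
  have hI0 : 0 ≤ ∫ x in s..t, w x := intervalIntegral.integral_nonneg hst.le fun x _ => (hw.pos x).le
  have hD0 : 0 ≤ D := (sq_nonneg _).trans (hD s ⟨le_rfl, hst.le⟩ s ⟨le_rfl, hst.le⟩)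
  have step : ∫ x in s..t, w x * (F x - q.eval x) ^ 2 ≤
      ∫ x in s..t, ((1 / 4 + h / 2) * (w x * (F x - q.eval x) ^ 2) + B ^ 2 * w x +
        1 / (2 * h) * (w x * (I.eval x - W x) ^ 2) + w x * (F x - q.eval x) * (W x - K)) := by
    refine intervalIntegral.integral_mono_on hst.le i0 (((i1.add i2).add i3).add i4) fun x hx => ?_
    set z := F x - q.eval x with hz
    set A := F x - Q.eval x
    set G := I.eval x - W x
    have e1 : z = A + G + (W x - K) := hdec x
    have hA : A ^ 2 ≤ B ^ 2 := sq_le_sq' (abs_le.1 (hB x hx)).1 (abs_le.1 (hB x hx)).2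
    have e2 : z * A ≤ 1 / 4 * z ^ 2 + B ^ 2 := by nlinarith [sq_nonneg (z / 2 - A)]
    -- Young's inequality with parameter `h`: the first part is absorbed for small `h`. The factor
    -- `1 / h` in the second is paid for by `∫ w G ^ 2 ≤ 4 D Ω h`, which leaves `2 Ω D`.
    have e3 : z * G ≤ h / 2 * z ^ 2 + 1 / (2 * h) * G ^ 2 := by
      have : h / 2 * z ^ 2 + 1 / (2 * h) * G ^ 2 - z * G = 1 / (2 * h) * (h * z - G) ^ 2 := by
        field_simp
        ring
      have h2 : 0 ≤ 1 / (2 * h) * (h * z - G) ^ 2 := by positivity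
      linarith
    have e4 : z ^ 2 = z * A + z * G + z * (W x - K) := by
      nth_rewrite 1 [pow_two, e1]
      ring
    have := mul_le_mul_of_nonneg_left (show z ^ 2 ≤ (1 / 4 + h / 2) * z ^ 2 + B ^ 2 +
      1 / (2 * h) * G ^ 2 + z * (W x - K) by linarith) (hw.pos x).le
    refine this.trans (le_of_eq ?_)
    ring
  rw [intervalIntegral.integral_add ((i1.add i2).add i3) i4,
    intervalIntegral.integral_add (i1.add i2) i3, intervalIntegral.integral_add i1 i2,
    intervalIntegral.integral_const_mul, intervalIntegral.integral_const_mul,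
    intervalIntegral.integral_const_mul] at step
  have hint := hw.integral_interpolate_sub_sq_le hst hg hJ hgs horth hW hD
  have b1 : B ^ 2 * ∫ x in s..t, w x ≤ B ^ 2 * Ω * (t - s) := by
    rw [mul_assoc]
    exact mul_le_mul_of_nonneg_left hΩI (sq_nonneg B)
  have hΩ0 : 0 ≤ Ω := (hw.pos 0).le.trans (hΩ 0)
  have b2 : 1 / (2 * h) * ∫ x in s..t, w x * (I.eval x - W x) ^ 2 ≤ 2 * Ω * D := by
    have h1 : 4 * D * ∫ x in s..t, w x ≤ 4 * D * (Ω * h) :=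
      mul_le_mul_of_nonneg_left (hΩI.trans (mul_le_mul_of_nonneg_left hh hΩ0)) (by positivity)
    have h2 := mul_le_mul_of_nonneg_left (hint.trans h1) (show 0 ≤ 1 / (2 * h) by positivity)
    refine h2.trans (le_of_eq ?_)
    field_simp
    ring
  linarith

/-- The flux error `d` of a piecewise polynomial collocation method, with primitive `e` with
respect to the weight `w`. -/
structure CollocationError (w : ℝ → ℝ) (a b : ℝ) (N : ℕ) (x : ℕ → ℝ) (J : Finset ℕ)
    (g : ℕ → ℕ → ℝ) (F d e : ℝ → ℝ) (q : ℕ → ℝ[X]) : Prop where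
  left : x 0 = a
  right : x N = b
  lt : ∀ i < N, x i < x (i + 1)
  nonempty : J.Nonempty
  inj : ∀ i < N, Set.InjOn (g i) J
  mem : ∀ i < N, ∀ j ∈ J, g i j ∈ Set.Icc (x i) (x (i + 1))
  orth : ∀ i < N, ∀ r : ℝ[X], r.degree < J.card →
    ∫ t in (x i)..(x (i + 1)), w t * (Lagrange.nodal J (g i) * r).eval t = 0
  cont : Continuous F
  deg : ∀ i < N, (q i).degree < J.card
  eq : ∀ i < N, ∀ t ∈ Set.Ioc (x i) (x (i + 1)), d t = F t - (q i).eval t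
  prim : IsPrimitiveOn e (fun t => w t * d t) a b
  ea : e a = 0
  eb : e b = 0

namespace CollocationError

variable {w : ℝ → ℝ} {a b : ℝ} {N : ℕ} {x : ℕ → ℝ} {J : Finset ℕ} {g : ℕ → ℕ → ℝ}
  {F d e : ℝ → ℝ} {q : ℕ → ℝ[X]}

theorem mono (H : CollocationError w a b N x J g F d e q) {i j : ℕ} (hij : i ≤ j) (hj : j ≤ N) :
    x i ≤ x j := by
  induction j, hij using Nat.le_induction with
  | base => exact le_rfl
  | succ k _ ih => exact (ih (by omega)).trans (H.lt k (by omega)).le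

theorem mem_Icc (H : CollocationError w a b N x J g F d e q) {i : ℕ} (hi : i ≤ N) :
    x i ∈ Set.Icc a b :=
  ⟨H.left ▸ H.mono (Nat.zero_le i) hi, H.right ▸ H.mono hi le_rfl⟩

theorem element_congr (H : CollocationError w a b N x J g F d e q) {i : ℕ} (hi : i < N)
    (Φ : ℝ → ℝ → ℝ) :
    ∫ t in (x i)..(x (i + 1)), Φ t (d t) =
      ∫ t in (x i)..(x (i + 1)), Φ t (F t - (q i).eval t) := by
  refine intervalIntegral.integral_congr_ae (Eventually.of_forall fun t ht => ?_)
  rw [Set.uIoc_of_le (H.lt i hi).le] at ht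
  rw [H.eq i hi t ht]

theorem integrable_element (H : CollocationError w a b N x J g F d e q) (hw : IsWeight w)
    {W : ℝ → ℝ} {i : ℕ} (hi : i < N) (hW : ContinuousOn W (Set.Icc (x i) (x (i + 1)))) (n : ℕ) :
    IntervalIntegrable (fun t => w t * d t ^ n * W t) volume (x i) (x (i + 1)) := by
  have : IntervalIntegrable (fun t => w t * (F t - (q i).eval t) ^ n * W t) volume
      (x i) (x (i + 1)) := by
    refine (hw.mul_continuous ((H.cont.sub (q i).continuous).pow n) _ _).mul_continuousOn ?_
    rwa [Set.uIcc_of_le (H.lt i hi).le]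
  refine this.congr fun t ht => ?_
  rw [Set.uIoc_of_le (H.lt i hi).le] at ht
  rw [H.eq i hi t ht]

theorem integrable (H : CollocationError w a b N x J g F d e q) (hw : IsWeight w)
    {W : ℝ → ℝ} (hW : ContinuousOn W (Set.Icc a b)) (n : ℕ) :
    IntervalIntegrable (fun t => w t * d t ^ n * W t) volume a b := by
  rw [← H.left, ← H.right]
  refine IntervalIntegrable.trans_iterate fun i hi => H.integrable_element hw hi (hW.mono ?_) n
  exact Set.Icc_subset_Icc (H.mem_Icc hi.le).1 (H.mem_Icc (Nat.succ_le_of_lt hi)).2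

theorem sum_integral (H : CollocationError w a b N x J g F d e q) {f : ℝ → ℝ}
    (hf : IntervalIntegrable f volume a b) :
    ∑ i ∈ Finset.range N, ∫ t in (x i)..(x (i + 1)), f t = ∫ t in a..b, f t := by
  rw [intervalIntegral.sum_integral_adjacent_intervals, H.left, H.right]
  intro i hi
  refine hf.mono_set ?_
  have h1 := H.mem_Icc hi.le
  have h2 := H.mem_Icc (Nat.succ_le_of_lt hi)
  rw [Set.uIcc_of_le (h1.1.trans h1.2)]
  exact Set.uIcc_subset_Icc h1 h2

/-- On an element of length `l`, Cauchy-Schwarz bounds the squared increments of `e` by `Ω l` times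
the local energy, and those of `∫ e` by `l ^ 2` times the global energy up to a constant. The sum of
the element estimates can therefore be absorbed under `hsmall`, while the global term with `W - K`
has a favourable sign. -/
theorem energy_le (H : CollocationError w a b N x J g F d e q) (hw : IsWeight w) {Ω : ℝ}
    (hΩ : ∀ t, w t ≤ Ω) {B γ c K h : ℝ} (hc : 0 ≤ c)
    (hB : ∀ i < N, ∀ t ∈ Set.Icc (x i) (x (i + 1)),
      |F t - (Lagrange.interpolate J (g i) fun j => F (g i j)).eval t| ≤ B)
    (hK : ∀ i < N, ∀ j ∈ J, F (g i j) - (q i).eval (g i j) =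
      γ * e (g i j) + c * (∫ t in a..g i j, e t) - K)
    (hh : ∀ i < N, x (i + 1) - x i ≤ h)
    (hsmall : h * (1 / 2 + 4 * Ω ^ 2 * (γ ^ 2 + c ^ 2 * (b - a) ^ 2)) ≤ 1 / 4) :
    ∫ t in a..b, w t * d t ^ 2 ≤ 2 * Ω * B ^ 2 * (b - a) := by
  have hab : a ≤ b := H.prim.le
  have hΩ0 : 0 < Ω := (hw.pos 0).trans_le (hΩ 0)
  have hec : ContinuousOn e (Set.Icc a b) := H.prim.continuousOn
  have hei : IntervalIntegrable e volume a b :=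
    ContinuousOn.intervalIntegrable (by rwa [Set.uIcc_of_le hab])
  set E : ℝ → ℝ := fun t => ∫ y in a..t, e y with hE
  have hEp : IsPrimitiveOn E e a b :=
    (isPrimitiveOn_integral hab hei 0).congr (fun t _ => by simp [hE])
      (Eventually.of_forall fun _ _ => rfl)
  set W : ℝ → ℝ := fun t => γ * e t + c * E t with hWdef
  have hWc : ContinuousOn W (Set.Icc a b) :=
    (continuousOn_const.mul hec).add (continuousOn_const.mul hEp.continuousOn)
  have iA : IntervalIntegrable (fun t => w t * d t ^ 2) volume a b := by
    simpa using H.integrable hw (continuousOn_const (c := (1 : ℝ))) 2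
  have iX : IntervalIntegrable (fun t => w t * d t * (W t - K)) volume a b := by
    simpa using H.integrable hw (hWc.sub (continuousOn_const (c := K))) 1
  set A := ∫ t in a..b, w t * d t ^ 2 with hA
  have hsubset : ∀ {s t : ℝ}, s ∈ Set.Icc a b → t ∈ Set.Icc a b → Set.uIcc s t ⊆ Set.uIcc a b := by
    intro s t hs ht
    rw [Set.uIcc_of_le hab]
    exact Set.uIcc_subset_Icc hs ht
  -- increments of `e`
  have hinc : ∀ s ∈ Set.Icc a b, ∀ t ∈ Set.Icc a b, s ≤ t →
      (e t - e s) ^ 2 ≤ Ω * (t - s) * ∫ y in s..t, w y * d y ^ 2 := by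
    intro s hs t ht hst
    rw [← H.prim.integral_eq hs ht]
    refine (hw.sq_integral_le hst (H.prim.int_sub hs ht) (iA.mono_set (hsubset hs ht))).trans ?_
    refine mul_le_mul_of_nonneg_right (hw.integral_le hΩ hst) ?_
    exact intervalIntegral.integral_nonneg hst fun y _ => mul_nonneg (hw.pos y).le (sq_nonneg _)
  have hmonoA : ∀ s ∈ Set.Icc a b, ∀ t ∈ Set.Icc a b, ∀ s' ∈ Set.Icc a b, ∀ t' ∈ Set.Icc a b,
      s' ≤ s → s ≤ t → t ≤ t' →
      ∫ y in s..t, w y * d y ^ 2 ≤ ∫ y in s'..t', w y * d y ^ 2 := by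
    intro s _ t _ s' hs' t' ht' h1 h2 h3
    refine intervalIntegral.integral_mono_interval h1 h2 h3
      (Eventually.of_forall fun y => mul_nonneg (hw.pos y).le (sq_nonneg _))
      (iA.mono_set (hsubset hs' ht'))
  have haI : a ∈ Set.Icc a b := ⟨le_rfl, hab⟩
  have hbI : b ∈ Set.Icc a b := ⟨hab, le_rfl⟩
  have hA0 : 0 ≤ A :=
    intervalIntegral.integral_nonneg hab fun y _ => mul_nonneg (hw.pos y).le (sq_nonneg _)
  have hsup : ∀ t ∈ Set.Icc a b, e t ^ 2 ≤ Ω * (b - a) * A := by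
    intro t ht
    have h1 := hinc a haI t ht ht.1
    rw [H.ea, sub_zero] at h1
    refine h1.trans (mul_le_mul (mul_le_mul_of_nonneg_left (by linarith [ht.2]) hΩ0.le)
      (hmonoA a haI t ht a haI b hbI le_rfl ht.1 ht.2) ?_ ?_)
    · exact intervalIntegral.integral_nonneg ht.1 fun y _ => mul_nonneg (hw.pos y).le (sq_nonneg _)
    · exact mul_nonneg hΩ0.le (sub_nonneg.2 hab)
  set S := Real.sqrt (Ω * (b - a) * A) with hS
  have hS2 : S ^ 2 = Ω * (b - a) * A :=
    Real.sq_sqrt (mul_nonneg (mul_nonneg hΩ0.le (sub_nonneg.2 hab)) hA0)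
  have hES : ∀ s ∈ Set.Icc a b, ∀ t ∈ Set.Icc a b,
      (E t - E s) ^ 2 ≤ (t - s) ^ 2 * (Ω * (b - a) * A) := by
    intro s hs t ht
    have h1 : |E t - E s| ≤ S * |t - s| := by
      rw [← hEp.integral_eq hs ht]
      refine intervalIntegral.norm_integral_le_of_norm_le_const (f := e) fun y hy => ?_
      refine Real.abs_le_sqrt (hsup y ?_)
      have := hsubset hs ht (Set.uIoc_subset_uIcc hy)
      rwa [Set.uIcc_of_le hab] at this
    rw [← sq_abs, ← hS2, ← sq_abs (t - s), ← mul_pow, mul_comm |t - s|]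
    exact pow_le_pow_left₀ (abs_nonneg _) h1 2
  -- elementwise estimates
  have hel : ∀ i ∈ Finset.range N,
      ∫ t in (x i)..(x (i + 1)), w t * d t ^ 2 ≤
        (1 / 4 + h / 2 + 4 * Ω ^ 2 * γ ^ 2 * h) * (∫ t in (x i)..(x (i + 1)), w t * d t ^ 2) +
        (B ^ 2 * Ω + 4 * Ω ^ 2 * c ^ 2 * (b - a) * A * h) * (x (i + 1) - x i) +
        ∫ t in (x i)..(x (i + 1)), w t * d t * (W t - K) := by
    intro i hi
    rw [Finset.mem_range] at hi
    have m1 := H.mem_Icc hi.le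
    have m2 := H.mem_Icc (Nat.succ_le_of_lt hi)
    have hlt := H.lt i hi
    have hsub : Set.Icc (x i) (x (i + 1)) ⊆ Set.Icc a b := Set.Icc_subset_Icc m1.1 m2.2
    set Ai := ∫ t in (x i)..(x (i + 1)), w t * d t ^ 2 with hAi
    have hAi0 : 0 ≤ Ai := intervalIntegral.integral_nonneg hlt.le
      fun y _ => mul_nonneg (hw.pos y).le (sq_nonneg _)
    set l := x (i + 1) - x i with hl
    have hl0 : 0 ≤ l := sub_nonneg.2 hlt.le
    have hlh : l ≤ h := hh i hi
    have hosc' : ∀ s ∈ Set.Icc (x i) (x (i + 1)), ∀ t ∈ Set.Icc (x i) (x (i + 1)), s ≤ t →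
        (W t - W s) ^ 2 ≤ 2 * γ ^ 2 * (Ω * l * Ai) + 2 * c ^ 2 * (l ^ 2 * (Ω * (b - a) * A)) := by
      intro s hs t ht hst
      have e1 : (e t - e s) ^ 2 ≤ Ω * l * Ai := by
        refine (hinc s (hsub hs) t (hsub ht) hst).trans
          (mul_le_mul (mul_le_mul_of_nonneg_left (by linarith [hs.1, ht.2]) hΩ0.le)
          (hmonoA s (hsub hs) t (hsub ht) _ m1 _ m2 hs.1 hst ht.2) ?_ (by positivity))
        exact intervalIntegral.integral_nonneg hst fun y _ => mul_nonneg (hw.pos y).le (sq_nonneg _)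
      have e2 : (E t - E s) ^ 2 ≤ l ^ 2 * (Ω * (b - a) * A) := by
        refine (hES s (hsub hs) t (hsub ht)).trans (mul_le_mul_of_nonneg_right ?_ ?_)
        · exact pow_le_pow_left₀ (sub_nonneg.2 hst) (by linarith [hs.1, ht.2]) 2
        · exact mul_nonneg (mul_nonneg hΩ0.le (sub_nonneg.2 hab)) hA0
      have e3 : W t - W s = γ * (e t - e s) + c * (E t - E s) := by simp only [hWdef]; ring
      rw [e3]
      nlinarith [sq_nonneg (γ * (e t - e s) - c * (E t - E s)),
        mul_le_mul_of_nonneg_left e1 (sq_nonneg γ), mul_le_mul_of_nonneg_left e2 (sq_nonneg c)]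
    have hosc : ∀ s ∈ Set.Icc (x i) (x (i + 1)), ∀ t ∈ Set.Icc (x i) (x (i + 1)),
        (W s - W t) ^ 2 ≤ 2 * γ ^ 2 * (Ω * l * Ai) + 2 * c ^ 2 * (l ^ 2 * (Ω * (b - a) * A)) := by
      intro s hs t ht
      rcases le_total s t with hst | hst
      · rw [← neg_sub, neg_sq]; exact hosc' s hs t ht hst
      · exact hosc' t ht s hs hst
    have key := hw.element_energy_le hΩ hlt (H.inj i hi) H.nonempty (H.mem i hi) (H.orth i hi)
      H.cont (H.deg i hi) (hB i hi) (hWc.mono hsub) hosc (hK i hi) hlh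
    rw [← H.element_congr hi (fun t z => w t * z ^ 2),
      ← H.element_congr hi (fun t z => w t * z * (W t - K))] at key
    refine key.trans ?_
    have p1 : γ ^ 2 * (Ω * l * Ai) ≤ γ ^ 2 * (Ω * h * Ai) := by gcongr
    -- This term contains the global energy, so one factor `l` is kept: summed over the elements it
    -- gives `b - a` rather than the number of elements.
    have p2 : c ^ 2 * (l ^ 2 * (Ω * (b - a) * A)) ≤ c ^ 2 * (h * l * (Ω * (b - a) * A)) := by
      have : 0 ≤ Ω * (b - a) * A := mul_nonneg (mul_nonneg hΩ0.le (sub_nonneg.2 hab)) hA0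
      rw [pow_two l]
      gcongr
    nlinarith [mul_le_mul_of_nonneg_left p1 hΩ0.le, mul_le_mul_of_nonneg_left p2 hΩ0.le]
  have hsum := Finset.sum_le_sum hel
  rw [Finset.sum_add_distrib, Finset.sum_add_distrib, ← Finset.mul_sum, ← Finset.mul_sum,
    H.sum_integral iA, H.sum_integral iX, Finset.sum_range_sub, H.left, H.right, ← hA] at hsum
  -- the coercive terms
  have hX : ∫ t in a..b, w t * d t * (W t - K) ≤ 0 := by
    have c1 := H.prim.integral_mul H.prim
    have c2 := H.prim.integral_mul hEp
    have j1 : IntervalIntegrable (fun t => w t * d t * e t) volume a b := by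
      simpa using H.integrable hw hec 1
    have j2 : IntervalIntegrable (fun t => w t * d t * E t) volume a b := by
      simpa using H.integrable hw hEp.continuousOn 1
    have j3 : IntervalIntegrable (fun t => e t * e t) volume a b :=
      ContinuousOn.intervalIntegrable (by rw [Set.uIcc_of_le hab]; exact hec.mul hec)
    have j4 : IntervalIntegrable (fun t => e t * (w t * d t)) volume a b := by
      simpa only [mul_comm] using j1
    rw [intervalIntegral.integral_add j1 j4, H.ea, H.eb] at c1
    rw [intervalIntegral.integral_add j2 j3, H.ea, H.eb] at c2
    have c3 : ∫ t in a..b, e t * (w t * d t) = ∫ t in a..b, w t * d t * e t := by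
      simp only [mul_comm]
    have c4 := H.prim.integral_eq haI hbI
    rw [H.ea, H.eb] at c4
    have c5 : 0 ≤ ∫ t in a..b, e t * e t :=
      intervalIntegral.integral_nonneg hab fun t _ => mul_self_nonneg _
    have c6 : ∫ t in a..b, w t * d t * (W t - K) =
        γ * (∫ t in a..b, w t * d t * e t) + c * (∫ t in a..b, w t * d t * E t) -
          K * ∫ t in a..b, w t * d t := by
      rw [← intervalIntegral.integral_const_mul, ← intervalIntegral.integral_const_mul,
        ← intervalIntegral.integral_const_mul,
        ← intervalIntegral.integral_add (j1.const_mul _) (j2.const_mul _),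
        ← intervalIntegral.integral_sub ((j1.const_mul _).add (j2.const_mul _))
          (H.prim.int.const_mul _)]
      congr 1
      ext t
      simp only [hWdef]
      ring
    -- Since `e' = w d` and `e` vanishes at both ends, convection contributes nothing, whatever the
    -- sign of `γ`, and the constant `K` drops out. Reaction contributes `-c ∫ e ^ 2`.
    have c7 : ∫ t in a..b, w t * d t * e t = 0 := by linarith
    have c8 : ∫ t in a..b, w t * d t * E t = -∫ t in a..b, e t * e t := by linarith
    rw [c6, c7, c8, c4]
    nlinarith
  -- The total coefficient of `A` on the right is at most `1 / 4 + 1 / 4`, so half of the energy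
  -- remains on the left.
  nlinarith [mul_le_mul_of_nonneg_right hsmall hA0]

end CollocationError

/-! ### The reference element -/

theorem isWeight_one : IsWeight fun _ => 1 :=
  ⟨measurable_const, 1, 1, one_pos, fun _ => ⟨le_rfl, le_rfl⟩⟩

theorem isWeight_one_div_beta {α βm βp : ℝ} (hm : 0 < βm) (hp : 0 < βp) :
    IsWeight fun t => 1 / beta α βm βp t := by
  refine ⟨?_, 1 / max βm βp, 1 / min βm βp, by positivity, fun t => ?_⟩
  · unfold beta
    exact measurable_const.div (Measurable.ite measurableSet_Iic measurable_const measurable_const)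
  · have h0 : 0 < min βm βp := lt_min hm hp
    unfold beta
    split_ifs
    · exact ⟨one_div_le_one_div_of_le hm (le_max_left _ _),
        one_div_le_one_div_of_le h0 (min_le_left _ _)⟩
    · exact ⟨one_div_le_one_div_of_le hp (le_max_right _ _),
        one_div_le_one_div_of_le h0 (min_le_right _ _)⟩

theorem isPrimitiveOn_affine (r s c d : ℝ) (h : c ≤ d) :
    IsPrimitiveOn (fun ξ => r * ξ + s) (fun _ => r) c d := by
  refine isPrimitiveOn_of_hasDerivAt h (fun ξ => ?_) continuous_const
  simpa using ((hasDerivAt_id ξ).const_mul r).add_const s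

/-- The factor `1` is the reference weight of an element without interface, so that both kinds of
element share the form weight times polynomial. For `n = 0` the truncated subtraction gives the
correct degree of a constant. -/
theorem lobatto_isPrimitiveOn (n : ℕ) : ∃ r : ℝ[X], r.natDegree ≤ n - 1 ∧
    IsPrimitiveOn (lobatto n) (fun ξ => 1 * r.eval ξ) (-1) 1 := by
  match n with
  | 0 =>
    refine ⟨C (-1 / 2), by simp, (isPrimitiveOn_affine (-1 / 2) (1 / 2) (-1) 1 (by norm_num)).congr
      (fun ξ _ => ?_) (Eventually.of_forall fun ξ _ => ?_)⟩
    · simp only [lobatto]; ring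
    · simp
  | 1 =>
    refine ⟨C (1 / 2), by simp, (isPrimitiveOn_affine (1 / 2) (1 / 2) (-1) 1 (by norm_num)).congr
      (fun ξ _ => ?_) (Eventually.of_forall fun ξ _ => ?_)⟩
    · simp only [lobatto]; ring
    · simp
  | n + 2 =>
    refine ⟨legendre (n + 1), ?_, (isPrimitiveOn_integral (by norm_num)
      ((legendre (n + 1)).continuous.intervalIntegrable (-1) 1) 0).congr
      (fun ξ _ => ?_) (Eventually.of_forall fun ξ _ => ?_)⟩
    · refine (natDegree_C_mul_le _ _).trans ?_
      rw [natDegree_orthPoly isWeight_one]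
      omega
    · simp only [lobatto]; ring
    · simp

/-- The kink at `α'` is carried entirely by `1 / β`: the flux is a single polynomial across the
interface, constant for the two nodal functions. -/
theorem genLobatto_isPrimitiveOn {α' βm βp : ℝ} (hα : α' ∈ Set.Ioo (-1 : ℝ) 1) (hm : 0 < βm)
    (hp : 0 < βp) (n : ℕ) : ∃ r : ℝ[X], r.natDegree ≤ n - 1 ∧
      IsPrimitiveOn (genLobatto α' βm βp n) (fun ξ => 1 / beta α' βm βp ξ * r.eval ξ) (-1) 1 := by
  obtain ⟨h1, h2⟩ := hα
  have hden : 0 < (1 - α') * βm + (1 + α') * βp := by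
    have := mul_pos (show 0 < 1 - α' by linarith) hm
    have := mul_pos (show 0 < 1 + α' by linarith) hp
    linarith
  set den := (1 - α') * βm + (1 + α') * βp with hdendef
  match n with
  | 0 =>
    refine ⟨C (-(βm * βp / den)), by simp, IsPrimitiveOn.trans (s := α') ?_ ?_⟩
    · refine (isPrimitiveOn_affine (-βp / den) (((1 - α') * βm + α' * βp) / den) (-1) α' h1.le).congr
        (fun ξ hξ => ?_) (Eventually.of_forall fun ξ hξ => ?_)
      · simp only [genLobatto, if_pos hξ.2, ← hdendef]; ring
      · simp only [beta, if_pos hξ.2, eval_C]; field_simp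
    · refine (isPrimitiveOn_affine (-βm / den) (βm / den) α' 1 h2.le).congr
        (fun ξ hξ => ?_) (Eventually.of_forall fun ξ hξ => ?_)
      · rcases eq_or_lt_of_le hξ.1 with rfl | hlt
        · simp only [genLobatto, if_pos le_rfl, ← hdendef]; ring
        · simp only [genLobatto, if_neg (not_le.2 hlt), ← hdendef]; ring
      · simp only [beta, if_neg (not_le.2 hξ.1), eval_C]; field_simp
  | 1 =>
    refine ⟨C (βm * βp / den), by simp, IsPrimitiveOn.trans (s := α') ?_ ?_⟩
    · refine (isPrimitiveOn_affine (βp / den) (βp / den) (-1) α' h1.le).congr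
        (fun ξ hξ => ?_) (Eventually.of_forall fun ξ hξ => ?_)
      · simp only [genLobatto, if_pos hξ.2, ← hdendef]; ring
      · simp only [beta, if_pos hξ.2, eval_C]; field_simp
    · refine (isPrimitiveOn_affine (βm / den) ((-α' * βm + (1 + α') * βp) / den) α' 1 h2.le).congr
        (fun ξ hξ => ?_) (Eventually.of_forall fun ξ hξ => ?_)
      · rcases eq_or_lt_of_le hξ.1 with rfl | hlt
        · simp only [genLobatto, if_pos le_rfl, ← hdendef]; ring
        · simp only [genLobatto, if_neg (not_le.2 hlt), ← hdendef]; ring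
      · simp only [beta, if_neg (not_le.2 hξ.1), eval_C]; field_simp
  | n + 2 =>
    refine ⟨genLegendre α' βm βp (n + 1), ?_, (isPrimitiveOn_integral (by norm_num)
      ((isWeight_one_div_beta hm hp).mul_continuous
        (genLegendre α' βm βp (n + 1)).continuous (-1) 1) 0).congr
      (fun ξ _ => ?_) (Eventually.of_forall fun ξ _ => rfl)⟩
    · rw [genLegendre, natDegree_orthPoly (isWeight_one_div_beta hm hp)]
      omega
    · simp only [genLobatto]; ring

/-- The weight of the reference element that corresponds to the `i`-th element. -/
noncomputable def refWeight (α βm βp : ℝ) (k : ℕ) (x : ℕ → ℝ) (i : ℕ) (ξ : ℝ) : ℝ :=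
  if i = k then 1 / beta (toRef x k α) βm βp ξ else 1

theorem isWeight_refWeight {α βm βp : ℝ} (hm : 0 < βm) (hp : 0 < βp) (k : ℕ) (x : ℕ → ℝ)
    (i : ℕ) : IsWeight (refWeight α βm βp k x i) := by
  by_cases h : i = k
  · have : refWeight α βm βp k x i = fun ξ => 1 / beta (toRef x k α) βm βp ξ :=
      funext fun ξ => if_pos h
    rw [this]
    exact isWeight_one_div_beta hm hp
  · have : refWeight α βm βp k x i = fun _ => 1 := funext fun ξ => if_neg h
    rw [this]
    exact isWeight_one

theorem gaussPoly_eq (α βm βp : ℝ) (p k : ℕ) (x : ℕ → ℝ) (i : ℕ) :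
    ∃ r : ℝ, r ≠ 0 ∧ gaussPoly α βm βp p k x i = C r * orthPoly (refWeight α βm βp k x i) p := by
  by_cases h : i = k
  · have : refWeight α βm βp k x i = fun ξ => 1 / beta (toRef x k α) βm βp ξ :=
      funext fun ξ => if_pos h
    exact ⟨1, one_ne_zero, by rw [gaussPoly, if_pos h, this, C_1, one_mul, genLegendre]⟩
  · have : refWeight α βm βp k x i = fun _ => 1 := funext fun ξ => if_neg h
    rw [gaussPoly, if_neg h, this, legendre]
    refine ⟨_, ?_, rfl⟩
    have hpos := isWeight_one.polyIntegral_pos (show (-1 : ℝ) < 1 by norm_num)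
      (pow_ne_zero 2 (orthPoly_ne_zero isWeight_one p)) fun x _ => by rw [eval_pow]; positivity
    simp only [IsWeight.polyIntegral_apply, one_mul, eval_pow] at hpos
    exact (Real.sqrt_pos.2 (by positivity)).ne'

/-! ### Elements -/

theorem IsPrimitiveOn.comp_affine {f g : ℝ → ℝ} {s t m c : ℝ} (hm : 0 < m)
    (h : IsPrimitiveOn f g (m * s + c) (m * t + c)) :
    IsPrimitiveOn (fun y => f (m * y + c)) (fun y => m * g (m * y + c)) s t := by
  have hmap : ∀ y ∈ Set.Icc s t, m * y + c ∈ Set.Icc (m * s + c) (m * t + c) := fun y hy =>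
    ⟨by nlinarith [hy.1], by nlinarith [hy.2]⟩
  refine ⟨by nlinarith [h.le], ?_, fun y hy => ?_⟩
  · have h1 := (h.int.comp_add_right c).comp_mul_left (c := m)
    rw [add_sub_cancel_right, add_sub_cancel_right, mul_div_cancel_left₀ _ hm.ne',
      mul_div_cancel_left₀ _ hm.ne'] at h1
    exact h1.const_mul m
  · rw [intervalIntegral.integral_const_mul, intervalIntegral.integral_comp_mul_add g hm.ne',
      smul_eq_mul, ← mul_assoc, mul_inv_cancel₀ hm.ne', one_mul, h.eq _ (hmap y hy)]

section Element

variable {a b α βm βp : ℝ} {p N k : ℕ} {x : ℕ → ℝ}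

theorem IsPartition.mono (hx : IsPartition a b α N k x) {i j : ℕ} (hij : i ≤ j) (hj : j ≤ N) :
    x i ≤ x j := by
  induction j, hij using Nat.le_induction with
  | base => exact le_rfl
  | succ n _ ih =>
    exact (ih (by omega)).trans (hx.lt (n + 1) (Finset.mem_Icc.2 ⟨by omega, hj⟩)).le

theorem toRef_eq (i : ℕ) (t : ℝ) : toRef x i t =
    2 / (x i - x (i - 1)) * t + -(x (i - 1) + x i) / (x i - x (i - 1)) := by
  rw [toRef]; ring

theorem fromRef_eq (i : ℕ) (ξ : ℝ) : fromRef x i ξ =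
    (x i - x (i - 1)) / 2 * ξ + (x (i - 1) + x i) / 2 := by
  rw [fromRef]; ring

theorem toRef_fromRef {i : ℕ} (h : x (i - 1) < x i) (ξ : ℝ) : toRef x i (fromRef x i ξ) = ξ := by
  have : x i - x (i - 1) ≠ 0 := (sub_pos.2 h).ne'
  rw [toRef, fromRef]
  field_simp
  ring

theorem toRef_le_toRef {i : ℕ} (h : x (i - 1) < x i) {s t : ℝ} :
    toRef x i s ≤ toRef x i t ↔ s ≤ t := by
  rw [toRef, toRef, div_le_div_iff_of_pos_right (sub_pos.2 h)]
  constructor <;> intro <;> linarith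

theorem toRef_left {i : ℕ} (h : x (i - 1) < x i) : toRef x i (x (i - 1)) = -1 := by
  have : x i - x (i - 1) ≠ 0 := (sub_pos.2 h).ne'
  rw [toRef]
  field_simp
  ring

theorem toRef_right {i : ℕ} (h : x (i - 1) < x i) : toRef x i (x i) = 1 := by
  have : x i - x (i - 1) ≠ 0 := (sub_pos.2 h).ne'
  rw [toRef]
  field_simp
  ring

theorem IsPartition.toRef_interface (hx : IsPartition a b α N k x) :
    toRef x k α ∈ Set.Ioo (-1 : ℝ) 1 := by
  have h := hx.lt k hx.mem
  constructor
  · rw [← toRef_left h, ← not_le, toRef_le_toRef h, not_le]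
    exact hx.lt_interface
  · rw [← toRef_right h, ← not_le, toRef_le_toRef h, not_le]
    exact hx.interface_lt

theorem fromRef_lt_fromRef {i : ℕ} (h : x (i - 1) < x i) {s t : ℝ} (hst : s < t) :
    fromRef x i s < fromRef x i t := by
  rw [fromRef_eq, fromRef_eq]
  have := sub_pos.2 h
  nlinarith

theorem fromRef_mem {i : ℕ} (h : x (i - 1) < x i) {ξ : ℝ} (hξ : ξ ∈ Set.Ioo (-1 : ℝ) 1) :
    fromRef x i ξ ∈ Set.Ioo (x (i - 1)) (x i) := by
  have := sub_pos.2 h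
  rw [fromRef]
  constructor <;> nlinarith [hξ.1, hξ.2]

/-- Up to a factor, the weight `1 / β` on an element is the pull-back of the reference weight. -/
theorem IsPartition.exists_weight_eq (hx : IsPartition a b α N k x) (hm : 0 < βm) (hp : 0 < βp)
    {i : ℕ} (hi : i ∈ Finset.Icc 1 N) : ∃ κ : ℝ, κ ≠ 0 ∧
      ∀ t ∈ Set.Ioc (x (i - 1)) (x i),
        1 / beta α βm βp t = κ * refWeight α βm βp k x i (toRef x i t) := by
  obtain ⟨hi1, hi2⟩ := Finset.mem_Icc.1 hi
  obtain ⟨hk1, hk2⟩ := Finset.mem_Icc.1 hx.mem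
  rcases lt_trichotomy i k with h | rfl | h
  · refine ⟨1 / βm, by positivity, fun t ht => ?_⟩
    have : t ≤ α := ht.2.trans ((hx.mono (by omega) (by omega)).trans hx.lt_interface.le)
    rw [beta, if_pos this, refWeight, if_neg h.ne, mul_one]
  · refine ⟨1, one_ne_zero, fun t ht => ?_⟩
    rw [refWeight, if_pos rfl, one_mul, beta, beta]
    simp only [toRef_le_toRef (hx.lt i hi)]
  · refine ⟨1 / βp, by positivity, fun t ht => ?_⟩
    have : α < t := hx.interface_lt.trans_le ((hx.mono (by omega) (by omega)).trans ht.1.le)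
    rw [beta, if_neg (not_le.2 this), refWeight, if_neg h.ne', mul_one]

/-- The reference statement transported by the affine map. Its slope and the factor `κ` between the
two weights are constants and go into the polynomial. -/
theorem basisFun_isPrimitiveOn (hx : IsPartition a b α N k x) (hm : 0 < βm) (hp : 0 < βp)
    (hp1 : 1 ≤ p) {i : ℕ} (hi : i ∈ Finset.Icc 1 N) {n : ℕ} (hn : n ≤ p) :
    ∃ q : ℝ[X], q.degree < p ∧ IsPrimitiveOn (basisFun α βm βp k x i n)
      (fun t => 1 / beta α βm βp t * q.eval t) (x (i - 1)) (x i) := by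
  have hlt := hx.lt i hi
  have hl : 0 < x i - x (i - 1) := sub_pos.2 hlt
  obtain ⟨κ, hκ0, hκ⟩ := hx.exists_weight_eq hm hp hi
  have href : ∃ r : ℝ[X], r.natDegree ≤ n - 1 ∧ IsPrimitiveOn
      (fun ξ => if i = k then genLobatto (toRef x k α) βm βp n ξ else lobatto n ξ)
      (fun ξ => refWeight α βm βp k x i ξ * r.eval ξ) (-1) 1 := by
    unfold refWeight
    by_cases h : i = k
    · simpa only [h, if_true] using genLobatto_isPrimitiveOn hx.toRef_interface hm hp n
    · simpa only [h, if_false] using lobatto_isPrimitiveOn n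
  obtain ⟨r, hr, hprim⟩ := href
  rw [← toRef_left hlt, ← toRef_right hlt, toRef_eq i (x (i - 1)), toRef_eq i (x i)] at hprim
  have hprim' := hprim.comp_affine (div_pos two_pos hl)
  refine ⟨C (2 / (x i - x (i - 1)) / κ) * r.comp (C (2 / (x i - x (i - 1))) * X +
    C (-(x (i - 1) + x i) / (x i - x (i - 1)))), ?_, hprim'.congr (fun t _ => ?_)
    (Eventually.of_forall fun t ht => ?_)⟩
  · refine degree_le_natDegree.trans_lt ?_
    have h1 : ((C (2 / (x i - x (i - 1))) * X +
      C (-(x (i - 1) + x i) / (x i - x (i - 1)))) : ℝ[X]).natDegree ≤ 1 := natDegree_linear_le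
    have h2 := natDegree_C_mul_le (2 / (x i - x (i - 1)) / κ)
      (r.comp (C (2 / (x i - x (i - 1))) * X + C (-(x (i - 1) + x i) / (x i - x (i - 1)))))
    rw [natDegree_comp] at h2
    have h3 : r.natDegree * ((C (2 / (x i - x (i - 1))) * X +
      C (-(x (i - 1) + x i) / (x i - x (i - 1)))) : ℝ[X]).natDegree ≤ (p - 1) * 1 :=
      Nat.mul_le_mul (by omega) h1
    exact_mod_cast show _ < p by omega
  · simp only [basisFun, toRef_eq i]
  · rw [hκ t ht, toRef_eq i]
    simp only [eval_mul, eval_C, eval_comp, eval_add, eval_X]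
    field_simp

theorem MemTrial.exists_isPrimitiveOn {v : ℝ → ℝ} (hv : MemTrial a b α βm βp p N k x v)
    (hx : IsPartition a b α N k x) (hm : 0 < βm) (hp : 0 < βp)
    (hp1 : 1 ≤ p) {i : ℕ} (hi : i ∈ Finset.Icc 1 N) :
    ∃ q : ℝ[X], q.degree < p ∧ IsPrimitiveOn v
      (fun t => 1 / beta α βm βp t * q.eval t) (x (i - 1)) (x i) := by
  obtain ⟨d, hd⟩ := hv.mem_span i hi
  have key : ∀ m ≤ p + 1, ∃ q : ℝ[X], q.degree < p ∧
      IsPrimitiveOn (fun t => ∑ n ∈ Finset.range m, d n * basisFun α βm βp k x i n t)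
        (fun t => 1 / beta α βm βp t * q.eval t) (x (i - 1)) (x i) := by
    intro m
    induction m with
    | zero =>
      intro _
      refine ⟨0, by rw [degree_zero]; exact WithBot.bot_lt_coe _,
        (isPrimitiveOn_affine 0 0 _ _ (hx.lt i hi).le).congr (fun t _ => by simp)
          (Eventually.of_forall fun t _ => by simp)⟩
    | succ m ih =>
      intro hm'
      obtain ⟨q, hq, hqp⟩ := ih (by omega)
      obtain ⟨r, hr, hrp⟩ := basisFun_isPrimitiveOn hx hm hp hp1 hi (n := m) (by omega)
      refine ⟨q + C (d m) * r, ?_, (hqp.add (hrp.const_mul (d m))).congr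
        (fun t _ => by simp only [Finset.sum_range_succ])
        (Eventually.of_forall fun t _ => by
          simp only [eval_add, eval_mul, eval_C]; ring)⟩
      refine (degree_add_le _ _).trans_lt (max_lt hq ?_)
      rw [← mem_degreeLT, C_mul']
      exact Submodule.smul_mem _ _ (mem_degreeLT.2 hr)
  obtain ⟨q, hq, hqp⟩ := key (p + 1) le_rfl
  exact ⟨q, hq, hqp.congr hd (Eventually.of_forall fun _ _ => rfl)⟩

/-! ### Gauss points -/

/-- The `j`-th root, `1 ≤ j ≤ p`, of the Gauss polynomial of the `i`-th element. -/
noncomputable def gaussRoot (α βm βp : ℝ) (p k : ℕ) (x : ℕ → ℝ) (i j : ℕ) : ℝ :=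
  ((gaussPoly α βm βp p k x i).roots.sort (· ≤ ·)).getD (j - 1) 0

theorem gaussPt_eq {i j : ℕ} (hj : j ≤ p) :
    gaussPt α βm βp p k x i j = fromRef x i (gaussRoot α βm βp p k x i j) := if_pos hj

theorem gaussPt_succ (hp1 : 1 ≤ p) (i : ℕ) :
    gaussPt α βm βp p k x i (p + 1) = gaussPt α βm βp p k x (i + 1) 1 := by
  rw [gaussPt, if_neg (by omega), gaussPt, if_pos hp1]

theorem gaussRoot_spec (hm : 0 < βm) (hp : 0 < βp) (i : ℕ) :
    (∀ j ∈ Finset.Icc 1 p, gaussRoot α βm βp p k x i j ∈ Set.Ioo (-1 : ℝ) 1 ∧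
      (orthPoly (refWeight α βm βp k x i) p).eval (gaussRoot α βm βp p k x i j) = 0) ∧
    ∀ j l, 1 ≤ j → j < l → l ≤ p →
      gaussRoot α βm βp p k x i j < gaussRoot α βm βp p k x i l := by
  obtain ⟨r, hr, hG⟩ := gaussPoly_eq α βm βp p k x i
  have hroots : (gaussPoly α βm βp p k x i).roots =
      (orthPoly (refWeight α βm βp k x i) p).roots := by rw [hG, roots_C_mul _ hr]
  obtain ⟨h1, h2, h3⟩ := orthPoly_roots (isWeight_refWeight (α := α) hm hp k x i) p
  obtain ⟨s1, s2⟩ := sort_roots_getD h1 h2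
  unfold gaussRoot
  rw [hroots]
  refine ⟨fun j hj => ?_, fun j l hj hjl hl => s2 _ _ (by omega) (by omega)⟩
  rw [Finset.mem_Icc] at hj
  have := s1 (j - 1) (by omega)
  exact ⟨h3 _ this, isRoot_of_mem_roots this⟩

theorem gaussPt_mem (hx : IsPartition a b α N k x) (hm : 0 < βm) (hp : 0 < βp) {i j : ℕ}
    (hi : i ∈ Finset.Icc 1 N) (hj : j ∈ Finset.Icc 1 p) :
    gaussPt α βm βp p k x i j ∈ Set.Ioo (x (i - 1)) (x i) := by
  rw [gaussPt_eq (Finset.mem_Icc.1 hj).2]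
  exact fromRef_mem (hx.lt i hi) ((gaussRoot_spec hm hp i).1 j hj).1

theorem gaussPt_lt (hx : IsPartition a b α N k x) (hm : 0 < βm) (hp : 0 < βp) {i j l : ℕ}
    (hi : i ∈ Finset.Icc 1 N) (hj : 1 ≤ j) (hjl : j < l) (hl : l ≤ p) :
    gaussPt α βm βp p k x i j < gaussPt α βm βp p k x i l := by
  rw [gaussPt_eq hl, gaussPt_eq (hjl.le.trans hl)]
  exact fromRef_lt_fromRef (hx.lt i hi) ((gaussRoot_spec hm hp i).2 j l hj hjl hl)

theorem gaussPt_injOn (hx : IsPartition a b α N k x) (hm : 0 < βm) (hp : 0 < βp) {i : ℕ}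
    (hi : i ∈ Finset.Icc 1 N) :
    Set.InjOn (gaussPt α βm βp p k x i) (Finset.Icc 1 p : Finset ℕ) := by
  intro j hj l hl h
  rw [Finset.mem_coe, Finset.mem_Icc] at hj hl
  rcases lt_trichotomy j l with hjl | hjl | hjl
  · exact absurd h (gaussPt_lt hx hm hp hi hj.1 hjl hl.2).ne
  · exact hjl
  · exact absurd h (gaussPt_lt hx hm hp hi hl.1 hjl hj.2).ne'

/-- Two monic polynomials of degree `p` that agree at `p` distinct points are equal. -/
theorem orthPoly_eq_nodal (hm : 0 < βm) (hp : 0 < βp) (i : ℕ) :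
    orthPoly (refWeight α βm βp k x i) p =
      Lagrange.nodal (Finset.Icc 1 p) (gaussRoot α βm βp p k x i) := by
  obtain ⟨s1, s2⟩ := gaussRoot_spec (α := α) (p := p) (k := k) (x := x) hm hp i
  obtain ⟨m1, m2⟩ := orthPoly_monic_degree (isWeight_refWeight (α := α) hm hp k x i) p
  have hinj : Set.InjOn (gaussRoot α βm βp p k x i) (Finset.Icc 1 p : Finset ℕ) := by
    intro j hj l hl h
    rw [Finset.mem_coe, Finset.mem_Icc] at hj hl
    rcases lt_trichotomy j l with hjl | hjl | hjl
    · exact absurd h (s2 j l hj.1 hjl hl.2).ne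
    · exact hjl
    · exact absurd h (s2 l j hl.1 hjl hj.2).ne'
  have hcard : (Finset.Icc 1 p).card = p := by simp
  refine eq_of_degree_sub_lt_of_eval_index_eq _ hinj ?_ fun j hj => ?_
  · rw [hcard, ← m2]
    refine degree_sub_lt_left ?_ m1.ne_zero ?_
    · rw [m2, Lagrange.degree_nodal, hcard]
    · rw [m1.leadingCoeff, Lagrange.nodal_monic.leadingCoeff]
  · rw [(s1 j hj).2, Lagrange.eval_nodal_at_node hj]

/-- Orthogonality on the reference element survives the change of variables: nodal polynomial and
weight change only by constant factors, and composition with an affine map does not raise the degree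
of `r`. -/
theorem integral_nodal_gaussPt_mul (hx : IsPartition a b α N k x) (hm : 0 < βm) (hp : 0 < βp)
    {i : ℕ} (hi : i ∈ Finset.Icc 1 N) {r : ℝ[X]} (hr : r.degree < p) :
    ∫ t in (x (i - 1))..(x i), 1 / beta α βm βp t *
      (Lagrange.nodal (Finset.Icc 1 p) (gaussPt α βm βp p k x i) * r).eval t = 0 := by
  have hlt := hx.lt i hi
  set l := x i - x (i - 1) with hl
  have hl0 : 0 < l := sub_pos.2 hlt
  obtain ⟨κ, -, hκ⟩ := hx.exists_weight_eq hm hp hi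
  set m := (x (i - 1) + x i) / 2 with hmdef
  set R : ℝ[X] := r.comp (C (l / 2) * X + C m) with hR
  have hRd : R.degree < p := by
    rcases eq_or_ne r 0 with rfl | hr0
    · rw [hR, zero_comp]; exact hr
    · refine degree_le_natDegree.trans_lt ?_
      have h1 : ((C (l / 2) * X + C m) : ℝ[X]).natDegree ≤ 1 := natDegree_linear_le
      rw [hR, natDegree_comp]
      have h2 : r.natDegree < p := (natDegree_lt_iff_degree_lt hr0).2 hr
      have h3 := Nat.mul_le_mul_left r.natDegree h1
      exact_mod_cast show _ < p by omega
  have h0 := orthPoly_orthogonal_degree_lt (isWeight_refWeight (α := α) hm hp k x i) p hRd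
  rw [IsWeight.polyIntegral_apply, orthPoly_eq_nodal hm hp i] at h0
  have hsub := intervalIntegral.integral_comp_mul_add (a := -1) (b := 1)
    (fun t => 1 / beta α βm βp t *
      (Lagrange.nodal (Finset.Icc 1 p) (gaussPt α βm βp p k x i) * r).eval t)
    (show l / 2 ≠ 0 by positivity) m
  have e1 : l / 2 * -1 + m = x (i - 1) := by rw [hl, hmdef]; ring
  have e2 : l / 2 * 1 + m = x i := by rw [hl, hmdef]; ring
  rw [e1, e2] at hsub
  have hz : ∫ ξ in (-1 : ℝ)..1, 1 / beta α βm βp (l / 2 * ξ + m) *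
      (Lagrange.nodal (Finset.Icc 1 p) (gaussPt α βm βp p k x i) * r).eval (l / 2 * ξ + m) =
      κ * (l / 2) ^ p * ∫ ξ in (-1 : ℝ)..1, refWeight α βm βp k x i ξ *
        (Lagrange.nodal (Finset.Icc 1 p) (gaussRoot α βm βp p k x i) * R).eval ξ := by
    rw [← intervalIntegral.integral_const_mul]
    refine intervalIntegral.integral_congr_ae (Eventually.of_forall fun ξ hξ => ?_)
    rw [Set.uIoc_of_le (by norm_num)] at hξ
    have hmem : l / 2 * ξ + m ∈ Set.Ioc (x (i - 1)) (x i) := by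
      rw [← e1, ← e2]
      constructor <;> nlinarith [hξ.1, hξ.2]
    rw [hκ _ hmem, ← fromRef_eq, toRef_fromRef hlt]
    have hnod : (Lagrange.nodal (Finset.Icc 1 p) (gaussPt α βm βp p k x i)).eval
        (fromRef x i ξ) = (l / 2) ^ p *
        (Lagrange.nodal (Finset.Icc 1 p) (gaussRoot α βm βp p k x i)).eval ξ := by
      rw [Lagrange.eval_nodal, Lagrange.eval_nodal]
      have : (l / 2) ^ p = ∏ _j ∈ Finset.Icc 1 p, l / 2 := by
        rw [Finset.prod_const]; simp only [Nat.card_Icc, add_tsub_cancel_right]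
      rw [this, ← Finset.prod_mul_distrib]
      refine Finset.prod_congr rfl fun j hj => ?_
      rw [gaussPt_eq (Finset.mem_Icc.1 hj).2, fromRef_eq, fromRef_eq]
      ring
    have hRe : R.eval ξ = r.eval (fromRef x i ξ) := by
      rw [hR, eval_comp, fromRef_eq]
      simp only [eval_add, eval_mul, eval_C, eval_X, hl, hmdef]
    rw [eval_mul, eval_mul, hnod, hRe]
    ring
  rw [hz, h0, mul_zero, smul_eq_mul] at hsub
  have := mul_eq_zero.1 hsub.symm
  exact this.resolve_left (by positivity)

end Element

/-! ### Regularity of the exact solution -/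

theorem IsWeakDeriv.seminorm_eq {s : Set ℝ} (hs : IsOpen s) {j : ℕ} {v g : ℝ → ℝ}
    (h : IsWeakDeriv s j v g) (q : ℝ≥0∞) :
    seminorm s j q v = eLpNorm g q (volume.restrict s) := by
  refine le_antisymm (iInf₂_le g h) (le_iInf₂ fun g' hg' => le_of_eq (eLpNorm_congr_ae ?_))
  exact (ae_restrict_iff' hs.measurableSet).2 (h.ae_unique hs hg')

theorem ae_abs_le_of_memLp_top {s : Set ℝ} (hs : MeasurableSet s) {g : ℝ → ℝ}
    (hg : MemLp g ∞ (volume.restrict s)) :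
    ∀ᵐ x, x ∈ s → |g x| ≤ (eLpNorm g ∞ (volume.restrict s)).toReal := by
  rw [← ae_restrict_iff' hs]
  filter_upwards [ae_le_eLpNormEssSup (f := g) (μ := volume.restrict s)] with x hx
  rw [← eLpNorm_exponent_top] at hx
  have := ENNReal.toReal_mono hg.2.ne hx
  simpa using this

theorem eqOn_Icc_of_ae_eq_Ioo {s t : ℝ} (hst : s < t) {f g : ℝ → ℝ}
    (hf : ContinuousOn f (Set.Icc s t)) (hg : ContinuousOn g (Set.Icc s t))
    (h : ∀ᵐ x, x ∈ Set.Ioo s t → f x = g x) : Set.EqOn f g (Set.Icc s t) := by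
  refine Measure.eqOn_Icc_of_ae_eq volume hst.ne ?_ hf hg
  rw [← restrict_Ioo_eq_restrict_Icc]
  exact (ae_restrict_iff' measurableSet_Ioo).2 h

theorem exists_representative {s t : ℝ} (hst : s < t) {p : ℕ} (hp : 1 ≤ p) {u : ℝ → ℝ}
    (hu : MemW (Set.Ioo s t) (p + 1) ∞ u) (hc : ContinuousOn u (Set.Icc s t)) :
    ∃ (V : ℝ → ℝ) (M : ℝ), 0 ≤ M ∧ ContDiff ℝ p V ∧
      (∀ x y, |iteratedDeriv p V x - iteratedDeriv p V y| ≤ M * |x - y|) ∧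
      Set.EqOn u V (Set.Icc s t) ∧
      (∀ j ≤ p, ∀ g, IsWeakDeriv (Set.Ioo s t) j u g →
        ∀ᵐ x, x ∈ Set.Ioo s t → g x = iteratedDeriv j V x) ∧
      (∀ g, IsWeakDeriv (Set.Ioo s t) 2 u g → IsPrimitiveOn (deriv V) g s t) ∧
      ENNReal.ofReal M = seminorm (Set.Ioo s t) (p + 1) ∞ u := by
  have hrep : ∀ m ≤ p, ∃ (V : ℝ → ℝ) (M : ℝ), 0 ≤ M ∧ ContDiff ℝ m V ∧
      (∀ x y, |iteratedDeriv m V x - iteratedDeriv m V y| ≤ M * |x - y|) ∧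
      Set.EqOn u V (Set.Icc s t) ∧
      (∀ j ≤ m, ∀ g, IsWeakDeriv (Set.Ioo s t) j u g →
        ∀ᵐ x, x ∈ Set.Ioo s t → g x = iteratedDeriv j V x) ∧
      (∀ g, IsWeakDeriv (Set.Ioo s t) (m + 1) u g → IsPrimitiveOn (iteratedDeriv m V) g s t) ∧
      ENNReal.ofReal M = seminorm (Set.Ioo s t) (m + 1) ∞ u := by
    intro m hm
    obtain ⟨g, hg, hgM⟩ := hu (m + 1) (by omega)
    obtain ⟨V, h1, h2, h3, h4⟩ := exists_contDiff_representative hst ENNReal.toReal_nonneg m u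
      (fun j hj => (hu j (by omega)).imp fun _ h => h.1)
      ⟨g, hg, ae_abs_le_of_memLp_top measurableSet_Ioo hgM⟩
    refine ⟨V, _, ENNReal.toReal_nonneg, h1, h2, ?_, h3, h4, ?_⟩
    · refine eqOn_Icc_of_ae_eq_Ioo hst hc h1.continuous.continuousOn ?_
      simpa only [iteratedDeriv_zero] using h3 0 (Nat.zero_le m) u hg.zero_self
    · rw [ENNReal.ofReal_toReal hgM.2.ne, hg.seminorm_eq isOpen_Ioo]
  obtain ⟨V, M, h1, h2, h3, h4, h5, -, h6⟩ := hrep p le_rfl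
  -- The second representative, with `m = 1`, serves the differential equation: it says that `V₁'`
  -- is a primitive of the second weak derivative. Both representatives equal `u` on the interval,
  -- so this passes to `V`.
  obtain ⟨V₁, M₁, -, k2, -, k4, -, k5, -⟩ := hrep 1 hp
  refine ⟨V, M, h1, h2, h3, h4, h5, fun g hg => ?_, h6⟩
  have hd : Set.EqOn (deriv V) (deriv V₁) (Set.Ioo s t) := by
    intro x hx
    refine Filter.EventuallyEq.deriv_eq ?_
    filter_upwards [isOpen_Ioo.mem_nhds hx] with y hy
    rw [← h4 (Set.Ioo_subset_Icc_self hy), k4 (Set.Ioo_subset_Icc_self hy)]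
  have hd' := hd.closure (h2.continuous_deriv (by exact_mod_cast hp))
    (k2.continuous_deriv (by simp))
  rw [closure_Ioo hst.ne] at hd'
  have := k5 g hg
  rw [iteratedDeriv_one] at this
  exact this.congr hd' (Eventually.of_forall fun _ _ => rfl)

theorem not_ae_notMem_Ioo {s t : ℝ} (hst : s < t) : ¬ ∀ᵐ x : ℝ, x ∉ Set.Ioo s t := by
  intro h
  have h0 : volume (Set.Ioo s t) = 0 := by
    rw [ae_iff] at h
    simpa only [not_not, Set.ofPred_mem_eq] using h
  rw [Real.volume_Ioo, ENNReal.ofReal_eq_zero] at h0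
  linarith

/-- Otherwise `f` and `V` would differ on a whole interval next to `t`, which has positive measure.
This turns the limits in `JumpZero`, taken along some representative, into values of the smooth one.
-/
theorem eq_of_tendsto_left {s t l : ℝ} (hst : s < t) {f V : ℝ → ℝ}
    (hf : Tendsto f (𝓝[<] t) (𝓝 l)) (hV : Continuous V)
    (h : ∀ᵐ x, x ∈ Set.Ioo s t → f x = V x) : l = V t := by
  by_contra hne
  have hev := (hf.sub (hV.continuousAt.tendsto.mono_left nhdsWithin_le_nhds)).eventually_ne
    (sub_ne_zero.2 hne)
  obtain ⟨c, hc, hsub⟩ := (mem_nhdsLT_iff_exists_Ioo_subset' hst).1 hev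
  refine not_ae_notMem_Ioo (max_lt hc hst : max c s < t) ?_
  filter_upwards [h] with x hx hx'
  exact hsub ⟨(le_max_left _ _).trans_lt hx'.1, hx'.2⟩
    (sub_eq_zero.2 (hx ⟨(le_max_right _ _).trans_lt hx'.1, hx'.2⟩))

theorem eq_of_tendsto_right {s t l : ℝ} (hst : s < t) {f V : ℝ → ℝ}
    (hf : Tendsto f (𝓝[>] s) (𝓝 l)) (hV : Continuous V)
    (h : ∀ᵐ x, x ∈ Set.Ioo s t → f x = V x) : l = V s := by
  by_contra hne
  have hev := (hf.sub (hV.continuousAt.tendsto.mono_left nhdsWithin_le_nhds)).eventually_ne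
    (sub_ne_zero.2 hne)
  obtain ⟨c, hc, hsub⟩ := (mem_nhdsGT_iff_exists_Ioo_subset' hst).1 hev
  refine not_ae_notMem_Ioo (lt_min hc hst : s < min c t) ?_
  filter_upwards [h] with x hx hx'
  exact hsub ⟨hx'.1, hx'.2.trans_le (min_le_left _ _)⟩
    (sub_eq_zero.2 (hx ⟨hx'.1, hx'.2.trans_le (min_le_right _ _)⟩))

theorem iteratedDeriv_const_mul_deriv (V : ℝ → ℝ) (r : ℝ) (j : ℕ) :
    iteratedDeriv j (fun t => r * deriv V t) = fun t => r * iteratedDeriv (j + 1) V t := by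
  induction j with
  | zero => simp [iteratedDeriv_one]
  | succ j ih =>
    rw [iteratedDeriv_succ, ih]
    ext t
    rw [deriv_const_mul_field, ← iteratedDeriv_succ]

theorem ContDiff.const_mul_deriv {n : ℕ} {V : ℝ → ℝ} (hV : ContDiff ℝ (n + 1 : ℕ) V) (r : ℝ) :
    ContDiff ℝ n (fun t => r * deriv V t) := by
  push_cast at hV
  exact contDiff_const.mul (contDiff_succ_iff_deriv.1 hV).2.2

/-- The flux of the exact solution extends to a smooth function, whose derivative of order `p - 1`
is Lipschitz continuous. -/
theorem exists_smooth_flux {a b α βm βp γ c : ℝ} {p : ℕ} {f u : ℝ → ℝ} (hp : 1 ≤ p)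
    (hm : 0 < βm) (hβp : 0 < βp) (hα : α ∈ Set.Ioo a b)
    (hu : MemWTilde a b α βm βp (p + 1) ∞ u) (hex : IsExactSolution a b α βm βp γ c f u) :
    ∃ (F : ℝ → ℝ) (M : ℝ), 0 ≤ M ∧ ENNReal.ofReal M ≤ brokenWInftyNorm a b α (p + 1) u ∧
      ContDiff ℝ (p - 1 : ℕ) F ∧
      (∀ x y, |iteratedDeriv (p - 1) F x - iteratedDeriv (p - 1) F y| ≤
        max βm βp * M * |x - y|) ∧
      IsPrimitiveOn u (fun t => 1 / beta α βm βp t * F t) a b ∧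
      IsPrimitiveOn (fun t => γ * u t - F t) (fun t => f t - c * u t) a b := by
  obtain ⟨n, rfl⟩ : ∃ n, p = n + 1 := ⟨p - 1, by omega⟩
  rw [Nat.add_sub_cancel]
  obtain ⟨Vl, Ml, l1, l2, l3, l4, l5, l6, l7⟩ := exists_representative hα.1 hp hu.left_mem
    (hu.continuousOn.mono (Set.Icc_subset_Icc_right hα.2.le))
  obtain ⟨Vr, Mr, r1, r2, r3, r4, r5, r6, r7⟩ := exists_representative hα.2 hp hu.right_mem
    (hu.continuousOn.mono (Set.Icc_subset_Icc_left hα.1.le))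
  -- The jump condition of order `j` matches the derivatives of order `j - 1` of the two one-sided
  -- fluxes.
  have hjump : ∀ j, 1 ≤ j → j ≤ n + 1 →
      βm * iteratedDeriv j Vl α = βp * iteratedDeriv j Vr α := by
    intro j hj1 hj2
    obtain ⟨gm, gp, l, r, h1, h2, h3, h4, h5⟩ := hu.jump j hj1 (by omega)
    have e1 := eq_of_tendsto_left hα.1 h3 (l2.continuous_iteratedDeriv j (by exact_mod_cast hj2))
      (l5 j hj2 gm h1)
    have e2 := eq_of_tendsto_right hα.2 h4 (r2.continuous_iteratedDeriv j (by exact_mod_cast hj2))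
      (r5 j hj2 gp h2)
    rw [← e1, ← e2]
    linarith
  set fl : ℝ → ℝ := fun t => βm * deriv Vl t with hfl
  set fr : ℝ → ℝ := fun t => βp * deriv Vr t with hfr
  have hfα : fl α = fr α := by
    simpa only [iteratedDeriv_one] using hjump 1 le_rfl (by omega)
  have hitl : ∀ j, iteratedDeriv j fl = fun t => βm * iteratedDeriv (j + 1) Vl t :=
    iteratedDeriv_const_mul_deriv Vl βm
  have hitr : ∀ j, iteratedDeriv j fr = fun t => βp * iteratedDeriv (j + 1) Vr t :=
    iteratedDeriv_const_mul_deriv Vr βp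
  have hcl : ContDiff ℝ n fl := ContDiff.const_mul_deriv l2 βm
  have hcr : ContDiff ℝ n fr := ContDiff.const_mul_deriv r2 βp
  have hmatch : ∀ j ≤ n, iteratedDeriv j fl α = iteratedDeriv j fr α := by
    intro j hj
    rw [hitl, hitr]
    exact hjump (j + 1) (by omega) (by omega)
  obtain ⟨g1, g2⟩ := contDiff_glue α n fl fr hcl hcr hmatch
  have hlip : ∀ {β M' : ℝ} {V : ℝ → ℝ}, 0 < β → β ≤ max βm βp → M' ≤ max Ml Mr →
      (∀ x y, |iteratedDeriv (n + 1) V x - iteratedDeriv (n + 1) V y| ≤ M' * |x - y|) →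
      ∀ x y, |β * iteratedDeriv (n + 1) V x - β * iteratedDeriv (n + 1) V y| ≤
        max βm βp * max Ml Mr * |x - y| := by
    intro β M' V hβ hβ' hM' hV x y
    rw [← mul_sub, abs_mul, abs_of_pos hβ, mul_assoc]
    exact mul_le_mul hβ' ((hV x y).trans (mul_le_mul_of_nonneg_right hM' (abs_nonneg _)))
      (abs_nonneg _) (hβ.le.trans hβ')
  have hFl : Set.EqOn (glue α fl fr) fl (Set.Icc a α) := fun t ht => if_pos ht.2
  have hFr : Set.EqOn (glue α fl fr) fr (Set.Icc α b) := by
    intro t ht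
    rcases eq_or_lt_of_le ht.1 with rfl | hlt
    · exact (if_pos le_rfl).trans hfα
    · exact if_neg (not_le.2 hlt)
  have hpl : IsPrimitiveOn u (deriv Vl) a α :=
    (isPrimitiveOn_of_hasDerivAt hα.1.le
      (fun t => (l2.differentiable (by simp) t).hasDerivAt)
      (l2.continuous_deriv (by simp))).congr l4 (Eventually.of_forall fun _ _ => rfl)
  have hpr : IsPrimitiveOn u (deriv Vr) α b :=
    (isPrimitiveOn_of_hasDerivAt hα.2.le
      (fun t => (r2.differentiable (by simp) t).hasDerivAt)
      (r2.continuous_deriv (by simp))).congr r4 (Eventually.of_forall fun _ _ => rfl)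
  refine ⟨glue α fl fr, max Ml Mr, l1.trans (le_max_left _ _), ?_, g1, ?_, ?_, ?_⟩
  · rw [Monotone.map_max ENNReal.ofReal_mono, l7, r7]
    exact le_iSup₂_of_le (f := fun j _ => max (seminorm (Set.Ioo a α) j ∞ u)
      (seminorm (Set.Ioo α b) j ∞ u)) (n + 1 + 1) (by simp) le_rfl
  · rw [g2]
    refine abs_glue_sub_le ?_ ?_ (hmatch n le_rfl)
    · rw [hitl]
      exact hlip hm (le_max_left _ _) (le_max_left _ _) l3
    · rw [hitr]
      exact hlip hβp (le_max_right _ _) (le_max_right _ _) r3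
  · refine IsPrimitiveOn.trans (s := α) ?_ ?_
    · refine hpl.congr (fun _ _ => rfl) (Eventually.of_forall fun t ht => ?_)
      rw [hFl (Set.Ioc_subset_Icc_self ht), beta, if_pos ht.2, hfl]
      field_simp
    · refine hpr.congr (fun _ _ => rfl) (Eventually.of_forall fun t ht => ?_)
      rw [hFr (Set.Ioc_subset_Icc_self ht), beta, if_neg (not_le.2 ht.1), hfr]
      field_simp
  -- On each side the equation reads `(γ u - β u')' = f - c u`. As `u` and the flux are continuous
  -- at `α`, the two integrated forms join, which also makes `f - c u` integrable on the whole
  -- interval.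
  · have hside : ∀ {s t β : ℝ} {V : ℝ → ℝ}, s < t → Set.EqOn (glue α fl fr)
        (fun t => β * deriv V t) (Set.Icc s t) → IsPrimitiveOn u (deriv V) s t →
        (∀ g, IsWeakDeriv (Set.Ioo s t) 1 u g →
          ∀ᵐ x, x ∈ Set.Ioo s t → g x = iteratedDeriv 1 V x) →
        (∀ g, IsWeakDeriv (Set.Ioo s t) 2 u g → IsPrimitiveOn (deriv V) g s t) →
        SolvesOn (Set.Ioo s t) β γ c f u →
        IsPrimitiveOn (fun t => γ * u t - glue α fl fr t) (fun t => f t - c * u t) s t := by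
      rintro s t β V hst h1 h2 h3 h4 ⟨w₁, w₂, k1, k2, k3⟩
      refine ((h2.const_mul γ).sub ((h4 w₂ k2).const_mul β)).congr
        (fun x hx => by simp only [h1 hx]) ?_
      have hne : ∀ᵐ x : ℝ, x ≠ t := by simp [ae_iff, measure_singleton]
      filter_upwards [hne, h3 w₁ k1, (ae_restrict_iff' measurableSet_Ioo).1 k3] with x n1 n2 n3 n4
      have hx : x ∈ Set.Ioo s t := ⟨n4.1, lt_of_le_of_ne n4.2 n1⟩
      have n2' := n2 hx
      rw [iteratedDeriv_one] at n2'
      rw [← n2', ← n3 hx]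
      ring
    exact IsPrimitiveOn.trans (hside hα.1 hFl hpl (l5 1 (by omega)) l6 hex.left)
      (hside hα.2 hFr hpr (r5 1 (by omega)) r6 hex.right)

/-! ### The scheme as a collocation method -/

theorem IsPrimitiveOn.refl (f g : ℝ → ℝ) (s : ℝ) : IsPrimitiveOn f g s s :=
  ⟨le_rfl, IntervalIntegrable.refl, fun x hx => by
    obtain rfl : x = s := le_antisymm hx.2 hx.1
    simp⟩

theorem IsPrimitiveOn.of_partition {f g : ℝ → ℝ} {x : ℕ → ℝ} {N : ℕ}
    (h : ∀ i < N, IsPrimitiveOn f g (x i) (x (i + 1))) : IsPrimitiveOn f g (x 0) (x N) := by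
  induction N with
  | zero => exact IsPrimitiveOn.refl f g _
  | succ N ih => exact (ih fun i hi => h i (by omega)).trans (h N (by omega))

theorem exists_piecewise {x : ℕ → ℝ} {N : ℕ} (hx : ∀ i < N, x i ≤ x (i + 1))
    (φ : ℕ → ℝ → ℝ) : ∃ d : ℝ → ℝ, ∀ i < N, ∀ t ∈ Set.Ioc (x i) (x (i + 1)), d t = φ i t := by
  induction N with
  | zero => exact ⟨0, fun i hi => absurd hi (Nat.not_lt_zero i)⟩
  | succ N ih =>
    obtain ⟨d, hd⟩ := ih fun i hi => hx i (by omega)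
    have hmono : ∀ i j, i ≤ j → j ≤ N → x i ≤ x j := by
      intro i j hij
      induction j, hij using Nat.le_induction with
      | base => exact fun _ => le_rfl
      | succ j _ ih => exact fun h => (ih (by omega)).trans (hx j (by omega))
    refine ⟨fun t => if t ≤ x N then d t else φ N t, fun i hi t ht => ?_⟩
    rcases Nat.lt_succ_iff_lt_or_eq.1 hi with h | rfl
    · simp only [if_pos (ht.2.trans (hmono (i + 1) N h le_rfl)), hd i h t ht]
    · simp only [if_neg (not_le.2 ht.1)]

theorem IsPrimitiveOn.ae_deriv_eq {f g : ℝ → ℝ} {s t : ℝ} (h : IsPrimitiveOn f g s t) :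
    ∀ᵐ x, x ∈ Set.Ioo s t → deriv f x = g x := by
  filter_upwards [h.int.ae_hasDerivAt_integral] with x hx hx'
  have hx2 : x ∈ Set.uIcc s t := by
    rw [Set.uIcc_of_le h.le]
    exact Set.Ioo_subset_Icc_self hx'
  have := ((hx hx2 s Set.left_mem_uIcc).const_add (f s)).congr_of_eventuallyEq (f₁ := f) ?_
  · exact this.deriv
  · filter_upwards [isOpen_Ioo.mem_nhds hx'] with y hy
    exact h.eq y (Set.Ioo_subset_Icc_self hy)

/-- The coefficient is constant on a left neighbourhood of `g` that includes `g`, because `beta`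
takes its left value at `α`. The left derivative thus yields the flux even when a Gauss point falls
on the interface. -/
theorem flux_eq {α βm βp s t g : ℝ} (hm : 0 < βm) (hp : 0 < βp) {v : ℝ → ℝ} {q : ℝ[X]}
    (hv : IsPrimitiveOn v (fun t => 1 / beta α βm βp t * q.eval t) s t)
    (hg : g ∈ Set.Ioo s t) : flux α βm βp v g = q.eval g := by
  have hβ : 0 < beta α βm βp g := by unfold beta; split_ifs <;> assumption
  have hconst : ∀ᶠ y in 𝓝[≤] g, ∀ z ∈ Set.Icc y g, beta α βm βp z = beta α βm βp g := by
    by_cases h : g ≤ α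
    · filter_upwards with y z hz
      rw [beta, beta, if_pos (hz.2.trans h), if_pos h]
    · push Not at h
      filter_upwards [mem_nhdsWithin_of_mem_nhds (Ioi_mem_nhds h)] with y hy z hz
      rw [beta, beta, if_neg (not_le.2 (lt_of_lt_of_le hy hz.1)), if_neg (not_le.2 h)]
  have hd : HasDerivAt (fun y => v g + 1 / beta α βm βp g * ∫ z in g..y, q.eval z)
      (1 / beta α βm βp g * q.eval g) g :=
    ((intervalIntegral.integral_hasDerivAt_right (q.continuous.intervalIntegrable _ _)
      q.continuous.stronglyMeasurable.stronglyMeasurableAtFilter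
      q.continuous.continuousAt).const_mul _).const_add _
  have hd' : HasDerivWithinAt v (1 / beta α βm βp g * q.eval g) (Set.Iic g) g := by
    refine hd.hasDerivWithinAt.congr_of_eventuallyEq ?_ (by simp)
    filter_upwards [hconst, self_mem_nhdsWithin,
      mem_nhdsWithin_of_mem_nhds (Ioi_mem_nhds hg.1)] with y hy hyg hys
    have hyg' : y ≤ g := hyg
    have hys' : s < y := hys
    have e := hv.integral_eq (Set.Ioo_subset_Icc_self hg)
      (⟨hys'.le, hyg'.trans hg.2.le⟩ : y ∈ Set.Icc s t)
    have e2 : ∫ z in g..y, 1 / beta α βm βp z * q.eval z =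
        1 / beta α βm βp g * ∫ z in g..y, q.eval z := by
      rw [← intervalIntegral.integral_const_mul]
      refine intervalIntegral.integral_congr fun z hz => ?_
      rw [Set.uIcc_of_ge hyg'] at hz
      simp only [hy z hz]
    rw [← e2, e]
    ring
  rw [flux, hd'.derivWithin (uniqueDiffOn_Iic g g Set.self_mem_Iic)]
  field_simp

theorem sum_sum_single {S : Finset ℕ} {T : ℕ → Finset ℕ} {i₁ j₁ : ℕ} (hi : i₁ ∈ S)
    (hj : j₁ ∈ T i₁) (φ : ℕ → ℕ → ℝ) :
    ∑ i ∈ S, ∑ j ∈ T i, (if i = i₁ ∧ j = j₁ then 1 else 0) * φ i j = φ i₁ j₁ := by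
  rw [Finset.sum_eq_single_of_mem i₁ hi, Finset.sum_eq_single_of_mem j₁ hj]
  · simp
  · intro j _ hne
    simp [hne]
  · intro i _ hne
    exact Finset.sum_eq_zero fun j _ => by simp [hne]

section Scheme

variable {a b α βm βp γ c : ℝ} {p N k : ℕ} {x : ℕ → ℝ} {f uT : ℝ → ℝ}

theorem integral_mul_indicator_Icc {g g' : ℝ} (hag : a ≤ g) (hgg : g ≤ g') (hgb : g' ≤ b)
    (f : ℝ → ℝ) :
    ∫ t in a..b, f t * (Set.Icc g g').indicator 1 t = ∫ t in g..g', f t := by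
  have hab : a ≤ b := hag.trans (hgg.trans hgb)
  have e : ∀ t, f t * (Set.Icc g g').indicator 1 t = (Set.Icc g g').indicator f t := by
    intro t
    by_cases ht : t ∈ Set.Icc g g' <;> simp [ht]
  simp only [e]
  rw [intervalIntegral.integral_of_le hab, intervalIntegral.integral_of_le hgg,
    ← integral_Icc_eq_integral_Ioc, setIntegral_indicator measurableSet_Icc,
    Set.inter_eq_self_of_subset_right (Set.Icc_subset_Icc hag hgb), integral_Icc_eq_integral_Ioc]

/-- The scheme on the control volume of `(i₀, j₀)`, where `(i₁, j₁)` is the index of the next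
Gauss point. -/
theorem IsIFVSolution.control_volume (h : IsIFVSolution a b α βm βp γ c p N k x f uT)
    {i₀ j₀ i₁ j₁ : ℕ} (hi₀ : i₀ ∈ Finset.Icc 1 N) (hj₀ : j₀ ∈ Finset.Icc 1 p)
    (hi₁ : i₁ ∈ Finset.Icc 1 N) (hj₁ : j₁ ∈ Finset.Icc 1 p)
    (hnext : (i₁ = i₀ ∧ j₁ = j₀ + 1) ∨ (j₀ = p ∧ i₁ = i₀ + 1 ∧ j₁ = 1)) :
    flux α βm βp uT (gaussPt α βm βp p k x i₀ j₀) -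
      flux α βm βp uT (gaussPt α βm βp p k x i₁ j₁) +
      ∫ t in (gaussPt α βm βp p k x i₀ j₀)..(gaussPt α βm βp p k x i₁ j₁),
        (γ * deriv uT t + c * uT t) =
    ∫ t in a..b, f t * (Set.Icc (gaussPt α βm βp p k x i₀ j₀)
      (gaussPt α βm βp p k x i₁ j₁)).indicator 1 t := by
  rw [Finset.mem_Icc] at hi₀ hj₀ hi₁ hj₁
  have hp1 : 1 ≤ p := hj₀.1.trans hj₀.2
  -- Testing with a single control volume leaves the fluxes at its two end points.
  set v : ℕ → ℕ → ℝ := fun i j => if i = i₀ ∧ j = j₀ then 1 else 0 with hv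
  have hg : gaussPt α βm βp p k x i₀ (j₀ + 1) = gaussPt α βm βp p k x i₁ j₁ := by
    rcases hnext with ⟨rfl, rfl⟩ | ⟨rfl, rfl, rfl⟩
    · rfl
    · exact gaussPt_succ hp1 i₀
  have hcv : j₀ ∈ Finset.Icc 1 (numCV p N i₀) := by
    rw [Finset.mem_Icc, numCV]
    split_ifs <;> omega
  have heq := h.eq v
  have htest : ∀ t, testFun α βm βp p N k x v t = (Set.Icc (gaussPt α βm βp p k x i₀ j₀)
      (gaussPt α βm βp p k x i₁ j₁)).indicator 1 t := by
    intro t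
    rw [testFun, ← hg]
    exact sum_sum_single (T := fun i => Finset.Icc 1 (numCV p N i)) (Finset.mem_Icc.2 hi₀) hcv
      fun i j => (Set.Icc (gaussPt α βm βp p k x i j) (gaussPt α βm βp p k x i (j + 1))).indicator
        1 t
  simp only [htest] at heq
  rw [← heq, bilin, sum_sum_single (T := fun i => Finset.Icc 1 (numCV p N i))
    (Finset.mem_Icc.2 hi₀) hcv fun i j => ∫ t in (gaussPt α βm βp p k x i j)..(gaussPt α βm βp p k
      x i (j + 1)), (γ * deriv uT t + c * uT t), hg]
  congr 1
  have hsplit : ∀ i ∈ Finset.Icc 1 N, ∑ j ∈ Finset.Icc 1 p,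
      (extCoef p N v i j - extCoef p N v i (j - 1)) *
        flux α βm βp uT (gaussPt α βm βp p k x i j) =
      ∑ j ∈ Finset.Icc 1 p, (if i = i₀ ∧ j = j₀ then 1 else 0) *
        flux α βm βp uT (gaussPt α βm βp p k x i j) -
      ∑ j ∈ Finset.Icc 1 p, (if i = i₁ ∧ j = j₁ then 1 else 0) *
        flux α βm βp uT (gaussPt α βm βp p k x i j) := by
    intro i hi
    rw [← Finset.sum_sub_distrib]
    refine Finset.sum_congr rfl fun j hj => ?_
    rw [Finset.mem_Icc] at hi hj
    rw [← sub_mul]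
    have e1 : extCoef p N v i j = if i = i₀ ∧ j = j₀ then 1 else 0 := by
      simp only [extCoef, hv]
      split_ifs <;> first | rfl | omega
    -- The predecessor of `(i, j)` is `(i₀, j₀)` exactly when `(i, j)` is the next Gauss point; for
    -- `j = 1` this is the convention `v_{i,0} = v_{i-1,p}`.
    have e2 : extCoef p N v i (j - 1) = if i = i₁ ∧ j = j₁ then 1 else 0 := by
      simp only [extCoef, hv]
      split_ifs <;> first | rfl | omega
    rw [e1, e2]
  rw [Finset.sum_congr rfl hsplit, Finset.sum_sub_distrib,
    sum_sum_single (T := fun _ => Finset.Icc 1 p) (Finset.mem_Icc.2 hi₀) (Finset.mem_Icc.2 hj₀)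
      fun i j => flux α βm βp uT (gaussPt α βm βp p k x i j),
    sum_sum_single (T := fun _ => Finset.Icc 1 p) (Finset.mem_Icc.2 hi₁) (Finset.mem_Icc.2 hj₁)
      fun i j => flux α βm βp uT (gaussPt α βm βp p k x i j)]

/-- In the Gauss points, the error of the flux is the convection and reaction part of the error,
up to a constant. -/
theorem IsIFVSolution.exists_flux_error_eq (h : IsIFVSolution a b α βm βp γ c p N k x f uT)
    (hx : IsPartition a b α N k x) (hm : 0 < βm) (hp : 0 < βp) (hp1 : 1 ≤ p)
    {u F z : ℝ → ℝ} {q : ℕ → ℝ[X]}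
    (huT : IsPrimitiveOn uT z a b)
    (hq : ∀ i ∈ Finset.Icc 1 N, IsPrimitiveOn uT
      (fun t => 1 / beta α βm βp t * (q i).eval t) (x (i - 1)) (x i))
    (hu : ContinuousOn u (Set.Icc a b))
    (hF : IsPrimitiveOn (fun t => γ * u t - F t) (fun t => f t - c * u t) a b) :
    ∃ K : ℝ, ∀ i ∈ Finset.Icc 1 N, ∀ j ∈ Finset.Icc 1 p,
      F (gaussPt α βm βp p k x i j) - (q i).eval (gaussPt α βm βp p k x i j) =
        γ * (u (gaussPt α βm βp p k x i j) - uT (gaussPt α βm βp p k x i j)) +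
          c * (∫ t in a..(gaussPt α βm βp p k x i j), (u t - uT t)) - K := by
  have hab : a ≤ b := hF.le
  have haI : a ∈ Set.Icc a b := ⟨le_rfl, hab⟩
  have hmem : ∀ i ∈ Finset.Icc 1 N, ∀ j ∈ Finset.Icc 1 p,
      gaussPt α βm βp p k x i j ∈ Set.Ioo a b := by
    intro i hi j hj
    have hg := gaussPt_mem hx hm hp hi hj
    rw [Finset.mem_Icc] at hi
    refine ⟨lt_of_le_of_lt ?_ hg.1, hg.2.trans_le ?_⟩
    · rw [← hx.left]; exact hx.mono (Nat.zero_le _) (by omega)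
    · rw [← hx.right]; exact hx.mono hi.2 le_rfl
  have hint : ∀ {w : ℝ → ℝ}, ContinuousOn w (Set.Icc a b) → ∀ {s t : ℝ}, s ∈ Set.Icc a b →
      t ∈ Set.Icc a b → IntervalIntegrable w volume s t := by
    intro w hw s t hs ht
    exact (hw.mono (Set.uIcc_subset_Icc hs ht)).intervalIntegrable
  set G : ℕ → ℕ → ℝ := fun i j =>
    γ * (u (gaussPt α βm βp p k x i j) - uT (gaussPt α βm βp p k x i j)) +
      c * (∫ t in a..(gaussPt α βm βp p k x i j), (u t - uT t)) -
      (F (gaussPt α βm βp p k x i j) - (q i).eval (gaussPt α βm βp p k x i j)) with hG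
  -- The scheme minus the integrated equation on a control volume says that `G` has no increment
  -- there; running through all Gauss points makes `G` a single constant, the required `K`.
  have hstep : ∀ i₀ ∈ Finset.Icc 1 N, ∀ j₀ ∈ Finset.Icc 1 p, ∀ i₁ ∈ Finset.Icc 1 N,
      ∀ j₁ ∈ Finset.Icc 1 p,
      ((i₁ = i₀ ∧ j₁ = j₀ + 1) ∨ (j₀ = p ∧ i₁ = i₀ + 1 ∧ j₁ = 1)) → G i₁ j₁ = G i₀ j₀ := by
    intro i₀ hi₀ j₀ hj₀ i₁ hi₁ j₁ hj₁ hnext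
    have hcv := h.control_volume hi₀ hj₀ hi₁ hj₁ hnext
    have hle : gaussPt α βm βp p k x i₀ j₀ ≤ gaussPt α βm βp p k x i₁ j₁ := by
      rcases hnext with ⟨rfl, rfl⟩ | ⟨rfl, rfl, rfl⟩
      · rw [Finset.mem_Icc] at hj₀ hj₁
        exact (gaussPt_lt hx hm hp hi₀ hj₀.1 (Nat.lt_succ_self _) hj₁.2).le
      · exact (gaussPt_mem hx hm hp hi₀ hj₀).2.le.trans (gaussPt_mem hx hm hp hi₁ hj₁).1.le
    have m0 := hmem i₀ hi₀ j₀ hj₀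
    have m1 := hmem i₁ hi₁ j₁ hj₁
    rw [flux_eq hm hp (hq i₀ hi₀) (gaussPt_mem hx hm hp hi₀ hj₀),
      flux_eq hm hp (hq i₁ hi₁) (gaussPt_mem hx hm hp hi₁ hj₁),
      integral_mul_indicator_Icc m0.1.le hle m1.2.le] at hcv
    simp only [hG]
    set s := gaussPt α βm βp p k x i₀ j₀ with hs
    set t := gaussPt α βm βp p k x i₁ j₁ with ht
    have n0 : s ∈ Set.Icc a b := Set.Ioo_subset_Icc_self m0
    have n1 : t ∈ Set.Icc a b := Set.Ioo_subset_Icc_self m1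
    have iu := hint hu n0 n1
    have iuT := hint huT.continuousOn n0 n1
    have e1 : ∫ y in s..t, (γ * deriv uT y + c * uT y) =
        γ * (uT t - uT s) + c * ∫ y in s..t, uT y := by
      rw [← huT.integral_eq n0 n1, ← intervalIntegral.integral_const_mul,
        ← intervalIntegral.integral_const_mul, ← intervalIntegral.integral_add
          ((huT.int_sub n0 n1).const_mul γ) (iuT.const_mul c)]
      refine intervalIntegral.integral_congr_ae ?_
      filter_upwards [huT.ae_deriv_eq] with y hy hy'
      rw [Set.uIoc_of_le hle] at hy'
      rw [hy ⟨m0.1.trans hy'.1, hy'.2.trans_lt m1.2⟩]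
    have e2 : ∫ y in s..t, f y = (γ * u t - F t) - (γ * u s - F s) + c * ∫ y in s..t, u y := by
      rw [← hF.integral_eq n0 n1, ← intervalIntegral.integral_const_mul,
        ← intervalIntegral.integral_add (hF.int_sub n0 n1) (iu.const_mul c)]
      refine intervalIntegral.integral_congr fun y _ => ?_
      ring
    have e3 : (∫ y in a..t, (u y - uT y)) = (∫ y in a..s, (u y - uT y)) +
        ((∫ y in s..t, u y) - ∫ y in s..t, uT y) := by
      rw [← intervalIntegral.integral_sub iu iuT]
      exact (intervalIntegral.integral_add_adjacent_intervals
        (hint (hu.sub huT.continuousOn) haI n0) (hint (hu.sub huT.continuousOn) n0 n1)).symm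
    rw [e1, e2] at hcv
    rw [e3]
    linarith
  have hrow : ∀ i ∈ Finset.Icc 1 N, ∀ j, 1 ≤ j → j ≤ p → G i j = G i 1 := by
    intro i hi j hj
    induction j, hj using Nat.le_induction with
    | base => exact fun _ => rfl
    | succ j hj ih =>
      intro hjp
      rw [hstep i hi j (Finset.mem_Icc.2 ⟨hj, by omega⟩) i hi (j + 1)
        (Finset.mem_Icc.2 ⟨by omega, hjp⟩) (Or.inl ⟨rfl, rfl⟩)]
      exact ih (by omega)
  have hcol : ∀ i, 1 ≤ i → i ≤ N → G i 1 = G 1 1 := by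
    intro i hi
    induction i, hi using Nat.le_induction with
    | base => exact fun _ => rfl
    | succ i hi ih =>
      intro hiN
      have hiI : i ∈ Finset.Icc 1 N := Finset.mem_Icc.2 ⟨hi, by omega⟩
      rw [hstep i hiI p (Finset.mem_Icc.2 ⟨hp1, le_rfl⟩) (i + 1)
        (Finset.mem_Icc.2 ⟨by omega, hiN⟩) 1 (Finset.mem_Icc.2 ⟨le_rfl, hp1⟩)
        (Or.inr ⟨rfl, rfl, rfl⟩), hrow i hiI p hp1 le_rfl]
      exact ih (by omega)
  refine ⟨G 1 1, fun i hi j hj => ?_⟩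
  have := hrow i hi j (Finset.mem_Icc.1 hj).1 (Finset.mem_Icc.1 hj).2
  rw [hcol i (Finset.mem_Icc.1 hi).1 (Finset.mem_Icc.1 hi).2] at this
  rw [← this]
  simp only [hG]
  ring

end Scheme

/-! ### The error estimate -/

theorem le_meshSize {N : ℕ} (x : ℕ → ℝ) {i : ℕ} (hi : i < N) :
    x (i + 1) - x i ≤ meshSize N x :=
  le_ciSup (f := fun i : Fin N => x (i.1 + 1) - x i.1) (Set.finite_range _).bddAbove ⟨i, hi⟩

theorem abs_sub_interpolate_le {p : ℕ} (hp : 1 ≤ p) {A B L : ℝ} {F : ℝ → ℝ}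
    (hF : ContDiff ℝ (p - 1 : ℕ) F)
    (hL : ∀ x y, |iteratedDeriv (p - 1) F x - iteratedDeriv (p - 1) F y| ≤ L * |x - y|)
    {J : Finset ℕ} (hJ : J.card = p) {g : ℕ → ℝ} (hg : Set.InjOn g J)
    (hgs : ∀ j ∈ J, g j ∈ Set.Icc A B) {x : ℝ} (hx : x ∈ Set.Icc A B) :
    |F x - (Lagrange.interpolate J g fun j => F (g j)).eval x| ≤ L * (B - A) ^ p := by
  have := abs_sub_interpolation_le (p - 1) hF hL (P := J.image g) (A := A) (B := B)
    (Q := Lagrange.interpolate J g fun j => F (g j))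
    (by rw [Finset.card_image_of_injOn hg, hJ]; omega)
    (fun z hz => by
      obtain ⟨j, hj, rfl⟩ := Finset.mem_image.1 hz
      exact hgs j hj)
    (by
      have h := Lagrange.degree_interpolate_lt (fun j => F (g j)) hg
      rw [hJ] at h
      exact Nat.le_sub_one_of_lt (by
        rcases eq_or_ne (Lagrange.interpolate J g fun j => F (g j)) 0 with h0 | h0
        · rw [h0, natDegree_zero]; exact hp
        · exact (natDegree_lt_iff_degree_lt h0).2 h))
    (fun z hz => by
      obtain ⟨j, hj, rfl⟩ := Finset.mem_image.1 hz
      exact (Lagrange.eval_interpolate_at_node (fun j => F (g j)) hg hj).symm) hx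
  rwa [Nat.sub_add_cancel hp] at this

theorem brokenH1Seminorm_le {a b α : ℝ} (hα : α ∈ Set.Ioo a b) {e z : ℝ → ℝ}
    (h : IsPrimitiveOn e z a b) {Z : ℝ → ℝ} (hZ : IntervalIntegrable Z volume a b)
    (hzZ : ∀ t, z t ^ 2 ≤ Z t) {R : ℝ} (hR : 0 ≤ R) (hZR : ∫ t in a..b, Z t ≤ R ^ 2) :
    brokenH1Seminorm a b α e ≤ ENNReal.ofReal R := by
  have hle : ∀ {s t : ℝ}, a ≤ s → s < t → t ≤ b → seminorm (Set.Ioo s t) 1 2 e ^ 2 ≤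
      ∫⁻ y in Set.Ioo s t, ENNReal.ofReal (Z y) := by
    intro s t has hst htb
    have hw := (h.mono has hst.le htb).isWeakDeriv hst
    rw [hw.seminorm_eq isOpen_Ioo]
    have e1 := eLpNorm_nnreal_pow_eq_lintegral (f := z) (μ := volume.restrict (Set.Ioo s t))
      (p := 2) two_ne_zero
    norm_num at e1
    rw [e1]
    refine lintegral_mono fun y => ?_
    rw [← enorm_pow, Real.enorm_eq_ofReal (sq_nonneg _)]
    exact ENNReal.ofReal_le_ofReal (hzZ y)
  have hsum : seminorm (Set.Ioo a α) 1 2 e ^ 2 + seminorm (Set.Ioo α b) 1 2 e ^ 2 ≤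
      ENNReal.ofReal (R ^ 2) := by
    refine (add_le_add (hle le_rfl hα.1 hα.2.le) (hle hα.1.le hα.2 le_rfl)).trans ?_
    rw [← lintegral_union measurableSet_Ioo
      (Set.disjoint_left.2 fun y hy hy' => lt_asymm hy.2 hy'.1)]
    have hsub : Set.Ioo a α ∪ Set.Ioo α b ⊆ Set.Ioc a b :=
      Set.union_subset (fun y hy => ⟨hy.1, (hy.2.trans hα.2).le⟩)
        fun y hy => ⟨hα.1.trans hy.1, hy.2.le⟩
    refine (lintegral_mono_set hsub).trans ?_
    rw [← ofReal_integral_eq_lintegral_ofReal hZ.1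
      (Eventually.of_forall fun y => (sq_nonneg _).trans (hzZ y)),
      ← intervalIntegral.integral_of_le h.le]
    exact ENNReal.ofReal_le_ofReal hZR
  refine (ENNReal.rpow_le_rpow hsum (by norm_num)).trans (le_of_eq ?_)
  rw [ENNReal.ofReal_rpow_of_nonneg (sq_nonneg R) (by norm_num), ← Real.sqrt_eq_rpow,
    Real.sqrt_sq hR]

/-- The energy estimate for the error of the scheme. -/
theorem brokenH1Seminorm_error_le {a b α βm βp γ c : ℝ} {p N k : ℕ} {x : ℕ → ℝ}
    {f u uT : ℝ → ℝ} (hab : a < b) (hp : 1 ≤ p) (hc : 0 ≤ c) (hm : 0 < βm) (hβp : 0 < βp)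
    (hα : α ∈ Set.Ioo a b) (hx : IsPartition a b α N k x)
    (hsmall : meshSize N x *
      (1 / 2 + 4 * (1 / min βm βp) ^ 2 * (γ ^ 2 + c ^ 2 * (b - a) ^ 2)) ≤ 1 / 4)
    (hu : MemWTilde a b α βm βp (p + 1) ∞ u) (hex : IsExactSolution a b α βm βp γ c f u)
    (hT : IsIFVSolution a b α βm βp γ c p N k x f uT) :
    brokenH1Seminorm a b α (u - uT) ≤
      ENNReal.ofReal (Real.sqrt (2 * (b - a)) * (max βm βp / min βm βp) * meshSize N x ^ p) *
        brokenWInftyNorm a b α (p + 1) u := by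
  obtain ⟨F, M, hM0, hMle, hF1, hF2, hF3, hF4⟩ := exists_smooth_flux hp hm hβp hα hu hex
  have hw : IsWeight fun t => 1 / beta α βm βp t := isWeight_one_div_beta hm hβp
  set h := meshSize N x with hh
  have hmin : 0 < min βm βp := lt_min hm hβp
  have hmax : 0 < max βm βp := lt_max_of_lt_left hm
  have hΩ : ∀ t, 1 / beta α βm βp t ≤ 1 / min βm βp := by
    intro t
    unfold beta
    split_ifs
    · exact one_div_le_one_div_of_le hmin (min_le_left _ _)
    · exact one_div_le_one_div_of_le hmin (min_le_right _ _)
  have hI : ∀ i < N, i + 1 ∈ Finset.Icc 1 N := fun i hi => Finset.mem_Icc.2 ⟨by omega, by omega⟩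
  have hlt : ∀ i < N, x i < x (i + 1) := fun i hi => hx.lt (i + 1) (hI i hi)
  have hN : 0 < N := by
    have := Finset.mem_Icc.1 hx.mem
    omega
  have hh0 : 0 ≤ h := (sub_nonneg.2 (hlt 0 hN).le).trans (le_meshSize x hN)
  have hq : ∀ i, ∃ q : ℝ[X], i ∈ Finset.Icc 1 N → q.degree < p ∧ IsPrimitiveOn uT
      (fun t => 1 / beta α βm βp t * q.eval t) (x (i - 1)) (x i) := by
    intro i
    by_cases hi : i ∈ Finset.Icc 1 N
    · obtain ⟨q, h1⟩ := hT.mem.exists_isPrimitiveOn hx hm hβp hp hi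
      exact ⟨q, fun _ => h1⟩
    · exact ⟨0, fun h => absurd h hi⟩
  choose q hq using hq
  obtain ⟨d, hd⟩ := exists_piecewise (fun i hi => (hlt i hi).le)
    fun i t => F t - (q (i + 1)).eval t
  have hTp : IsPrimitiveOn uT (fun t => 1 / beta α βm βp t * (F t - d t)) a b := by
    rw [← hx.left, ← hx.right]
    refine IsPrimitiveOn.of_partition fun i hi => ?_
    have := (hq (i + 1) (hI i hi)).2
    rw [Nat.add_sub_cancel] at this
    refine this.congr (fun _ _ => rfl) (Eventually.of_forall fun t ht => ?_)
    rw [hd i hi t ht]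
    ring
  have hep : IsPrimitiveOn (u - uT) (fun t => 1 / beta α βm βp t * d t) a b :=
    (hF3.sub hTp).congr (fun _ _ => rfl) (Eventually.of_forall fun t _ => by ring)
  obtain ⟨K, hK⟩ := hT.exists_flux_error_eq hx hm hβp hp hTp (fun i hi => (hq i hi).2)
    hu.continuousOn hF4
  have hcard : (Finset.Icc 1 p).card = p := by simp
  have H : CollocationError (fun t => 1 / beta α βm βp t) a b N x (Finset.Icc 1 p)
      (fun i => gaussPt α βm βp p k x (i + 1)) F d (u - uT) (fun i => q (i + 1)) :=
    { left := hx.left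
      right := hx.right
      lt := hlt
      nonempty := ⟨1, Finset.mem_Icc.2 ⟨le_rfl, hp⟩⟩
      inj := fun i hi => gaussPt_injOn hx hm hβp (hI i hi)
      mem := fun i hi j hj => Set.Ioo_subset_Icc_self (gaussPt_mem hx hm hβp (hI i hi) hj)
      orth := fun i hi r hr =>
        integral_nodal_gaussPt_mul hx hm hβp (hI i hi) (by rwa [hcard] at hr)
      cont := hF1.continuous
      deg := fun i hi => by rw [hcard]; exact (hq (i + 1) (hI i hi)).1
      eq := hd
      prim := hep
      ea := by simp [hu.bc_left, hT.mem.bc_left]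
      eb := by simp [hu.bc_right, hT.mem.bc_right] }
  set L := max βm βp * M with hL
  have hL0 : 0 ≤ L := mul_nonneg hmax.le hM0
  have henergy := H.energy_le hw hΩ (B := L * h ^ p) (γ := γ) (c := c) (K := K) (h := h) hc
    (fun i hi t ht => (abs_sub_interpolate_le hp hF1 hF2 hcard (H.inj i hi) (H.mem i hi) ht).trans
      (mul_le_mul_of_nonneg_left (pow_le_pow_left₀ (sub_nonneg.2 (hlt i hi).le)
        (le_meshSize x hi) p) hL0))
    (fun i hi j hj => hK (i + 1) (hI i hi) j hj) (fun i hi => le_meshSize x hi) hsmall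
  have hint : IntervalIntegrable (fun t => 1 / beta α βm βp t * d t ^ 2) volume a b := by
    simpa using H.integrable hw (continuousOn_const (c := (1 : ℝ))) 2
  have hbound : brokenH1Seminorm a b α (u - uT) ≤
      ENNReal.ofReal (Real.sqrt (2 * (b - a)) * (max βm βp / min βm βp) * h ^ p * M) := by
    refine brokenH1Seminorm_le hα hep (hint.const_mul (1 / min βm βp)) (fun t => ?_)
      (by have := sub_pos.2 hab; positivity) ?_
    · have h1 : (1 / beta α βm βp t * d t) ^ 2 =
          1 / beta α βm βp t * (1 / beta α βm βp t * d t ^ 2) := by ring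
      rw [h1]
      exact mul_le_mul_of_nonneg_right (hΩ t) (mul_nonneg (hw.pos t).le (sq_nonneg _))
    · rw [intervalIntegral.integral_const_mul]
      refine (mul_le_mul_of_nonneg_left henergy (one_div_pos.2 hmin).le).trans (le_of_eq ?_)
      have hsq := Real.sq_sqrt (show 0 ≤ 2 * (b - a) by linarith)
      -- One factor `1 / min β` comes from `(w d) ^ 2 ≤ Ω w d ^ 2`, another from the energy
      -- estimate, and `(max β) ^ 2` from the interpolation error: together the squared ratio.
      rw [show (Real.sqrt (2 * (b - a)) * (max βm βp / min βm βp) * h ^ p * M) ^ 2 =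
        Real.sqrt (2 * (b - a)) ^ 2 * ((max βm βp / min βm βp) * h ^ p * M) ^ 2 by ring, hsq, hL]
      field_simp
  refine hbound.trans ?_
  rw [ENNReal.ofReal_mul (by have := sub_pos.2 hab; positivity)]
  exact mul_le_mul_right hMle _

end IFV

/-! ### The convergence theorem -/

theorem corollary3p4 (a b : ℝ) (hab : a < b) (p : ℕ) (hp : 1 ≤ p)
    (γ c ρ : ℝ) (hc : 0 ≤ c) :
    ∃ C : ℝ, 0 < C ∧
      ∀ βm βp : ℝ, 0 < βm → 0 < βp → max βm βp / min βm βp = ρ →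
        ∃ h₀ : ℝ, 0 < h₀ ∧
          ∀ (α : ℝ), α ∈ Set.Ioo a b →
          ∀ (N k : ℕ) (x : ℕ → ℝ), IFV.IsPartition a b α N k x → IFV.meshSize N x ≤ h₀ →
          ∀ f u uT : ℝ → ℝ,
            IFV.MemWTilde a b α βm βp (p + 1) ∞ u →
            IFV.IsExactSolution a b α βm βp γ c f u →
            IFV.IsIFVSolution a b α βm βp γ c p N k x f uT →
              IFV.brokenH1Seminorm a b α (u - uT) ≤
                ENNReal.ofReal (C * IFV.meshSize N x ^ p) *
                  IFV.brokenWInftyNorm a b α (p + 1) u := by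
  -- The constant is fixed before the coefficients are given, so the sign of `ρ` is not yet known;
  -- `|ρ|` and the summand `1` only secure positivity.
  refine ⟨Real.sqrt (2 * (b - a)) * |ρ| + 1, by positivity, fun βm βp hm hβp hρ => ?_⟩
  have hρ0 : 0 ≤ ρ := by rw [← hρ]; positivity
  set K := 1 / 2 + 4 * (1 / min βm βp) ^ 2 * (γ ^ 2 + c ^ 2 * (b - a) ^ 2) with hK
  have hK0 : 0 < K := by positivity
  -- The largest mesh size for which half of the energy survives the absorption; only here does the
  -- size of `min β`, rather than the ratio, matter.
  refine ⟨1 / (4 * K), by positivity, fun α hα N k x hx hh f u uT hu hex hT => ?_⟩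
  have hsmall : IFV.meshSize N x * K ≤ 1 / 4 := by
    refine (mul_le_mul_of_nonneg_right hh hK0.le).trans (le_of_eq ?_)
    field_simp
  refine (IFV.brokenH1Seminorm_error_le hab hp hc hm hβp hα hx hsmall hu hex hT).trans ?_
  refine mul_le_mul_left (ENNReal.ofReal_le_ofReal ?_) _
  have hN : 0 < N := by
    have := Finset.mem_Icc.1 hx.mem
    omega
  have hh0 : 0 ≤ IFV.meshSize N x :=
    (sub_nonneg.2 (hx.lt 1 (Finset.mem_Icc.2 ⟨le_rfl, hN⟩)).le).trans (IFV.le_meshSize x hN)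
  rw [hρ, abs_of_nonneg hρ0]
  exact mul_le_mul_of_nonneg_right (le_add_of_nonneg_right zero_le_one) (pow_nonneg hh0 p)
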